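/- Let $\lambda:[0,1]\to\mathbb R$ be decreasing and twice continuously differentiable with $\inf_{[0,1]}|\lambda'|>0$, and put $\Lambda(t)=\int_0^t\lambda(u)\,du$. Let $k$ be a twice differentiable symmetric probability density on $\mathbb R$ with support $[-1,1]$, let $b=b_n>0$ with $b\to0$ and $nb\to\infty$, and put $k_b(u)=b^{-1}k(u/b)$. Let $d\mu(t)=w(t)\,dt$ on $[0,1]$ with $w\ge0$ continuous on $[0,1]$, and let $p\ge1$. For each $n$ let $\Lambda_n$ be a cadlag process on $[0,1]$ and $B_n$ a process on the same probability space, where either every $B_n$ is a standard Brownian motion or every $B_n$ is a Brownian bridge on $[0,L(1)]$. Here $L:[0,1]\to[0,\infty)$ is strictly increasing and twice differentiable with $\sup|L''|<\infty$ and $\inf L'>0$. Assume that there are $q>5/2$ and $C_q>0$ such that for all $n$ and all $x\in(0,n]$ $$\mathbb P\Big(n^{1-1/q}\sup_{t\in[0,1]}\big|\Lambda_n(t)-\Lambda(t)-n^{-1/2}B_n(L(t))\big|>x\Big)\le C_qx^{-q}.$$ For $t\in[0,1]$ define, with all integrals over $[t-b,t+b]\cap[0,1]$, $$\tilde\lambda_n(t)=\int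 k_b(t-u)\,d\Lambda_n(u),\qquad Y_n(t)=b^{1/2}\int k_b(t-u)\,dB_n(L(u)),$$ $$g_{(n)}(t)=(nb)^{1/2}\Big(\int k_b(t-u)\lambda(u)\,du-\lambda(t)\Big).$$ Let $(\mathrm R)$ denote the conditions $b^{-1}n^{-1+1/q}=O(1)$ and $b^{p-1}n^{p-2+2/q}\to0$. (i) If $w(0)>0$, $\lambda(0)\ne0$ and $nb^3\to\infty$, then $$(nb)^{p/2}\,\mathbb E\Big[\int_0^b|\tilde\lambda_n(t)-\lambda(t)|^p\,d\mu(t)\Big]\to\infty.$$ (ii) If $bn^{1-1/p}\to0$, and if in addition $q\ge2p$ or $(\mathrm R)$ holds, then, in probability, $$b^{-1/2}\Big\{\int_0^b(nb)^{p/2}|\tilde\lambda_n(t)-\lambda(t)|^p\,d\mu(t)-\int_0^b|g_{(n)}(t)|^p\,d\mu(t)\Big\}\to0.$$ (iii) If $(\mathrm R)$ holds, then, in probability, $$b^{-1/2}\Big|\int_0^b(nb)^{p/2}|\tilde\lambda_n(t)-\lambda(t)|^p\,d\mu(t)-\int_0^b|Y_n(t)+g_{(n)}(t)|^p\,d\mu(t)\Big|\to0;$$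 if moreover $bn^{1-1/p}\to\infty$, $w(0)>0$ and $\lambda(0)\ne0$, then for every $0<c<1$ $$b^{-1}\,\mathrm{Var}\Big(\int_0^{cb}|Y_n(t)+g_{(n)}(t)|^p\,d\mu(t)\Big)\to\infty.$$ The same statements hold at the right endpoint, with $[0,b]$, $[0,cb]$, $w(0)$, $\lambda(0)$ replaced by $[1-b,1]$, $[1-cb,1]$, $w(1)$, $\lambda(1)$. -/

import Mathlib

open MeasureTheory Set Filter Topology
open scoped ENNReal NNReal

/-- A kernel: a twice differentiable symmetric probability density on `ℝ` with support
`[-1, 1]`. -/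
structure IsSmoothingKernel (k : ℝ → ℝ) : Prop where
  differentiable : Differentiable ℝ k
  differentiable_deriv : Differentiable ℝ (deriv k)
  symmetric : ∀ y, k (-y) = k y
  nonneg : ∀ y, 0 ≤ k y
  integral_eq_one : ∫ y, k y = 1
  support_eq : tsupport k = Icc (-1) 1

/-- `X` is right-continuous with left limits on `[0, 1]`. -/
def IsCadlagOnUnit (X : ℝ → ℝ) : Prop :=
  (∀ t ∈ Icc (0 : ℝ) 1, ContinuousWithinAt X (Icc t 1) t) ∧
    ∀ t ∈ Ioc (0 : ℝ) 1, ∃ l, Tendsto X (𝓝[Ico 0 t] t) (𝓝 l)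

/-- `I` is the Riemann–Stieltjes integral of `f` with respect to `X` over `[a, c]`: the sums
`∑ f (ξ i) (X (x (i + 1)) - X (x i))` over tagged partitions
`a = x 0 ≤ ξ 0 ≤ x 1 ≤ ⋯ ≤ x m = c` tend to `I` as the mesh tends to zero. -/
def HasRSIntegral (f X : ℝ → ℝ) (a c I : ℝ) : Prop :=
  ∀ ε > 0, ∃ δ > 0, ∀ (m : ℕ) (x ξ : ℕ → ℝ), x 0 = a → x m = c →
    (∀ i < m, x i ≤ ξ i ∧ ξ i ≤ x (i + 1) ∧ x (i + 1) - x i < δ) →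
    |∑ i ∈ Finset.range m, f (ξ i) * (X (x (i + 1)) - X (x i)) - I| < ε

open Classical in
/-- The Riemann–Stieltjes integral `∫_a^c f dX` (zero if it does not exist). For `f` continuously
differentiable it exists for every path `X` that is cadlag or continuous on `[a, c]`. It is the
Lebesgue–Stieltjes integral over `(a, c]` when `X` is moreover a step function, and the Wiener
integral when `X` is a path of a (time-changed) Brownian motion or Brownian bridge. -/
noncomputable def rsIntegral (f X : ℝ → ℝ) (a c : ℝ) : ℝ :=
  if h : ∃ I, HasRSIntegral f X a c I then h.choose else 0

/-- The Riemann–Stieltjes integral is unique. -/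
theorem HasRSIntegral.unique {f X : ℝ → ℝ} {a c I J : ℝ} (hac : a ≤ c)
    (hI : HasRSIntegral f X a c I) (hJ : HasRSIntegral f X a c J) : I = J := by
  by_contra hne
  have hpos : 0 < |I - J| / 2 := by
    have := abs_pos.mpr (sub_ne_zero.mpr hne)
    positivity
  obtain ⟨δ₁, hδ₁, h₁⟩ := hI _ hpos
  obtain ⟨δ₂, hδ₂, h₂⟩ := hJ _ hpos
  obtain ⟨m, hm⟩ := exists_nat_gt ((c - a) / min δ₁ δ₂)
  have hδ : 0 < min δ₁ δ₂ := lt_min hδ₁ hδ₂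
  have hm0 : (0 : ℝ) < m := lt_of_le_of_lt (div_nonneg (by linarith) hδ.le) hm
  have hstep : (c - a) / m < min δ₁ δ₂ := by
    rw [div_lt_iff₀ hδ] at hm
    rw [div_lt_iff₀ hm0]
    linarith
  have hstep0 : 0 ≤ (c - a) / m := div_nonneg (by linarith) hm0.le
  set x : ℕ → ℝ := fun i => a + i * ((c - a) / m) with hx
  have hx0 : x 0 = a := by simp [hx]
  have hxm : x m = c := by
    simp only [hx]
    field_simp
    ring
  have hdiff : ∀ i, x (i + 1) - x i = (c - a) / m := by
    intro i
    simp only [hx]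
    push_cast
    ring
  have e₁ := h₁ m x x hx0 hxm fun i _ => ⟨le_rfl, by linarith [hdiff i],
    by rw [hdiff]; exact hstep.trans_le (min_le_left _ _)⟩
  have e₂ := h₂ m x x hx0 hxm fun i _ => ⟨le_rfl, by linarith [hdiff i],
    by rw [hdiff]; exact hstep.trans_le (min_le_right _ _)⟩
  rw [abs_sub_comm] at e₁
  have := abs_sub_le I (∑ i ∈ Finset.range m, f (x i) * (X (x (i + 1)) - X (x i))) J
  linarith

theorem HasRSIntegral.rsIntegral_eq {f X : ℝ → ℝ} {a c I : ℝ} (hac : a ≤ c)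
    (h : HasRSIntegral f X a c I) : rsIntegral f X a c = I := by
  have hex : ∃ I, HasRSIntegral f X a c I := ⟨I, h⟩
  rw [rsIntegral, dif_pos hex]
  exact hex.choose_spec.unique hac h

/-- The rescaled kernel `k_b(u) = b⁻¹ k(u / b)`. -/
noncomputable def rescaledKernel (k : ℝ → ℝ) (b u : ℝ) : ℝ := b⁻¹ * k (u / b)

/-- `∫ k_b(t - u) dX(u)` for a path `X` on `[0, 1]`, the integral being over
`[t - b, t + b] ∩ [0, 1]`. With `X = Λ_n` this is the standard (uncorrected) kernel estimator. -/
noncomputable def kernelSmooth (k : ℝ → ℝ) (b : ℝ) (X : ℝ → ℝ) (t : ℝ) : ℝ :=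
  rsIntegral (fun u => rescaledKernel k b (t - u)) X (max 0 (t - b)) (min 1 (t + b))

/-- The scaled bias `g_(n)(t) = (n b)^{1/2} (∫_0^1 k_b(t - u) λ(u) du - λ(t))`. -/
noncomputable def scaledBias (k lam : ℝ → ℝ) (n : ℕ) (b t : ℝ) : ℝ :=
  Real.sqrt (n * b) * ((∫ u in (0 : ℝ)..1, rescaledKernel k b (t - u) * lam u) - lam t)

/-- The path `u ↦ B(L(u))`. -/
noncomputable def timeChanged {Ω : Type*} (B : ℝ≥0 → Ω → ℝ) (L : ℝ → ℝ) (ω : Ω) (u : ℝ) : ℝ :=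
  B (L u).toNNReal ω

/-- The Gaussian process `Y_n(t) = b^{1/2} ∫ k_b(t - u) dB(L(u))`. -/
noncomputable def gaussianSmooth {Ω : Type*} (k : ℝ → ℝ) (b : ℝ) (B : ℝ≥0 → Ω → ℝ) (L : ℝ → ℝ)
    (ω : Ω) (t : ℝ) : ℝ :=
  Real.sqrt b * kernelSmooth k b (timeChanged B L ω) t

/-- `X` restricted to `[0, T]` is a Brownian bridge from `0` to `0` of length `T`: a centred
Gaussian process with covariance `s - s t / T` for `s ≤ t`, and almost surely continuous paths. -/
structure IsBrownianBridge {Ω : Type*} [MeasurableSpace Ω] (T : ℝ≥0) (X : ℝ≥0 → Ω → ℝ)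
    (P : Measure Ω) : Prop where
  gaussian : ProbabilityTheory.IsGaussianProcess (fun (t : Icc (0 : ℝ≥0) T) => X t) P
  mean : ∀ t ≤ T, ∫ ω, X t ω ∂P = 0
  covariance : ∀ s t, s ≤ t → t ≤ T →
    ProbabilityTheory.covariance (X s) (X t) P = (s : ℝ) - s * t / T
  continuous : ∀ᵐ ω ∂P, ContinuousOn (fun t => X t ω) (Icc 0 T)

/-- The part of `[0, 1]` within distance `r` of the endpoint `e`: for `0 ≤ r ≤ 1`
this is `[0, r]` if `e = 0` and `[1 - r, 1]` if `e = 1`. -/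
def endRegion (e r : ℝ) : Set ℝ := {t ∈ Icc (0 : ℝ) 1 | |t - e| ≤ r}

/-- Convergence to zero in probability of random variables `Z n`, each defined on its own
probability space. -/
def TendstoZeroInProb {Ω : ℕ → Type*} [∀ n, MeasurableSpace (Ω n)] (P : ∀ n, Measure (Ω n))
    (Z : ∀ n, Ω n → ℝ) : Prop :=
  ∀ ε : ℝ, 0 < ε → Tendsto (fun n => P n {ω | ε ≤ |Z n ω|}) atTop (𝓝 0)

/-- The rates `b⁻¹ n^{-1 + 1/q} = O(1)` and `b^{p-1} n^{p - 2 + 2/q} → 0`. -/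
def CouplingRates (p q : ℝ) (b : ℕ → ℝ) : Prop :=
  ((fun n : ℕ => (b n)⁻¹ * (n : ℝ) ^ (-1 + 1 / q)) =O[atTop] fun _ => (1 : ℝ)) ∧
    Tendsto (fun n : ℕ => b n ^ (p - 1) * (n : ℝ) ^ (p - 2 + 2 / q)) atTop (𝓝 0)

/-! Everything rests on a pathwise decomposition. Integration by parts turns kernel smoothing into
an operator (`smoothed`) defined for every regulated path, linear in the path, and bounded by `C * M
/ b` when the path is bounded by `M`. Applied to `Λ_n = Λ + n^{-1/2} B_n ∘ L + error`, it gives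
`√(nb) (λ̃_n - λ) = Y_n + g_(n) + O(r_n)` uniformly in `t`, off an event of small probability. Here
`r_n = √(nb) / b * n^{-1+1/q}` is `couplingRate`.

The two main terms have different sizes. `Y_n(t)` is centred Gaussian with variance bounded in `n`
and `t`, so the average of `1 + |Y_n|^p` over a boundary region of length `b` (`gaussianLoad`) has
bounded expectation. The bias is `O(√(nb))`, and this order is exact within `c b` of an endpoint, `c
< 1`: there the kernel loses at least the mass `∫_c^1 k > 0` outside `[0,1]`, so `g_(n)` has
constant sign and modulus at least `a √(nb)` when `λ` does not vanish at the endpoint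
(`exists_le_scaledBias`).

(i) On half the boundary region the bias beats the coupling error because `n b^3 → ∞` and `q > 5/2`.
With probability at least 1/2 the scaled integral is then at least `b (a √(nb) - K)`, which tends to
infinity since `b √(nb) = √(n b^3)`.

(ii) and the first half of (iii) follow from `| |a+z|^p - |a|^p | ≤ C (|a|^{p-1} |z| + |z|^p)`.
After division by `√b`, removing the coupling error costs `√b (nb)^{(p-1)/2} r_n` and `√b r_n^p`,
and removing `Y_n` costs `√b (nb)^{(p-1)/2}`. The square of the last is `(b n^{1-1/p})^p`, and the
square of the first is the second expression in (R).

The variance in (iii) is bounded below by Cauchy–Schwarz against one increment `N` of the path over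
a window of length `2b` containing all smoothing windows: `Var F ≥ Cov(F, N)^2 / E N^2`. Gaussian
regression reduces `Cov(|Y+g|^p, N)` to `Cov(Y, N) / Var Y` times `E[Y |Y+g|^p]`, and the latter is
at least `(p/4) g^{p-1} Var Y` for large positive `g`. With `Cov(Y, N) ≥ const * √b` and `E N^2 ≤
const * b`, this gives `b^{-1} Var F ≥ const * (b n^{1-1/p})^p`.

Brownian motion and bridge are treated together through the covariance `L u - θ L u L v`, where `θ =
0` or `θ = 1 / L 1`. -/

/-! ### The kernel: boundary values and bounds. -/

namespace IsSmoothingKernel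

variable {k : ℝ → ℝ}

theorem continuous (hk : IsSmoothingKernel k) : Continuous k := hk.differentiable.continuous

theorem continuous_deriv (hk : IsSmoothingKernel k) : Continuous (deriv k) :=
  hk.differentiable_deriv.continuous

theorem eq_zero_of_one_lt_abs (hk : IsSmoothingKernel k) {y : ℝ} (hy : 1 < |y|) : k y = 0 := by
  by_contra h
  have h1 : y ∈ tsupport k := subset_tsupport k h
  rw [hk.support_eq] at h1
  exact absurd (abs_le.2 ⟨h1.1, h1.2⟩) (not_le.2 hy)

/-- The support condition leaves `±1` open; continuity from outside decides it. The boundary terms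
of the integration by parts then vanish at the ends of an interior window. -/
theorem eq_zero (hk : IsSmoothingKernel k) {y : ℝ} (hy : 1 ≤ |y|) : k y = 0 := by
  rcases hy.lt_or_eq with h | h
  · exact hk.eq_zero_of_one_lt_abs h
  have key : k 1 = 0 := by
    have h1 : Tendsto k (𝓝[>] 1) (𝓝 (k 1)) := hk.continuous.continuousAt.tendsto.mono_left inf_le_left
    have h2 : Tendsto k (𝓝[>] 1) (𝓝 0) := by
      refine tendsto_const_nhds.congr' ?_
      filter_upwards [self_mem_nhdsWithin] with z hz
      exact (hk.eq_zero_of_one_lt_abs (lt_of_lt_of_le hz (le_abs_self z))).symm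
    exact tendsto_nhds_unique h1 h2
  rcases eq_or_eq_neg_of_abs_eq h.symm with h | h
  · rw [h, key]
  · rw [h, hk.symmetric, key]

/-- A zero of a nonnegative function is a minimum. -/
theorem deriv_eq_zero (hk : IsSmoothingKernel k) {y : ℝ} (hy : 1 ≤ |y|) : deriv k y = 0 := by
  have hz : k y = 0 := hk.eq_zero hy
  have hmin : IsLocalMin k y := Eventually.of_forall fun z => by rw [hz]; exact hk.nonneg z
  exact hmin.deriv_eq_zero

theorem hasCompactSupport (hk : IsSmoothingKernel k) : HasCompactSupport k := by
  rw [HasCompactSupport, hk.support_eq]; exact isCompact_Icc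

theorem exists_bound (hk : IsSmoothingKernel k) :
    ∃ K : ℝ, 0 < K ∧ (∀ y, |k y| ≤ K) ∧ ∀ y, |deriv k y| ≤ K := by
  obtain ⟨K₀, h₀⟩ := hk.hasCompactSupport.exists_bound_of_continuous hk.continuous
  obtain ⟨K₁, h₁⟩ := hk.hasCompactSupport.deriv.exists_bound_of_continuous hk.continuous_deriv
  refine ⟨max 1 (max K₀ K₁), by positivity, fun y => (h₀ y).trans ?_, fun y => (h₁ y).trans ?_⟩
  · exact (le_max_left _ _).trans (le_max_right _ _)
  · exact (le_max_right _ _).trans (le_max_right _ _)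

end IsSmoothingKernel

/-! ### Regulated paths and existence of the Riemann–Stieltjes integral. -/

/-- `X` is bounded on `[0, 1]`, measurable there, and the oscillation of `X` over short subintervals
of `[0, 1]` is small except over those which meet a finite set. -/
structure IsRegulatedOnUnit (X : ℝ → ℝ) : Prop where
  bounded : ∃ M, ∀ t ∈ Icc (0 : ℝ) 1, |X t| ≤ M
  aestronglyMeasurable : AEStronglyMeasurable X (volume.restrict (Icc 0 1))
  oscillation : ∀ ε > 0, ∃ S : Finset ℝ, ∃ δ > 0, ∀ u ∈ Icc (0 : ℝ) 1, ∀ v ∈ Icc (0 : ℝ) 1,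
    |u - v| < δ → ε < |X u - X v| → ∃ s ∈ S, s ∈ uIcc u v

/-- Near `t` the path stays within `ε / 2` of `X t` on the right and of the left limit on the left,
so an oscillation larger than `ε` must straddle `t`. -/
theorem IsCadlagOnUnit.exists_nhds {X : ℝ → ℝ} (hX : IsCadlagOnUnit X) {ε : ℝ} (hε : 0 < ε)
    (t : ℝ) (ht : t ∈ Icc (0 : ℝ) 1) : ∃ U : Set ℝ, IsOpen U ∧ t ∈ U ∧
      (∀ u ∈ U, ∀ v ∈ U, u ∈ Icc (0 : ℝ) 1 → v ∈ Icc (0 : ℝ) 1 → ε < |X u - X v| →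
        t ∈ uIcc u v) ∧
      ∃ M, ∀ u ∈ U, u ∈ Icc (0 : ℝ) 1 → |X u| ≤ M := by
  have hr : ∃ U : Set ℝ, IsOpen U ∧ t ∈ U ∧ ∀ u ∈ U, u ∈ Icc t 1 → |X u - X t| < ε / 2 := by
    have h := Metric.tendsto_nhds.1 (hX.1 t ht) (ε / 2) (by positivity)
    obtain ⟨U, h, hU, htU⟩ := eventually_nhds_iff.1 (eventually_nhdsWithin_iff.1 h)
    exact ⟨U, hU, htU, fun u hu hu' => by simpa [Real.dist_eq] using h u hu hu'⟩
  have hl : ∃ l : ℝ, ∃ U : Set ℝ, IsOpen U ∧ t ∈ U ∧ ∀ u ∈ U, u ∈ Ico 0 t → |X u - l| < ε / 2 := by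
    rcases ht.1.eq_or_lt with h0 | h0
    · exact ⟨0, univ, isOpen_univ, mem_univ _, fun u _ hu => by
        rw [← h0] at hu; exact absurd hu.1 (not_le.2 hu.2)⟩
    obtain ⟨l, hl⟩ := hX.2 t ⟨h0, ht.2⟩
    have h := Metric.tendsto_nhds.1 hl (ε / 2) (by positivity)
    obtain ⟨U, h, hU, htU⟩ := eventually_nhds_iff.1 (eventually_nhdsWithin_iff.1 h)
    exact ⟨l, U, hU, htU, fun u hu hu' => by simpa [Real.dist_eq] using h u hu hu'⟩
  obtain ⟨U, hU, htU, hr⟩ := hr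
  obtain ⟨l, V, hV, htV, hl⟩ := hl
  refine ⟨U ∩ V, hU.inter hV, ⟨htU, htV⟩, ?_, max (|X t| + ε) (|l| + ε), ?_⟩
  · intro u hu v hv hu1 hv1 hgt
    by_contra hnot
    have hcase : (t ≤ u ∧ t ≤ v) ∨ (u < t ∧ v < t) := by
      rw [mem_uIcc] at hnot
      push Not at hnot
      rcases le_or_gt t u with h | h
      · rcases le_or_gt t v with h' | h'
        · exact Or.inl ⟨h, h'⟩
        · exact absurd (hnot.2 h'.le) (not_lt.2 h)
      · exact Or.inr ⟨h, hnot.1 h.le⟩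
    rcases hcase with ⟨h1, h2⟩ | ⟨h1, h2⟩
    · have a := hr u hu.1 ⟨h1, hu1.2⟩
      have b := hr v hv.1 ⟨h2, hv1.2⟩
      rw [abs_lt] at a b
      rw [lt_abs] at hgt
      rcases hgt with h | h <;> linarith
    · have a := hl u hu.2 ⟨hu1.1, h1⟩
      have b := hl v hv.2 ⟨hv1.1, h2⟩
      rw [abs_lt] at a b
      rw [lt_abs] at hgt
      rcases hgt with h | h <;> linarith
  · intro u hu hu1
    rcases le_or_gt t u with h | h
    · have a := hr u hu.1 ⟨h, hu1.2⟩
      have := abs_sub_abs_le_abs_sub (X u) (X t)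
      exact le_trans (by linarith) (le_max_left _ _)
    · have a := hl u hu.2 ⟨hu1.1, h⟩
      have := abs_sub_abs_le_abs_sub (X u) l
      exact le_trans (by linarith) (le_max_right _ _)

theorem IsCadlagOnUnit.aestronglyMeasurable {X : ℝ → ℝ} (hX : IsCadlagOnUnit X) :
    AEStronglyMeasurable X (volume.restrict (Icc 0 1)) := by
  -- approximate `X` from the right by step functions
  let r : ℕ → ℝ → ℝ := fun n u => min 1 ((⌊(n + 1 : ℝ) * u⌋ + 1) / (n + 1 : ℝ))
  have hr : ∀ n u, u ≤ 1 → u ≤ r n u := by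
    intro n u hu
    refine le_min hu ?_
    rw [le_div_iff₀ (by positivity)]
    have := (Int.lt_floor_add_one ((n + 1 : ℝ) * u)).le
    linarith
  have hr' : ∀ u, u ≤ 1 → Tendsto (fun n => r n u) atTop (𝓝 u) := by
    intro u hu
    have h1 : Tendsto (fun n : ℕ => u + 1 / ((n : ℝ) + 1)) atTop (𝓝 u) := by
      simpa using (tendsto_const_nhds (x := u)).add tendsto_one_div_add_atTop_nhds_zero_nat
    refine tendsto_of_tendsto_of_tendsto_of_le_of_le tendsto_const_nhds h1 (fun n => hr n u hu)
      fun n => (min_le_right _ _).trans ?_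
    have hn : (0 : ℝ) < n + 1 := by positivity
    rw [div_le_iff₀ hn, add_mul u, one_div, inv_mul_cancel₀ hn.ne']
    have := Int.floor_le ((n + 1 : ℝ) * u)
    linarith
  refine aestronglyMeasurable_of_tendsto_ae (u := atTop) (f := fun n u => X (r n u)) ?_ ?_
  · intro n
    have : (fun u => X (r n u)) = (fun j : ℤ => X (min 1 ((j + 1) / (n + 1 : ℝ)))) ∘
        fun u : ℝ => ⌊(n + 1 : ℝ) * u⌋ := rfl
    rw [this]
    refine Measurable.aestronglyMeasurable ?_
    exact (measurable_of_countable _).comp (Int.measurable_floor.comp (measurable_const_mul _))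
  · filter_upwards [ae_restrict_mem measurableSet_Icc] with u hu
    refine (hX.1 u hu).tendsto.comp (tendsto_nhdsWithin_iff.2 ⟨hr' u hu.2, ?_⟩)
    exact Eventually.of_forall fun n => ⟨hr n u hu.2, min_le_left _ _⟩

/-- Compactness of `[0, 1]`: the centres of a finite subcover are the exceptional points, and a
Lebesgue number of the cover is the admissible distance. -/
theorem IsCadlagOnUnit.isRegulatedOnUnit {X : ℝ → ℝ} (hX : IsCadlagOnUnit X) :
    IsRegulatedOnUnit X where
  bounded := by
    choose! U hUo htU _ hM using fun t ht => hX.exists_nhds one_pos t ht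
    choose! M hM using hM
    obtain ⟨S, hS, hcov⟩ := (isCompact_Icc (a := (0 : ℝ)) (b := 1)).elim_nhds_subcover U
      fun t ht => (hUo t ht).mem_nhds (htU t ht)
    refine ⟨∑ s ∈ S, |M s|, fun t ht => ?_⟩
    obtain ⟨s, hs, hts⟩ := mem_iUnion₂.1 (hcov ht)
    exact (hM s (hS s hs) t hts ht).trans ((le_abs_self _).trans
      (Finset.single_le_sum (f := fun s => |M s|) (fun _ _ => abs_nonneg _) hs))
  aestronglyMeasurable := hX.aestronglyMeasurable
  oscillation := by
    intro ε hε
    choose! U hUo htU hU _ using fun t ht => hX.exists_nhds hε t ht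
    obtain ⟨S, hS, hcov⟩ := (isCompact_Icc (a := (0 : ℝ)) (b := 1)).elim_nhds_subcover U
      fun t ht => (hUo t ht).mem_nhds (htU t ht)
    obtain ⟨δ, hδ, hleb⟩ := lebesgue_number_lemma_of_metric (s := Icc (0 : ℝ) 1)
      (c := fun s : S => U s) isCompact_Icc (fun s => hUo s (hS s s.2)) (by
        intro t ht
        obtain ⟨s, hs, hts⟩ := mem_iUnion₂.1 (hcov ht)
        exact mem_iUnion.2 ⟨⟨s, hs⟩, hts⟩)
    refine ⟨S, δ, hδ, fun u hu v hv huv hgt => ?_⟩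
    obtain ⟨s, hs⟩ := hleb u hu
    exact ⟨s, s.2, hU s (hS s s.2) u (hs (Metric.mem_ball_self hδ)) v
      (hs (by rw [Metric.mem_ball, Real.dist_eq, abs_sub_comm]; exact huv)) hu hv hgt⟩

theorem ContinuousOn.isCadlagOnUnit {X : ℝ → ℝ} (hX : ContinuousOn X (Icc 0 1)) :
    IsCadlagOnUnit X :=
  ⟨fun t ht => (hX t ht).mono (Icc_subset_Icc_left ht.1), fun t ht =>
    ⟨X t, ((hX t ⟨ht.1.le, ht.2⟩).mono fun _ hu => ⟨hu.1, hu.2.le.trans ht.2⟩).tendsto⟩⟩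

theorem IsRegulatedOnUnit.integrableOn {X : ℝ → ℝ} (hX : IsRegulatedOnUnit X) :
    IntegrableOn X (Icc 0 1) := by
  obtain ⟨M, hM⟩ := hX.bounded
  refine Integrable.of_bound hX.aestronglyMeasurable M ?_
  filter_upwards [ae_restrict_mem measurableSet_Icc] with t ht using hM t ht

theorem partition_le_of_le {m : ℕ} {x : ℕ → ℝ} (hx : ∀ i < m, x i ≤ x (i + 1)) :
    ∀ j ≤ m, ∀ i ≤ j, x i ≤ x j := by
  intro j
  induction j with
  | zero => intro _ i hi; rw [Nat.le_zero.1 hi]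
  | succ j ih =>
    intro hj i hi
    rcases Nat.le_succ_iff.1 hi with h | h
    · exact (ih (by omega) i h).trans (hx j (by omega))
    · rw [h]

/-- Integration by parts: a regulated path has a Riemann–Stieltjes integral against a continuously
differentiable integrand. -/
theorem IsRegulatedOnUnit.hasRSIntegral {X f f' : ℝ → ℝ} (hX : IsRegulatedOnUnit X)
    (hf : ∀ u, HasDerivAt f (f' u) u) (hf' : Continuous f') {a c : ℝ} (ha : 0 ≤ a) (hac : a ≤ c)
    (hc : c ≤ 1) :
    HasRSIntegral f X a c (f c * X c - f a * X a - ∫ u in a..c, X u * f' u) := by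
  obtain ⟨M, hM⟩ := hX.bounded
  have hM0 : 0 ≤ M := (abs_nonneg _).trans (hM 0 ⟨le_rfl, zero_le_one⟩)
  obtain ⟨K, hK⟩ := (isCompact_Icc (a := (0 : ℝ)) (b := 1)).exists_bound_of_continuousOn
    hf'.continuousOn
  have hK0 : 0 ≤ K := (norm_nonneg _).trans (hK 0 ⟨le_rfl, zero_le_one⟩)
  have hXi : ∀ u ∈ Icc (0 : ℝ) 1, ∀ v ∈ Icc (0 : ℝ) 1, IntervalIntegrable X volume u v := by
    intro u hu v hv
    exact (hX.integrableOn.mono_set (uIcc_subset_Icc hu hv)).intervalIntegrable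
  intro ε hε
  -- Half of `ε` pays for the oscillation `η` away from the exceptional points; the other half,
  -- through `δ`, pays for the neighbourhoods of these points.
  obtain ⟨η, hη, hηε⟩ : ∃ η > 0, K * η < ε / 2 := by
    refine ⟨ε / (2 * (K + 1)), by positivity, ?_⟩
    rw [mul_div_assoc', div_lt_div_iff₀ (by positivity) (by positivity)]
    nlinarith
  obtain ⟨S, δ₀, hδ₀, hosc⟩ := hX.oscillation η hη
  obtain ⟨δ, hδ, hδ₀', hδε⟩ : ∃ δ > 0, δ ≤ δ₀ ∧ K * (2 * M * (S.card * (2 * δ))) < ε / 2 := by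
    refine ⟨min δ₀ (ε / (2 * (K * (2 * M * (S.card * 2)) + 1))), by positivity, min_le_left _ _, ?_⟩
    have h1 := min_le_right δ₀ (ε / (2 * (K * (2 * M * (S.card * 2)) + 1)))
    set δ := min δ₀ (ε / (2 * (K * (2 * M * (S.card * 2)) + 1)))
    have h2 : 0 ≤ K * (2 * M * (S.card * 2)) := by positivity
    have h3 : K * (2 * M * (S.card * (2 * δ))) = (K * (2 * M * (S.card * 2))) * δ := by ring
    rw [h3]
    calc _ ≤ (K * (2 * M * (S.card * 2))) * (ε / (2 * (K * (2 * M * (S.card * 2)) + 1))) := by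
          gcongr
      _ < ε / 2 := by
          rw [mul_div_assoc', div_lt_div_iff₀ (by positivity) (by positivity)]
          nlinarith
  -- An integrable majorant of the oscillation: `η` everywhere, plus the trivial bound `2 * M`
  -- within `δ` of each exceptional point.
  let h : ℝ → ℝ := fun u => η + ∑ s ∈ S, (Ioo (s - δ) (s + δ)).indicator (fun _ => 2 * M) u
  have hhsum : ∀ u v, IntervalIntegrable
      (fun u => ∑ s ∈ S, (Ioo (s - δ) (s + δ)).indicator (fun _ => 2 * M) u) volume u v := by
    intro u v
    refine IntegrableOn.intervalIntegrable ?_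
    refine integrable_finsetSum _ fun s _ => ?_
    exact (integrableOn_const (by simp)).indicator measurableSet_Ioo
  have hh : ∀ u v, IntervalIntegrable h volume u v := fun u v =>
    intervalIntegrable_const.add (hhsum u v)
  have hosc' : ∀ u ∈ Icc (0 : ℝ) 1, ∀ v ∈ Icc (0 : ℝ) 1, |u - v| < δ → |X u - X v| ≤ h u := by
    intro u hu v hv huv
    have hnn : ∀ s ∈ S, 0 ≤ (Ioo (s - δ) (s + δ)).indicator (fun _ => 2 * M) u :=
      fun s _ => indicator_nonneg (fun _ _ => by positivity) _
    rcases le_or_gt |X u - X v| η with h1 | h1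
    · have := Finset.sum_nonneg hnn
      simp only [h]; linarith
    · obtain ⟨s, hs, hsuv⟩ := hosc u hu v hv (huv.trans_le hδ₀') h1
      have hmem : u ∈ Ioo (s - δ) (s + δ) := by
        rw [abs_lt] at huv
        rcases mem_uIcc.1 hsuv with h2 | h2 <;> constructor <;> linarith
      have h3 := Finset.single_le_sum hnn hs
      rw [indicator_of_mem hmem] at h3
      have h4 := abs_sub (X u) (X v)
      have h5 := hM u hu
      have h6 := hM v hv
      simp only [h]; linarith
  refine ⟨δ, hδ, fun m x ξ hx0 hxm hpart => ?_⟩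
  have hmono := partition_le_of_le (m := m) (x := x) fun i hi => (hpart i hi).1.trans (hpart i hi).2.1
  have hmem : ∀ i ≤ m, x i ∈ Icc a c := fun i hi =>
    ⟨hx0 ▸ hmono i hi 0 (Nat.zero_le _), hxm ▸ hmono m le_rfl i hi⟩
  have hmem1 : ∀ i ≤ m, x i ∈ Icc (0 : ℝ) 1 := fun i hi => Icc_subset_Icc ha hc (hmem i hi)
  have hξ : ∀ i < m, ξ i ∈ Icc (0 : ℝ) 1 := fun i hi =>
    ⟨(hmem1 i hi.le).1.trans (hpart i hi).1, (hpart i hi).2.1.trans (hmem1 (i + 1) hi).2⟩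
  have hXf : ∀ u ∈ Icc (0 : ℝ) 1, ∀ v ∈ Icc (0 : ℝ) 1,
      IntervalIntegrable (fun u => X u * f' u) volume u v := fun u hu v hv =>
    (hXi u hu v hv).mul_continuousOn hf'.continuousOn
  have hd : ∀ u v, IntervalIntegrable f' volume u v := fun u v => hf'.intervalIntegrable u v
  have hftc : ∀ u v, ∫ z in u..v, f' z = f v - f u := fun u v =>
    intervalIntegral.integral_eq_sub_of_hasDerivAt (fun z _ => hf z) (hd u v)
  have htel : f c * X c - f a * X a =
      ∑ i ∈ Finset.range m, (f (x (i + 1)) * X (x (i + 1)) - f (x i) * X (x i)) := by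
    rw [Finset.sum_range_sub (fun i => f (x i) * X (x i)), hx0, hxm]
  have hsumint : ∫ u in a..c, X u * f' u =
      ∑ i ∈ Finset.range m, ∫ u in x i..x (i + 1), X u * f' u := by
    rw [intervalIntegral.sum_integral_adjacent_intervals, hx0, hxm]
    exact fun i hi => hXf _ (hmem1 i hi.le) _ (hmem1 (i + 1) hi)
  have hsumh : ∫ u in a..c, h u = ∑ i ∈ Finset.range m, ∫ u in x i..x (i + 1), h u := by
    rw [intervalIntegral.sum_integral_adjacent_intervals, hx0, hxm]
    exact fun i hi => hh _ _
  have hpiece : ∀ u ∈ Icc (0 : ℝ) 1, ∀ v ∈ Icc (0 : ℝ) 1, ∀ y ∈ Icc (0 : ℝ) 1, u ≤ v →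
      (∀ z ∈ Icc u v, |z - y| < δ) →
      |(∫ z in u..v, X z * f' z) - X y * (f v - f u)| ≤ K * ∫ z in u..v, h z := by
    intro u hu v hv y hy huv hclose
    have e : (∫ z in u..v, X z * f' z) - X y * (f v - f u) = ∫ z in u..v, (X z - X y) * f' z := by
      rw [← hftc, ← intervalIntegral.integral_const_mul,
        ← intervalIntegral.integral_sub (hXf u hu v hv) ((hd u v).const_mul _)]
      congr 1; ext z; ring
    rw [e, ← intervalIntegral.integral_const_mul, ← Real.norm_eq_abs]
    refine intervalIntegral.norm_integral_le_of_norm_le huv ?_ ((hh u v).const_mul _)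
    refine Eventually.of_forall fun z hz => ?_
    have hz1 : z ∈ Icc (0 : ℝ) 1 := ⟨hu.1.trans hz.1.le, hz.2.trans hv.2⟩
    rw [norm_mul, mul_comm, Real.norm_eq_abs (X z - X y)]
    have := hosc' z hz1 y hy (hclose z ⟨hz.1.le, hz.2⟩)
    exact mul_le_mul (hK z hz1) this (abs_nonneg _) hK0
  -- Summation by parts inside one cell: the term equals the integral of `(X u - X (x i)) * f' u` up
  -- to `ξ i` plus that of `(X u - X (x (i + 1))) * f' u` from `ξ i` on, so the tag only decides
  -- which endpoint value is compared with `X u`.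
  have hterm : ∀ i < m, |f (ξ i) * (X (x (i + 1)) - X (x i))
      - (f (x (i + 1)) * X (x (i + 1)) - f (x i) * X (x i))
      + ∫ u in x i..x (i + 1), X u * f' u| ≤ K * ∫ u in x i..x (i + 1), h u := by
    intro i hi
    obtain ⟨h1, h2, h3⟩ := hpart i hi
    have hi0 := hmem1 i hi.le
    have hi1 := hmem1 (i + 1) hi
    have hξi := hξ i hi
    rw [← intervalIntegral.integral_add_adjacent_intervals (hh (x i) (ξ i)) (hh (ξ i) (x (i + 1))),
      ← intervalIntegral.integral_add_adjacent_intervals (hXf _ hi0 _ hξi) (hXf _ hξi _ hi1)]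
    have p1 := hpiece (x i) hi0 (ξ i) hξi (x i) hi0 h1 fun z hz => by
      rw [abs_lt]; constructor <;> linarith [hz.1, hz.2]
    have p2 := hpiece (ξ i) hξi (x (i + 1)) hi1 (x (i + 1)) hi1 h2 fun z hz => by
      rw [abs_lt]; constructor <;> linarith [hz.1, hz.2]
    rw [abs_le] at p1 p2 ⊢
    constructor <;> linarith [p1.1, p1.2, p2.1, p2.2]
  have hhint : ∫ u in a..c, h u ≤ η + S.card * (2 * δ) * (2 * M) := by
    have e : ∫ u in a..c, h u = (c - a) * η +
        ∑ s ∈ S, ∫ u in a..c, (Ioo (s - δ) (s + δ)).indicator (fun _ => 2 * M) u := by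
      have hi : ∀ s, IntervalIntegrable ((Ioo (s - δ) (s + δ)).indicator fun _ => 2 * M) volume a c :=
        fun s => IntegrableOn.intervalIntegrable
          ((integrableOn_const (by simp)).indicator measurableSet_Ioo)
      have := intervalIntegral.integral_finsetSum (μ := volume) (a := a) (b := c) (s := S)
        (f := fun s u => (Ioo (s - δ) (s + δ)).indicator (fun _ => 2 * M) u) fun s _ => hi s
      rw [← this]
      simp only [h]
      rw [intervalIntegral.integral_add intervalIntegrable_const]
      · simp
      · exact hhsum a c
    have hs : ∀ s ∈ S, ∫ u in a..c, (Ioo (s - δ) (s + δ)).indicator (fun _ => 2 * M) u ≤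
        2 * δ * (2 * M) := by
      intro s _
      rw [intervalIntegral.integral_of_le hac]
      calc _ ≤ ∫ u, (Ioo (s - δ) (s + δ)).indicator (fun _ => 2 * M) u :=
            setIntegral_le_integral
              ((integrable_indicator_iff measurableSet_Ioo).2 (integrableOn_const (by simp)))
              (Eventually.of_forall fun u => indicator_nonneg (fun _ _ => by positivity) u)
        _ = 2 * δ * (2 * M) := by
            rw [integral_indicator measurableSet_Ioo, setIntegral_const, smul_eq_mul,
              Measure.real, Real.volume_Ioo, ENNReal.toReal_ofReal (by linarith)]
            ring
    have h1 := Finset.sum_le_sum hs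
    rw [Finset.sum_const, nsmul_eq_mul] at h1
    have h2 : (c - a) * η ≤ 1 * η := by
      gcongr; linarith
    rw [e]; linarith
  calc |∑ i ∈ Finset.range m, f (ξ i) * (X (x (i + 1)) - X (x i)) -
        (f c * X c - f a * X a - ∫ u in a..c, X u * f' u)|
      = |∑ i ∈ Finset.range m, (f (ξ i) * (X (x (i + 1)) - X (x i))
      - (f (x (i + 1)) * X (x (i + 1)) - f (x i) * X (x i))
      + ∫ u in x i..x (i + 1), X u * f' u)| := by
        rw [htel, hsumint, ← Finset.sum_sub_distrib, ← Finset.sum_sub_distrib]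
        refine congrArg _ (Finset.sum_congr rfl fun i _ => ?_)
        ring
    _ ≤ ∑ i ∈ Finset.range m, K * ∫ u in x i..x (i + 1), h u :=
        (Finset.abs_sum_le_sum_abs _ _).trans
          (Finset.sum_le_sum fun i hi => hterm i (Finset.mem_range.1 hi))
    _ = K * ∫ u in a..c, h u := by rw [hsumh, Finset.mul_sum]
    _ ≤ K * (η + S.card * (2 * δ) * (2 * M)) := by gcongr
    _ < ε := by nlinarith

/-! ### The smoothing operator in integrated form. -/

/-- The kernel smoothing `∫ k_b(t - u) dX(u)` of a path on `[0, 1]`, after integration by parts. -/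
noncomputable def smoothed (k : ℝ → ℝ) (b : ℝ) (X : ℝ → ℝ) (t : ℝ) : ℝ :=
  b⁻¹ * k ((t - 1) / b) * X 1 - b⁻¹ * k (t / b) * X 0
    + (b ^ 2)⁻¹ * ∫ u in (0 : ℝ)..1, X u * deriv k ((t - u) / b)

theorem smoothed_congr {k X Y : ℝ → ℝ} {b : ℝ} (h : ∀ u ∈ Icc (0 : ℝ) 1, X u = Y u) (t : ℝ) :
    smoothed k b X t = smoothed k b Y t := by
  have : ∫ u in (0 : ℝ)..1, X u * deriv k ((t - u) / b) =
      ∫ u in (0 : ℝ)..1, Y u * deriv k ((t - u) / b) := by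
    refine intervalIntegral.integral_congr fun u hu => ?_
    rw [uIcc_of_le zero_le_one] at hu
    simp only [h u hu]
  rw [smoothed, smoothed, this, h 1 (by simp), h 0 (by simp)]

theorem IsSmoothingKernel.hasDerivAt_rescaledKernel {k : ℝ → ℝ} (hk : IsSmoothingKernel k)
    (b t u : ℝ) : HasDerivAt (fun u => rescaledKernel k b (t - u))
      (-((b ^ 2)⁻¹ * deriv k ((t - u) / b))) u := by
  have h1 : HasDerivAt (fun u : ℝ => (t - u) / b) (-1 / b) u :=
    ((hasDerivAt_id u).const_sub t).div_const b
  have h2 := ((hk.differentiable ((t - u) / b)).hasDerivAt.comp u h1).const_mul b⁻¹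
  refine h2.congr_deriv ?_
  rw [pow_two, mul_inv]; ring

theorem IsSmoothingKernel.continuous_deriv_comp {k : ℝ → ℝ} (hk : IsSmoothingKernel k)
    (b t : ℝ) : Continuous fun u => deriv k ((t - u) / b) :=
  hk.continuous_deriv.comp (by fun_prop)

theorem IsSmoothingKernel.eq_zero_div {k : ℝ → ℝ} (hk : IsSmoothingKernel k) {b x : ℝ} (hb : 0 < b)
    (h : b ≤ |x|) : k (x / b) = 0 := by
  refine hk.eq_zero ?_
  rw [abs_div, abs_of_pos hb, le_div_iff₀ hb]; linarith

theorem IsSmoothingKernel.deriv_eq_zero_div {k : ℝ → ℝ} (hk : IsSmoothingKernel k) {b x : ℝ}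
    (hb : 0 < b) (h : b ≤ |x|) : deriv k (x / b) = 0 := by
  refine hk.deriv_eq_zero ?_
  rw [abs_div, abs_of_pos hb, le_div_iff₀ hb]; linarith

theorem IsRegulatedOnUnit.intervalIntegrable {X : ℝ → ℝ} (hX : IsRegulatedOnUnit X) :
    IntervalIntegrable X volume 0 1 := by
  refine IntegrableOn.intervalIntegrable ?_
  rw [uIcc_of_le zero_le_one]; exact hX.integrableOn

/-- The Riemann–Stieltjes smoothing of a regulated path, and the fact that the integral exists. -/
theorem IsRegulatedOnUnit.hasRSIntegral_smoothed {k X : ℝ → ℝ} (hX : IsRegulatedOnUnit X)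
    (hk : IsSmoothingKernel k) {b : ℝ} (hb : 0 < b) {t : ℝ} (ht : t ∈ Icc (0 : ℝ) 1) :
    HasRSIntegral (fun u => rescaledKernel k b (t - u)) X (max 0 (t - b)) (min 1 (t + b))
      (smoothed k b X t) := by
  set a := max 0 (t - b) with ha
  set c := min 1 (t + b) with hc
  have ha0 : 0 ≤ a := le_max_left _ _
  have hc1 : c ≤ 1 := min_le_left _ _
  have hat : a ≤ t := max_le ht.1 (by linarith)
  have htc : t ≤ c := le_min ht.2 (by linarith)
  have h := hX.hasRSIntegral (fun u => hk.hasDerivAt_rescaledKernel b t u)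
    (((hk.continuous_deriv_comp b t).const_mul _).neg) ha0 (hat.trans htc) hc1
  convert h using 1
  -- Either the window is cut off by the endpoint and `c = 1`, or it ends inside the interval and
  -- the kernel vanishes both at `c` and at `1`. The left end is analogous.
  have e1 : rescaledKernel k b (t - c) * X c = b⁻¹ * k ((t - 1) / b) * X 1 := by
    rcases le_total 1 (t + b) with h1 | h1
    · rw [hc, min_eq_left h1]; rfl
    · rw [hc, min_eq_right h1, rescaledKernel, hk.eq_zero_div hb (by rw [sub_add_cancel_left, abs_neg,
        abs_of_pos hb]), hk.eq_zero_div (x := t - 1) hb (by rw [abs_sub_comm,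
        abs_of_nonneg] <;> linarith)]
      simp
  have e2 : rescaledKernel k b (t - a) * X a = b⁻¹ * k (t / b) * X 0 := by
    rcases le_total (t - b) 0 with h1 | h1
    · rw [ha, max_eq_left h1, sub_zero]; rfl
    · rw [ha, max_eq_right h1, rescaledKernel, hk.eq_zero_div hb (by rw [sub_sub_cancel,
        abs_of_pos hb]), hk.eq_zero_div (x := t) hb (by rw [abs_of_nonneg] <;> linarith)]
      simp
  have hi : ∀ u ∈ Icc (0 : ℝ) 1, ∀ v ∈ Icc (0 : ℝ) 1,
      IntervalIntegrable (fun u => X u * deriv k ((t - u) / b)) volume u v := fun u hu v hv =>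
    ((hX.integrableOn.mono_set (uIcc_subset_Icc hu hv)).intervalIntegrable).mul_continuousOn
      (hk.continuous_deriv_comp b t).continuousOn
  have h0 : (0 : ℝ) ∈ Icc (0 : ℝ) 1 := by simp
  have h1 : (1 : ℝ) ∈ Icc (0 : ℝ) 1 := by simp
  have ham : a ∈ Icc (0 : ℝ) 1 := ⟨ha0, hat.trans ht.2⟩
  have hcm : c ∈ Icc (0 : ℝ) 1 := ⟨ht.1.trans htc, hc1⟩
  have z1 : ∫ u in (0 : ℝ)..a, X u * deriv k ((t - u) / b) = 0 := by
    rcases le_total (t - b) 0 with h' | h'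
    · rw [ha, max_eq_left h', intervalIntegral.integral_same]
    · rw [intervalIntegral.integral_of_le ha0, ha, max_eq_right h']
      refine setIntegral_eq_zero_of_forall_eq_zero fun u hu => ?_
      rw [hk.deriv_eq_zero_div hb (le_trans (by linarith [hu.2]) (le_abs_self _)), mul_zero]
  have z2 : ∫ u in c..1, X u * deriv k ((t - u) / b) = 0 := by
    rcases le_total 1 (t + b) with h' | h'
    · rw [hc, min_eq_left h', intervalIntegral.integral_same]
    · rw [intervalIntegral.integral_of_le hc1, hc, min_eq_right h']
      refine setIntegral_eq_zero_of_forall_eq_zero fun u hu => ?_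
      rw [hk.deriv_eq_zero_div hb (le_trans (by linarith [hu.1]) (neg_le_abs _)), mul_zero]
  rw [smoothed, e1, e2, ← intervalIntegral.integral_add_adjacent_intervals (hi 0 h0 a ham)
    (hi a ham 1 h1), ← intervalIntegral.integral_add_adjacent_intervals (hi a ham c hcm)
    (hi c hcm 1 h1), z1, z2, zero_add, add_zero]
  have : (fun u => X u * -((b ^ 2)⁻¹ * deriv k ((t - u) / b))) =
      fun u => -(b ^ 2)⁻¹ * (X u * deriv k ((t - u) / b)) := by ext u; ring
  rw [this, intervalIntegral.integral_const_mul]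
  ring

theorem IsRegulatedOnUnit.kernelSmooth_eq {k X : ℝ → ℝ} (hX : IsRegulatedOnUnit X)
    (hk : IsSmoothingKernel k) {b : ℝ} (hb : 0 < b) {t : ℝ} (ht : t ∈ Icc (0 : ℝ) 1) :
    kernelSmooth k b X t = smoothed k b X t :=
  (hX.hasRSIntegral_smoothed hk hb ht).rsIntegral_eq
    ((max_le ht.1 (by linarith)).trans (le_min ht.2 (by linarith : t ≤ t + b)))

theorem IsSmoothingKernel.intervalIntegrable_mul {k X : ℝ → ℝ} (hk : IsSmoothingKernel k)
    (hX : IntervalIntegrable X volume 0 1) (b t : ℝ) :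
    IntervalIntegrable (fun u => X u * deriv k ((t - u) / b)) volume 0 1 :=
  hX.mul_continuousOn (hk.continuous_deriv_comp b t).continuousOn

theorem IsSmoothingKernel.smoothed_add {k X Y : ℝ → ℝ} (hk : IsSmoothingKernel k)
    (hX : IntervalIntegrable X volume 0 1) (hY : IntervalIntegrable Y volume 0 1) (b t : ℝ) :
    smoothed k b (fun u => X u + Y u) t = smoothed k b X t + smoothed k b Y t := by
  simp only [smoothed, add_mul]
  rw [intervalIntegral.integral_add (hk.intervalIntegrable_mul hX b t)
    (hk.intervalIntegrable_mul hY b t)]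
  ring

theorem smoothed_const_mul (k X : ℝ → ℝ) (c b t : ℝ) :
    smoothed k b (fun u => c * X u) t = c * smoothed k b X t := by
  simp only [smoothed, mul_assoc c]
  rw [intervalIntegral.integral_const_mul]
  ring

/-- Smoothing a continuously differentiable path amounts to smoothing its derivative. -/
theorem IsSmoothingKernel.smoothed_of_hasDerivWithinAt {k F F' : ℝ → ℝ} (hk : IsSmoothingKernel k)
    (hF : ∀ u ∈ Icc (0 : ℝ) 1, HasDerivWithinAt F (F' u) (Icc 0 1) u)
    (hF' : ContinuousOn F' (Icc 0 1)) (b t : ℝ) :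
    smoothed k b F t = ∫ u in (0 : ℝ)..1, rescaledKernel k b (t - u) * F' u := by
  have hd : Continuous fun u => -((b ^ 2)⁻¹ * deriv k ((t - u) / b)) :=
    ((hk.continuous_deriv_comp b t).const_mul _).neg
  rw [intervalIntegral.integral_mul_deriv_eq_deriv_mul_of_hasDerivWithinAt (v := F)
    (fun u _ => (hk.hasDerivAt_rescaledKernel b t u).hasDerivWithinAt)
    (by rw [uIcc_of_le zero_le_one]; exact hF) (hd.intervalIntegrable _ _)
    (by rw [← uIcc_of_le (zero_le_one (α := ℝ))] at hF'; exact hF'.intervalIntegrable)]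
  have : (fun u => -((b ^ 2)⁻¹ * deriv k ((t - u) / b)) * F u) =
      fun u => -(b ^ 2)⁻¹ * (F u * deriv k ((t - u) / b)) := by ext u; ring
  rw [this, intervalIntegral.integral_const_mul, smoothed, rescaledKernel, rescaledKernel, sub_zero]
  ring

/-- Smoothing sees only increments. This allows the path to be recentred at `X t` or `X s` before
taking moments. -/
theorem IsSmoothingKernel.smoothed_const {k : ℝ → ℝ} (hk : IsSmoothingKernel k) (c b t : ℝ) :
    smoothed k b (fun _ => c) t = 0 := by
  rw [hk.smoothed_of_hasDerivWithinAt (F' := fun _ => 0)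
    (fun u _ => hasDerivWithinAt_const u _ c) continuousOn_const]
  simp

theorem IsSmoothingKernel.smoothed_sub_const {k X : ℝ → ℝ} (hk : IsSmoothingKernel k)
    (hX : IntervalIntegrable X volume 0 1) (c b t : ℝ) :
    smoothed k b (fun u => X u - c) t = smoothed k b X t := by
  simp only [sub_eq_add_neg]
  rw [hk.smoothed_add hX intervalIntegrable_const, hk.smoothed_const, add_zero]

theorem IsSmoothingKernel.continuous_smoothed {k X : ℝ → ℝ} (hk : IsSmoothingKernel k)
    (hX : IntervalIntegrable X volume 0 1) (b : ℝ) : Continuous (smoothed k b X) := by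
  obtain ⟨K, hK0, _, hK⟩ := hk.exists_bound
  have hk0 := hk.continuous
  have h : Continuous fun t => ∫ u in (0 : ℝ)..1, X u * deriv k ((t - u) / b) := by
    refine intervalIntegral.continuous_of_dominated_interval (bound := fun u => ‖X u‖ * K)
      (fun t => (hk.intervalIntegrable_mul hX b t).aestronglyMeasurable_restrict_uIoc)
      (fun t => ae_of_all _ fun u _ => ?_) (hX.norm.mul_const K)
      (ae_of_all _ fun u _ => ?_)
    · rw [norm_mul]; gcongr; exact hK _
    · exact continuous_const.mul (hk.continuous_deriv.comp (by fun_prop))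
  have h1 : Continuous fun t : ℝ => k ((t - 1) / b) := hk0.comp (by fun_prop)
  have h2 : Continuous fun t : ℝ => k (t / b) := hk0.comp (by fun_prop)
  exact (((h1.const_mul _).mul_const _).sub ((h2.const_mul _).mul_const _)).add (h.const_mul _)

/-- The part of the integral of `|k' ((t - u) / b)|` over the unit interval has size `b`. -/
theorem IsSmoothingKernel.integral_abs_deriv_le {k : ℝ → ℝ} (hk : IsSmoothingKernel k) {b : ℝ}
    (hb : 0 < b) (t : ℝ) :
    ∫ u in (0 : ℝ)..1, |deriv k ((t - u) / b)| ≤ b * ∫ y, |deriv k y| := by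
  have hint : Integrable fun y => |deriv k y| :=
    (hk.continuous_deriv.integrable_of_hasCompactSupport hk.hasCompactSupport.deriv).abs
  have hc : Integrable fun u => |deriv k ((t - u) / b)| :=
    (hint.comp_div hb.ne').comp_sub_left t
  rw [intervalIntegral.integral_of_le zero_le_one]
  calc _ ≤ ∫ u, |deriv k ((t - u) / b)| :=
        setIntegral_le_integral hc (ae_of_all _ fun u => abs_nonneg _)
    _ = ∫ u, |deriv k (u / b)| := integral_sub_left_eq_self (fun u => |deriv k (u / b)|) volume t
    _ = b * ∫ y, |deriv k y| := by
        rw [Measure.integral_comp_div (fun y => |deriv k y|), abs_of_pos hb, smul_eq_mul]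

/-- The boundary terms carry `1 / b`; the integral carries `1 / b ^ 2` but lives on a window of
length of order `b`. This factor `1 / b` is the price of transferring the uniform coupling error to
the estimator. -/
theorem IsSmoothingKernel.exists_abs_smoothed_le {k : ℝ → ℝ} (hk : IsSmoothingKernel k) :
    ∃ C > 0, ∀ b > 0, ∀ (X : ℝ → ℝ) (M : ℝ), (∀ u ∈ Icc (0 : ℝ) 1, |X u| ≤ M) → ∀ t,
      |smoothed k b X t| ≤ C * M / b := by
  obtain ⟨K, hK0, hK, _⟩ := hk.exists_bound
  have hI : 0 ≤ ∫ y, |deriv k y| := integral_nonneg fun _ => abs_nonneg _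
  refine ⟨K + K + ∫ y, |deriv k y|, by positivity, fun b hb X M hM t => ?_⟩
  have hM0 : 0 ≤ M := (abs_nonneg _).trans (hM 0 (by simp))
  have h1 : |b⁻¹ * k ((t - 1) / b) * X 1| ≤ b⁻¹ * K * M := by
    rw [abs_mul, abs_mul, abs_of_pos (inv_pos.2 hb)]
    gcongr
    · exact hK _
    · exact hM 1 (by simp)
  have h2 : |b⁻¹ * k (t / b) * X 0| ≤ b⁻¹ * K * M := by
    rw [abs_mul, abs_mul, abs_of_pos (inv_pos.2 hb)]
    gcongr
    · exact hK _
    · exact hM 0 (by simp)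
  have h3 : |(b ^ 2)⁻¹ * ∫ u in (0 : ℝ)..1, X u * deriv k ((t - u) / b)| ≤
      (b ^ 2)⁻¹ * (M * (b * ∫ y, |deriv k y|)) := by
    rw [abs_mul, abs_of_pos (by positivity)]
    gcongr
    calc _ ≤ ∫ u in (0 : ℝ)..1, M * |deriv k ((t - u) / b)| := by
          rw [← Real.norm_eq_abs]
          refine intervalIntegral.norm_integral_le_of_norm_le zero_le_one
            (ae_of_all _ fun u hu => ?_)
            (((hk.continuous_deriv_comp b t).abs.const_mul M).intervalIntegrable _ _)
          rw [norm_mul]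
          exact mul_le_mul_of_nonneg_right (hM u ⟨hu.1.le, hu.2⟩) (norm_nonneg _)
      _ ≤ _ := by
          rw [intervalIntegral.integral_const_mul]
          gcongr
          exact hk.integral_abs_deriv_le hb t
  have e : (K + K + ∫ y, |deriv k y|) * M / b =
      b⁻¹ * K * M + b⁻¹ * K * M + (b ^ 2)⁻¹ * (M * (b * ∫ y, |deriv k y|)) := by
    field_simp
  rw [e, smoothed]
  refine (abs_add_le _ _).trans (add_le_add ((abs_sub _ _).trans (add_le_add h1 h2)) h3)

/-! ### Kernel mass inside `[0, 1]` and the size of the bias. -/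

/-- The mass which the kernel centred at `t` puts on the unit interval. -/
noncomputable def kernelMass (k : ℝ → ℝ) (b t : ℝ) : ℝ :=
  ∫ u in (0 : ℝ)..1, rescaledKernel k b (t - u)

namespace IsSmoothingKernel

variable {k : ℝ → ℝ}

theorem integrable (hk : IsSmoothingKernel k) : Integrable k :=
  hk.continuous.integrable_of_hasCompactSupport hk.hasCompactSupport

theorem intervalIntegral_le_of_le (hk : IsSmoothingKernel k) {x x' y y' : ℝ} (hx : x' ≤ x)
    (hxy : x ≤ y) (hy : y ≤ y') : ∫ v in x..y, k v ≤ ∫ v in x'..y', k v :=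
  intervalIntegral.integral_mono_interval hx hxy hy (ae_of_all _ hk.nonneg)
    (hk.continuous.intervalIntegrable _ _)

theorem intervalIntegral_le_one (hk : IsSmoothingKernel k) {x y : ℝ} (hxy : x ≤ y) :
    ∫ v in x..y, k v ≤ 1 := by
  rw [← hk.integral_eq_one, intervalIntegral.integral_of_le hxy]
  exact setIntegral_le_integral hk.integrable (ae_of_all _ hk.nonneg)

theorem intervalIntegral_neg (hk : IsSmoothingKernel k) (x y : ℝ) :
    ∫ v in -y..-x, k v = ∫ v in x..y, k v := by
  rw [← intervalIntegral.integral_comp_neg]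
  simp only [hk.symmetric]

theorem integral_zero_one (hk : IsSmoothingKernel k) : ∫ v in (0 : ℝ)..1, k v = 1 / 2 := by
  have h1 : ∫ v in (-1 : ℝ)..1, k v = 1 := by
    refine Eq.trans ?_ hk.integral_eq_one
    refine intervalIntegral.integral_eq_integral_of_support_subset fun y hy => ?_
    by_contra h
    refine hy (hk.eq_zero ?_)
    by_contra h'
    rw [not_le, abs_lt] at h'
    exact h ⟨h'.1, h'.2.le⟩
  have h2 := intervalIntegral.integral_add_adjacent_intervals
    (hk.continuous.intervalIntegrable (μ := volume) (-1) 0) (hk.continuous.intervalIntegrable 0 1)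
  have h3 := hk.intervalIntegral_neg 0 1
  rw [neg_zero] at h3
  linarith

/-- Since `1` belongs to the closed support, `k` is nonzero at points arbitrarily close to the
midpoint of `(c, 1)`, and continuity turns one such point into positive mass. This is the mass lost
at the boundary. -/
theorem integral_pos_of_lt_one (hk : IsSmoothingKernel k) {c : ℝ} (hc : -1 < c) (hc1 : c < 1) :
    0 < ∫ v in c..1, k v := by
  obtain ⟨x, hx, hkx⟩ : ∃ x ∈ Ioo c 1, k x ≠ 0 := by
    by_contra! h
    have hmem : (c + 1) / 2 ∈ tsupport k := by
      rw [hk.support_eq]; constructor <;> linarith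
    rw [tsupport, mem_closure_iff_nhds] at hmem
    obtain ⟨x, hx, hx'⟩ := hmem (Ioo c 1) (Ioo_mem_nhds (by linarith) (by linarith))
    exact hx' (h x hx)
  exact intervalIntegral.integral_pos hc1 hk.continuous.continuousOn (fun x _ => hk.nonneg x)
    ⟨x, Ioo_subset_Icc_self hx, lt_of_le_of_ne (hk.nonneg x) hkx.symm⟩

theorem kernelMass_eq (_hk : IsSmoothingKernel k) {b : ℝ} (hb : 0 < b) (t : ℝ) :
    kernelMass k b t = ∫ v in (t - 1) / b..t / b, k v := by
  simp only [kernelMass, rescaledKernel]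
  rw [intervalIntegral.integral_const_mul]
  have := intervalIntegral.integral_comp_sub_div (a := 0) (b := 1) k hb.ne' (t / b)
  simp only [← sub_div, sub_zero] at this
  rw [this, smul_eq_mul, inv_mul_cancel_left₀ hb.ne']

theorem kernelMass_nonneg (hk : IsSmoothingKernel k) {b : ℝ} (hb : 0 < b) (t : ℝ) :
    0 ≤ kernelMass k b t :=
  intervalIntegral.integral_nonneg zero_le_one fun _ _ =>
    mul_nonneg (inv_nonneg.2 hb.le) (hk.nonneg _)

theorem kernelMass_le_one (hk : IsSmoothingKernel k) {b : ℝ} (hb : 0 < b) (t : ℝ) :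
    kernelMass k b t ≤ 1 := by
  rw [hk.kernelMass_eq hb]
  exact hk.intervalIntegral_le_one (div_le_div_of_nonneg_right (by linarith) hb.le)

/-- If `b ≤ 1 / 2`, at least one half of the window lies in `[0, 1]`, and by symmetry each half has
mass `1 / 2`. -/
theorem half_le_kernelMass (hk : IsSmoothingKernel k) {b : ℝ} (hb : 0 < b) (hb' : b ≤ 1 / 2) {t : ℝ}
    (ht : t ∈ Icc (0 : ℝ) 1) : 1 / 2 ≤ kernelMass k b t := by
  rw [hk.kernelMass_eq hb, ← hk.integral_zero_one]
  rcases le_total (1 / 2) t with h | h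
  · refine hk.intervalIntegral_le_of_le ?_ zero_le_one ?_
    · rw [div_le_iff₀ hb]; linarith [ht.2]
    · rw [le_div_iff₀ hb]; linarith
  · rw [← hk.intervalIntegral_neg 0 1, neg_zero]
    refine hk.intervalIntegral_le_of_le ?_ (by norm_num) (div_nonneg ht.1 hb.le)
    rw [div_le_iff₀ hb]; linarith

/-- At distance at most `c * b` from the endpoint, the part of the kernel beyond `c` on that side
falls outside the unit interval. -/
theorem kernelMass_le_of_mem_endRegion (hk : IsSmoothingKernel k) {b c e : ℝ} (hb : 0 < b)
    (hb' : b ≤ 1 / 2) (hc1 : c ≤ 1) (he : e ∈ ({0, 1} : Set ℝ)) {t : ℝ}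
    (ht : t ∈ endRegion e (c * b)) : kernelMass k b t ≤ 1 - ∫ v in c..1, k v := by
  have hi : ∀ x y, IntervalIntegrable k volume x y := fun x y => hk.continuous.intervalIntegrable x y
  have hcb : c * b ≤ 1 / 2 := (mul_le_of_le_one_left hb.le hc1).trans hb'
  rw [hk.kernelMass_eq hb]
  obtain ⟨ht1, ht2⟩ := ht
  rcases he with rfl | rfl
  · have h1 : t / b ≤ c := by
      rw [div_le_iff₀ hb]; rw [sub_zero] at ht2; exact (le_abs_self t).trans ht2
    have h2 := hk.intervalIntegral_le_of_le h1 hc1 le_rfl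
    have h3 := intervalIntegral.integral_add_adjacent_intervals (hi ((t - 1) / b) (t / b)) (hi _ 1)
    have h4 := hk.intervalIntegral_le_one (x := (t - 1) / b) (y := 1)
      (by rw [div_le_iff₀ hb]; linarith [ht1.2])
    linarith
  · have h1 : -c ≤ (t - 1) / b := by
      rw [le_div_iff₀ hb]; linarith [neg_abs_le (t - 1)]
    have h2 := hk.intervalIntegral_le_of_le le_rfl (neg_le_neg hc1) h1
    rw [hk.intervalIntegral_neg] at h2
    have h3 := intervalIntegral.integral_add_adjacent_intervals (hi (-1) ((t - 1) / b))
      (hi _ (t / b))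
    have h4 := hk.intervalIntegral_le_one (x := -1) (y := t / b)
      ((by norm_num : (-1 : ℝ) ≤ 0).trans (div_nonneg ht1.1 hb.le))
    linarith

theorem continuous_rescaledKernel_sub (hk : IsSmoothingKernel k) (b t : ℝ) :
    Continuous fun u => rescaledKernel k b (t - u) :=
  continuous_const.mul (hk.continuous.comp (by fun_prop))

/-- The kernel smoothing of a Lipschitz function differs from the function, scaled by the mass of
the kernel, by a multiple of the bandwidth. -/
theorem abs_smoothing_sub_le (hk : IsSmoothingKernel k) {lam : ℝ → ℝ} {A : ℝ} {b : ℝ} (hb : 0 < b)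
    (hlam : ContinuousOn lam (Icc 0 1))
    (hA : ∀ u ∈ Icc (0 : ℝ) 1, ∀ v ∈ Icc (0 : ℝ) 1, |lam u - lam v| ≤ A * |u - v|) {t : ℝ}
    (ht : t ∈ Icc (0 : ℝ) 1) :
    |(∫ u in (0 : ℝ)..1, rescaledKernel k b (t - u) * lam u) - kernelMass k b t * lam t| ≤
      A * b := by
  have hA0 : 0 ≤ A := by
    have := (abs_nonneg _).trans (hA 0 (by simp) 1 (by simp)); simpa using this
  have hc := hk.continuous_rescaledKernel_sub b t
  have hi : IntervalIntegrable (fun u => rescaledKernel k b (t - u) * lam u) volume 0 1 := by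
    refine ContinuousOn.intervalIntegrable ?_
    rw [uIcc_of_le zero_le_one]; exact hc.continuousOn.mul hlam
  have e : (∫ u in (0 : ℝ)..1, rescaledKernel k b (t - u) * lam u) - kernelMass k b t * lam t =
      ∫ u in (0 : ℝ)..1, rescaledKernel k b (t - u) * (lam u - lam t) := by
    simp only [mul_sub]
    rw [intervalIntegral.integral_sub hi ((hc.intervalIntegrable _ _).mul_const _),
      intervalIntegral.integral_mul_const, kernelMass]
  rw [e, ← Real.norm_eq_abs]
  calc _ ≤ ∫ u in (0 : ℝ)..1, rescaledKernel k b (t - u) * (A * b) := by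
        refine intervalIntegral.norm_integral_le_of_norm_le zero_le_one (ae_of_all _ fun u hu => ?_)
          ((hc.mul continuous_const).intervalIntegrable _ _)
        have hn : 0 ≤ rescaledKernel k b (t - u) :=
          mul_nonneg (inv_nonneg.2 hb.le) (hk.nonneg _)
        rw [norm_mul, Real.norm_of_nonneg hn]
        rcases le_or_gt b |t - u| with h | h
        · rw [rescaledKernel, hk.eq_zero_div hb h]; simp
        · refine mul_le_mul_of_nonneg_left ((hA u ⟨hu.1.le, hu.2⟩ t ht).trans ?_) hn
          rw [abs_sub_comm] at h
          gcongr
    _ = kernelMass k b t * (A * b) := by rw [intervalIntegral.integral_mul_const, kernelMass]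
    _ ≤ A * b := mul_le_of_le_one_left (by positivity) (hk.kernelMass_le_one hb t)

theorem abs_scaledBias_le (hk : IsSmoothingKernel k) {lam : ℝ → ℝ} {A M : ℝ} {b : ℝ} (hb : 0 < b)
    (hb1 : b ≤ 1) (hlam : ContinuousOn lam (Icc 0 1))
    (hA : ∀ u ∈ Icc (0 : ℝ) 1, ∀ v ∈ Icc (0 : ℝ) 1, |lam u - lam v| ≤ A * |u - v|)
    (hM : ∀ u ∈ Icc (0 : ℝ) 1, |lam u| ≤ M) (n : ℕ) {t : ℝ} (ht : t ∈ Icc (0 : ℝ) 1) :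
    |scaledBias k lam n b t| ≤ (A + M) * Real.sqrt (n * b) := by
  have hA0 : 0 ≤ A := by
    have := (abs_nonneg _).trans (hA 0 (by simp) 1 (by simp)); simpa using this
  have h1 := hk.abs_smoothing_sub_le hb hlam hA ht
  have h2 : |(kernelMass k b t - 1) * lam t| ≤ M := by
    rw [abs_mul, abs_sub_comm, abs_of_nonneg (by linarith [hk.kernelMass_le_one hb t])]
    calc _ ≤ 1 * |lam t| := by
          gcongr; linarith [hk.kernelMass_nonneg hb t]
      _ ≤ M := by rw [one_mul]; exact hM t ht
  rw [scaledBias, abs_mul, abs_of_nonneg (Real.sqrt_nonneg _), mul_comm]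
  gcongr
  have e : (∫ u in (0 : ℝ)..1, rescaledKernel k b (t - u) * lam u) - lam t =
      ((∫ u in (0 : ℝ)..1, rescaledKernel k b (t - u) * lam u) - kernelMass k b t * lam t)
        + (kernelMass k b t - 1) * lam t := by ring
  rw [e]
  refine (abs_add_le _ _).trans (add_le_add (h1.trans (mul_le_of_le_one_right hA0 hb1)) h2)

/-- Near an endpoint at which `λ` does not vanish the scaled bias is of exact order `√(n b)`, and
has the sign opposite to that of `λ`. -/
theorem exists_le_scaledBias (hk : IsSmoothingKernel k) {lam : ℝ → ℝ} {A : ℝ}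
    (hlam : ContinuousOn lam (Icc 0 1))
    (hA : ∀ u ∈ Icc (0 : ℝ) 1, ∀ v ∈ Icc (0 : ℝ) 1, |lam u - lam v| ≤ A * |u - v|)
    {c e : ℝ} (hc : -1 < c) (hc1 : c < 1) (he : e ∈ ({0, 1} : Set ℝ)) (hlame : lam e ≠ 0) :
    ∃ σ : ℝ, (σ = 1 ∨ σ = -1) ∧ ∃ a > 0, ∃ b₀ > 0, ∀ b, 0 < b → b ≤ b₀ → ∀ n : ℕ,
      ∀ t ∈ endRegion e (c * b), a * Real.sqrt (n * b) ≤ σ * scaledBias k lam n b t := by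
  have heI : e ∈ Icc (0 : ℝ) 1 := by rcases he with rfl | rfl <;> simp
  have hA0 : 0 ≤ A := by
    have := (abs_nonneg _).trans (hA 0 (by simp) 1 (by simp)); simpa using this
  -- The missing mass `1 - m` contributes `-(1 - m) * lam e` to the bias, so the sign opposite to
  -- that of `lam e` makes it positive.
  obtain ⟨σ, hσ, hσe⟩ : ∃ σ : ℝ, (σ = 1 ∨ σ = -1) ∧ σ * lam e = -|lam e| := by
    rcases le_total 0 (lam e) with h | h
    · exact ⟨-1, Or.inr rfl, by rw [abs_of_nonneg h]; ring⟩
    · exact ⟨1, Or.inl rfl, by rw [abs_of_nonpos h]; ring⟩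
  have hσ1 : |σ| = 1 := by rcases hσ with rfl | rfl <;> simp
  set κ := ∫ v in c..1, k v with hκ
  have hκ0 : 0 < κ := hk.integral_pos_of_lt_one hc hc1
  have hκ1 : κ ≤ 1 := hk.intervalIntegral_le_one hc1.le
  have hl : 0 < |lam e| := abs_pos.2 hlame
  refine ⟨σ, hσ, κ * |lam e| / 2, by positivity, min (1 / 2) (κ * |lam e| / (4 * (A + 1))),
    by positivity, fun b hb hb0 n t ht => ?_⟩
  have hb1 : b ≤ 1 / 2 := hb0.trans (min_le_left _ _)
  have hb2 : A * b ≤ κ * |lam e| / 4 := by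
    have h := hb0.trans (min_le_right _ _)
    rw [le_div_iff₀ (by positivity)] at h
    nlinarith
  have hmass := hk.kernelMass_le_of_mem_endRegion hb hb1 hc1.le he ht
  have h1 := hk.abs_smoothing_sub_le hb hlam hA ht.1
  have h2 : |lam t - lam e| ≤ A * b := by
    refine (hA t ht.1 e heI).trans (mul_le_mul_of_nonneg_left (ht.2.trans ?_) hA0)
    exact mul_le_of_le_one_left hb.le hc1.le
  have h0 := hk.kernelMass_nonneg hb t
  rw [scaledBias, mul_left_comm, mul_comm]
  refine mul_le_mul_of_nonneg_left ?_ (Real.sqrt_nonneg _)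
  set I := ∫ u in (0 : ℝ)..1, rescaledKernel k b (t - u) * lam u
  set m := kernelMass k b t
  have h3 : |σ * (I - m * lam t)| ≤ A * b := by rw [abs_mul, hσ1, one_mul]; exact h1
  have h4 : |σ * ((1 - m) * (lam t - lam e))| ≤ A * b := by
    rw [abs_mul, hσ1, one_mul, abs_mul, abs_of_nonneg (by linarith)]
    exact (mul_le_of_le_one_left (abs_nonneg _) (by linarith)).trans h2
  -- The first two terms are at most `A * b ≤ κ * |lam e| / 4` each, by the choice of the threshold
  -- for `b`, while the last is at least `κ * |lam e|`; half of it survives.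
  have e1 : σ * (I - lam t) = σ * (I - m * lam t) - σ * ((1 - m) * (lam t - lam e))
      - (1 - m) * (σ * lam e) := by ring
  rw [abs_le] at h3 h4
  have h5 : κ * |lam e| ≤ (1 - m) * |lam e| := by gcongr; linarith
  rw [e1, hσe]
  linarith [h3.1, h4.2]

end IsSmoothingKernel

/-- The primitive of a continuous function on `[0, 1]`. -/
theorem ContinuousOn.hasDerivWithinAt_integral {lam : ℝ → ℝ} (hlam : ContinuousOn lam (Icc 0 1)) :
    ∀ u ∈ Icc (0 : ℝ) 1, HasDerivWithinAt (fun t => ∫ v in (0 : ℝ)..t, lam v) (lam u)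
      (Icc 0 1) u := by
  intro u hu
  set f : ℝ → ℝ := fun v => lam (projIcc 0 1 zero_le_one v)
  have hf : Continuous f := hlam.domRestrict.comp continuous_projIcc
  have hfl : ∀ v ∈ Icc (0 : ℝ) 1, f v = lam v := fun v hv => by
    simp only [f, projIcc_of_mem zero_le_one hv]
  have h := (hf.integral_hasStrictDerivAt 0 u).hasDerivAt.hasDerivWithinAt (s := Icc 0 1)
  rw [hfl u hu] at h
  have hcongr : ∀ t ∈ Icc (0 : ℝ) 1, ∫ v in (0 : ℝ)..t, lam v = ∫ v in (0 : ℝ)..t, f v := by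
    intro t ht
    refine intervalIntegral.integral_congr fun v hv => ?_
    rw [uIcc_of_le ht.1] at hv
    exact (hfl v ⟨hv.1, hv.2.trans ht.2⟩).symm
  exact h.congr hcongr (hcongr u hu)

/-- The convolution is the smoothing of the primitive of `lam`, whose continuity in `t` is already
known. -/
theorem IsSmoothingKernel.continuousOn_scaledBias {k lam : ℝ → ℝ} (hk : IsSmoothingKernel k)
    (hlam : ContinuousOn lam (Icc 0 1)) (n : ℕ) (b : ℝ) :
    ContinuousOn (scaledBias k lam n b) (Icc 0 1) := by
  have hΛ := hlam.hasDerivWithinAt_integral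
  have hc : ContinuousOn (fun t => ∫ v in (0 : ℝ)..t, lam v) (Icc 0 1) := fun u hu =>
    (hΛ u hu).continuousWithinAt
  have h := hk.continuous_smoothed (X := fun t => ∫ v in (0 : ℝ)..t, lam v)
    hc.isCadlagOnUnit.isRegulatedOnUnit.intervalIntegrable b
  refine continuousOn_const.mul (ContinuousOn.sub ?_ hlam)
  refine h.continuousOn.congr fun t _ => ?_
  exact (hk.smoothed_of_hasDerivWithinAt hΛ hlam b t).symm

theorem ContinuousOn.exists_abs_le_unit {f : ℝ → ℝ} (hf : ContinuousOn f (Icc 0 1)) :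
    ∃ M, ∀ u ∈ Icc (0 : ℝ) 1, |f u| ≤ M :=
  isCompact_Icc.exists_bound_of_continuousOn hf

theorem exists_lipschitz_of_hasDerivWithinAt {f f' : ℝ → ℝ}
    (hf : ∀ u ∈ Icc (0 : ℝ) 1, HasDerivWithinAt f (f' u) (Icc 0 1) u)
    (hf' : ContinuousOn f' (Icc 0 1)) :
    ∃ A, ∀ u ∈ Icc (0 : ℝ) 1, ∀ v ∈ Icc (0 : ℝ) 1, |f u - f v| ≤ A * |u - v| := by
  obtain ⟨A, hA⟩ := hf'.exists_abs_le_unit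
  exact ⟨A, fun u hu v hv =>
    (convex_Icc (0 : ℝ) 1).norm_image_sub_le_of_norm_hasDerivWithin_le hf hA hv hu⟩

/-! ### Elementary inequalities for `p`-th powers. -/

/-- With `y ≤ x`, this is Bernoulli's inequality `(1 + s) ^ p ≥ 1 + p * s` at `s = y / x - 1`,
multiplied by `x ^ p`. -/
theorem abs_rpow_sub_rpow_le {p x y : ℝ} (hp : 1 ≤ p) (hx : 0 ≤ x) (hy : 0 ≤ y) :
    |x ^ p - y ^ p| ≤ p * max x y ^ (p - 1) * |x - y| := by
  wlog hxy : y ≤ x generalizing x y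
  · rw [abs_sub_comm, max_comm, abs_sub_comm x y]
    exact this hy hx (le_of_not_ge hxy)
  rw [max_eq_left hxy, abs_of_nonneg (sub_nonneg.2 (Real.rpow_le_rpow hy hxy (by linarith))),
    abs_of_nonneg (sub_nonneg.2 hxy)]
  rcases hx.eq_or_lt with rfl | hx
  · have : y = 0 := le_antisymm hxy hy
    simp [this]
  have h := one_add_mul_self_le_rpow_one_add (s := y / x - 1) (by
    have := div_nonneg hy hx.le; linarith) hp
  rw [add_sub_cancel, Real.div_rpow hy hx.le, le_div_iff₀ (Real.rpow_pos_of_pos hx p)] at h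
  have e : x ^ p = x * x ^ (p - 1) := by
    rw [← Real.rpow_one_add' hx.le (by linarith)]; congr 1; ring
  have e2 : (1 + p * (y / x - 1)) * (x * x ^ (p - 1)) =
      x * x ^ (p - 1) - p * x ^ (p - 1) * (x - y) := by field_simp; ring
  rw [e, e2] at h
  rw [e]; linarith

/-- Bounding the sum by twice the maximum works for every `s ≥ 0`, including the exponents `p - 1 <
1` for which convexity fails. -/
theorem add_rpow_le_two_rpow_mul {s x y : ℝ} (hs : 0 ≤ s) (hx : 0 ≤ x) (hy : 0 ≤ y) :
    (x + y) ^ s ≤ 2 ^ s * (x ^ s + y ^ s) := by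
  wlog hxy : y ≤ x generalizing x y
  · rw [add_comm, add_comm (x ^ s)]; exact this hy hx (le_of_not_ge hxy)
  calc (x + y) ^ s ≤ (2 * x) ^ s := Real.rpow_le_rpow (by positivity) (by linarith) hs
    _ = 2 ^ s * x ^ s := Real.mul_rpow (by norm_num) hx
    _ ≤ _ := by gcongr; linarith [Real.rpow_nonneg hy s]

theorem rpow_le_one_add_rpow {r s x : ℝ} (hr : 0 ≤ r) (hrs : r ≤ s) (hx : 0 ≤ x) :
    x ^ r ≤ 1 + x ^ s := by
  rcases le_total x 1 with h | h
  · have := Real.rpow_le_one hx h hr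
    have := Real.rpow_nonneg hx s
    linarith
  · have := Real.rpow_le_rpow_of_exponent_le h hrs
    linarith

/-- The basic stability estimate for the `L_p` integrands. In one application `z` is the coupling
error, in the other it is the Gaussian part and `a` the bias. -/
theorem abs_abs_add_rpow_sub_le {p : ℝ} (hp : 1 ≤ p) (a z : ℝ) :
    |(|a + z| ^ p) - |a| ^ p| ≤ p * 2 ^ (p - 1) * (|a| ^ (p - 1) * |z| + |z| ^ p) := by
  have h1 := abs_rpow_sub_rpow_le hp (abs_nonneg (a + z)) (abs_nonneg a)
  have h2 : max |a + z| |a| ≤ |a| + |z| := max_le (abs_add_le a z) (by linarith [abs_nonneg z])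
  have h3 : |(|a + z| - |a|)| ≤ |z| := by
    have := abs_abs_sub_abs_le (a + z) a
    rwa [add_sub_cancel_left] at this
  have h4 := add_rpow_le_two_rpow_mul (s := p - 1) (by linarith) (abs_nonneg a) (abs_nonneg z)
  have e : |z| ^ p = |z| ^ (p - 1) * |z| := by
    rw [← Real.rpow_add_one' (abs_nonneg z) (by linarith)]; congr 1; ring
  calc _ ≤ p * max |a + z| |a| ^ (p - 1) * |(|a + z| - |a|)| := h1
    _ ≤ p * (2 ^ (p - 1) * (|a| ^ (p - 1) + |z| ^ (p - 1))) * |z| := by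
        have := Real.rpow_le_rpow (le_max_of_le_left (abs_nonneg (a + z))) h2
          (by linarith : 0 ≤ p - 1)
        gcongr
        exact this.trans h4
    _ = _ := by rw [e]; ring

/-- The effect on `|y + g|^p` of a perturbation of size `ρ`. -/
theorem exists_abs_perturbation_le {p : ℝ} (hp : 1 ≤ p) :
    ∃ C > 0, ∀ y g z G ρ : ℝ, |g| ≤ G → |z| ≤ ρ →
      |(|y + g + z| ^ p) - |y + g| ^ p| ≤
        C * (ρ * (1 + |y| ^ p) + ρ * G ^ (p - 1) + ρ ^ p) := by
  refine ⟨p * 2 ^ (p - 1) * 2 ^ (p - 1), by positivity, fun y g z G ρ hg hz => ?_⟩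
  have hp1 : 0 ≤ p - 1 := by linarith
  have hρ : 0 ≤ ρ := (abs_nonneg z).trans hz
  have hG : 0 ≤ G := (abs_nonneg g).trans hg
  have h1 : |y + g| ^ (p - 1) ≤ 2 ^ (p - 1) * ((1 + |y| ^ p) + G ^ (p - 1)) :=
    calc _ ≤ (|y| + |g|) ^ (p - 1) := Real.rpow_le_rpow (abs_nonneg _) (abs_add_le _ _) hp1
      _ ≤ _ := add_rpow_le_two_rpow_mul hp1 (abs_nonneg _) (abs_nonneg _)
      _ ≤ _ := by
          gcongr
          exact rpow_le_one_add_rpow hp1 (by linarith) (abs_nonneg _)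
  have h2 : (1 : ℝ) ≤ 2 ^ (p - 1) := Real.one_le_rpow (by norm_num) hp1
  calc _ ≤ p * 2 ^ (p - 1) * (|y + g| ^ (p - 1) * |z| + |z| ^ p) := abs_abs_add_rpow_sub_le hp _ _
    _ ≤ p * 2 ^ (p - 1) * (2 ^ (p - 1) * ((1 + |y| ^ p) + G ^ (p - 1)) * ρ
          + 2 ^ (p - 1) * ρ ^ p) := by
        gcongr
        exact (Real.rpow_le_rpow (abs_nonneg z) hz (by linarith)).trans
          (le_mul_of_one_le_left (Real.rpow_nonneg hρ p) h2)
    _ = _ := by ring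

/-- The effect of a random perturbation `y` on `|g|^p`. -/
theorem exists_abs_add_rpow_sub_le {p : ℝ} (hp : 1 ≤ p) :
    ∃ C > 0, ∀ y g G : ℝ, |g| ≤ G →
      |(|y + g| ^ p) - |g| ^ p| ≤ C * ((G ^ (p - 1) + 1) * (1 + |y| ^ p)) := by
  refine ⟨p * 2 ^ (p - 1), by positivity, fun y g G hg => ?_⟩
  have h := abs_abs_add_rpow_sub_le hp g y
  rw [add_comm y g]
  refine h.trans ?_
  have h1 : |y| ≤ 1 + |y| ^ p := by
    simpa using rpow_le_one_add_rpow zero_le_one hp (abs_nonneg y)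
  have h2 : |g| ^ (p - 1) ≤ G ^ (p - 1) := Real.rpow_le_rpow (abs_nonneg _) hg (by linarith)
  have h3 : 0 ≤ G ^ (p - 1) := (Real.rpow_nonneg (abs_nonneg g) _).trans h2
  gcongr
  calc _ ≤ G ^ (p - 1) * (1 + |y| ^ p) + (1 + |y| ^ p) := by gcongr; linarith
    _ = _ := by ring

/-! ### Boundary regions and their measure. -/

theorem endRegion_subset (e r : ℝ) : endRegion e r ⊆ Icc 0 1 := fun _ h => h.1

theorem measurableSet_endRegion (e r : ℝ) : MeasurableSet (endRegion e r) :=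
  measurableSet_Icc.inter
    (measurableSet_le (f := fun t : ℝ => |t - e|) (g := fun _ => r) (by fun_prop) (by fun_prop))

theorem endRegion_mono (e : ℝ) {r s : ℝ} (h : r ≤ s) : endRegion e r ⊆ endRegion e s :=
  fun _ ht => ⟨ht.1, ht.2.trans h⟩

theorem volume_endRegion_le (e r : ℝ) : volume (endRegion e r) ≤ ENNReal.ofReal (2 * r) := by
  calc _ ≤ volume (Icc (e - r) (e + r)) := measure_mono fun t ht => by
        have := abs_le.1 ht.2; constructor <;> linarith
    _ = _ := by rw [Real.volume_Icc]; congr 1; ring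

theorem le_volume_endRegion {e r : ℝ} (he : e ∈ ({0, 1} : Set ℝ)) (hr1 : r ≤ 1) :
    ENNReal.ofReal r ≤ volume (endRegion e r) := by
  rcases he with rfl | rfl
  · calc _ = volume (Icc 0 r) := by rw [Real.volume_Icc, sub_zero]
      _ ≤ volume (endRegion 0 r) := by
        refine measure_mono fun t ht => ⟨⟨ht.1, ht.2.trans hr1⟩, ?_⟩
        rw [sub_zero, abs_of_nonneg ht.1]; exact ht.2
  · calc _ = volume (Icc (1 - r) 1) := by rw [Real.volume_Icc, sub_sub_cancel]
      _ ≤ volume (endRegion 1 r) := by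
        refine measure_mono fun t ht => ⟨⟨by linarith [ht.1], ht.2⟩, ?_⟩
        rw [abs_sub_comm, abs_of_nonneg (by linarith [ht.2])]; linarith [ht.1]

section Weight

variable {μ : Measure ℝ} {w : ℝ → ℝ}

theorem measure_endRegion_eq
    (hμ : μ.restrict (Icc 0 1) =
      (volume.restrict (Icc 0 1)).withDensity fun t => ENNReal.ofReal (w t)) (e r : ℝ) :
    μ (endRegion e r) = ∫⁻ t in endRegion e r, ENNReal.ofReal (w t) := by
  have h := congrArg (fun m : Measure ℝ => m (endRegion e r)) hμ
  rw [Measure.restrict_apply (measurableSet_endRegion e r),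
    withDensity_apply _ (measurableSet_endRegion e r),
    Measure.restrict_restrict (measurableSet_endRegion e r),
    inter_eq_left.2 (endRegion_subset e r)] at h
  exact h

theorem exists_measure_endRegion_le (hw : ContinuousOn w (Icc 0 1))
    (hμ : μ.restrict (Icc 0 1) =
      (volume.restrict (Icc 0 1)).withDensity fun t => ENNReal.ofReal (w t)) :
    ∃ W > 0, ∀ e r, 0 ≤ r → μ (endRegion e r) ≤ ENNReal.ofReal (W * r) := by
  obtain ⟨M, hM⟩ := hw.exists_abs_le_unit
  refine ⟨2 * (|M| + 1), by positivity, fun e r hr => ?_⟩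
  rw [measure_endRegion_eq hμ]
  calc _ ≤ ∫⁻ t in endRegion e r, ENNReal.ofReal (|M| + 1) := by
        refine setLIntegral_mono' (measurableSet_endRegion e r) fun t ht => ?_
        refine ENNReal.ofReal_le_ofReal ?_
        linarith [le_abs_self (w t), hM t ht.1, le_abs_self M]
    _ = ENNReal.ofReal (|M| + 1) * volume (endRegion e r) := by rw [setLIntegral_const]
    _ ≤ ENNReal.ofReal (|M| + 1) * ENNReal.ofReal (2 * r) := by
        gcongr; exact volume_endRegion_le e r
    _ = _ := by rw [← ENNReal.ofReal_mul (by positivity)]; congr 1; ring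

/-- By continuity the weight stays above `w e / 2` near `e`, and the region has length at least `r`.
-/
theorem exists_le_measure_endRegion (hw : ContinuousOn w (Icc 0 1))
    (hμ : μ.restrict (Icc 0 1) =
      (volume.restrict (Icc 0 1)).withDensity fun t => ENNReal.ofReal (w t)) {e : ℝ}
    (he : e ∈ ({0, 1} : Set ℝ)) (hwe : 0 < w e) :
    ∃ a > 0, ∃ r₀ > 0, ∀ r, 0 ≤ r → r ≤ r₀ → ENNReal.ofReal (a * r) ≤ μ (endRegion e r) := by
  have heI : e ∈ Icc (0 : ℝ) 1 := by rcases he with rfl | rfl <;> simp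
  obtain ⟨r₀, hr₀, h⟩ := Metric.continuousWithinAt_iff.1 (hw e heI) (w e / 2) (by positivity)
  refine ⟨w e / 2, by positivity, min 1 (r₀ / 2), by positivity, fun r hr hrr => ?_⟩
  have hr1 := hrr.trans (min_le_left _ _)
  have hr2 := hrr.trans (min_le_right _ _)
  rw [measure_endRegion_eq hμ]
  calc _ = ENNReal.ofReal (w e / 2) * ENNReal.ofReal r := ENNReal.ofReal_mul (by positivity)
    _ ≤ ENNReal.ofReal (w e / 2) * volume (endRegion e r) := by
        gcongr; exact le_volume_endRegion he hr1
    _ = ∫⁻ t in endRegion e r, ENNReal.ofReal (w e / 2) := by rw [setLIntegral_const]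
    _ ≤ _ := by
        refine setLIntegral_mono' (measurableSet_endRegion e r) fun t ht => ?_
        refine ENNReal.ofReal_le_ofReal ?_
        have := h ht.1 (by rw [Real.dist_eq]; linarith [ht.2])
        rw [Real.dist_eq, abs_lt] at this
        linarith [this.1]

theorem endRegion_zero_one : endRegion 0 1 = Icc 0 1 :=
  subset_antisymm (endRegion_subset 0 1) fun t ht =>
    ⟨ht, by rw [sub_zero, abs_of_nonneg ht.1]; exact ht.2⟩

theorem ContinuousOn.integrableOn_endRegion (hμ : μ (Icc 0 1) ≠ ∞) {f : ℝ → ℝ}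
    (hf : ContinuousOn f (Icc 0 1)) (e r : ℝ) : IntegrableOn f (endRegion e r) μ := by
  obtain ⟨M, hM⟩ := hf.exists_abs_le_unit
  have : IsFiniteMeasure (μ.restrict (Icc 0 1)) := ⟨by simpa using hμ.lt_top⟩
  refine IntegrableOn.mono_set (t := Icc 0 1) ?_ (endRegion_subset e r)
  refine Integrable.of_bound (hf.aestronglyMeasurable measurableSet_Icc) M ?_
  filter_upwards [ae_restrict_mem measurableSet_Icc] with t ht using hM t ht

theorem abs_setIntegral_sub_le (hμ : μ (Icc 0 1) ≠ ∞) {f g h : ℝ → ℝ}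
    (hf : ContinuousOn f (Icc 0 1)) (hg : ContinuousOn g (Icc 0 1))
    (hh : ContinuousOn h (Icc 0 1)) {e r : ℝ} (hle : ∀ t ∈ endRegion e r, |f t - g t| ≤ h t) :
    |(∫ t in endRegion e r, f t ∂μ) - ∫ t in endRegion e r, g t ∂μ| ≤
      ∫ t in endRegion e r, h t ∂μ := by
  rw [← integral_sub (hf.integrableOn_endRegion hμ e r) (hg.integrableOn_endRegion hμ e r),
    ← Real.norm_eq_abs]
  refine norm_integral_le_of_norm_le (hh.integrableOn_endRegion hμ e r) ?_
  filter_upwards [ae_restrict_mem (measurableSet_endRegion e r)] with t ht using hle t ht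

end Weight

/-! ### A criterion for convergence in probability. -/

/-- Convergence to zero in probability from a bound by a multiple of a variable with bounded
expectation, valid off events of small probability. -/
theorem tendstoZeroInProb_of_bound {Ω : ℕ → Type*} [∀ n, MeasurableSpace (Ω n)]
    {P : ∀ n, Measure (Ω n)} {Z U : ∀ n, Ω n → ℝ} {bad : ∀ n, ℝ → Set (Ω n)} {q Cq Cu : ℝ}
    (hq : 0 < q) (hU0 : ∀ n ω, 0 ≤ U n ω)
    (hbad : ∀ n : ℕ, ∀ x ∈ Ioc (0 : ℝ) n, P n (bad n x) ≤ ENNReal.ofReal (Cq * x ^ (-q)))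
    (hU : ∀ᶠ n in atTop, AEMeasurable (U n) (P n) ∧
      ∫⁻ ω, ENNReal.ofReal (U n ω) ∂(P n) ≤ ENNReal.ofReal Cu)
    (hZ : ∀ x > 0, ∃ α β : ℕ → ℝ, Tendsto α atTop (𝓝 0) ∧ Tendsto β atTop (𝓝 0) ∧
      ∀ᶠ n in atTop, ∀ᵐ ω ∂(P n), ω ∉ bad n x → |Z n ω| ≤ α n * U n ω + β n) :
    TendstoZeroInProb P Z := by
  intro ε hε
  rw [ENNReal.tendsto_nhds_zero]
  intro η hη
  obtain ⟨η', hη'0, hη'⟩ : ∃ η' : ℝ, 0 < η' ∧ ENNReal.ofReal η' + ENNReal.ofReal η' ≤ η := by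
    rcases eq_or_ne η ∞ with rfl | hη2
    · exact ⟨1, one_pos, le_top⟩
    · have hp := ENNReal.toReal_pos hη.ne' hη2
      refine ⟨η.toReal / 2, by positivity, ?_⟩
      rw [← ENNReal.ofReal_add (by positivity) (by positivity), add_halves,
        ENNReal.ofReal_toReal hη2]
  -- First `x` makes the failure event rare, then `K` controls `U n` by Markov's inequality. Only
  -- afterwards are `α` and `β`, which depend on `x`, sent to zero.
  obtain ⟨x, hx0, hx⟩ : ∃ x : ℝ, 0 < x ∧ Cq * x ^ (-q) < η' := by
    have h : Tendsto (fun x : ℝ => Cq * x ^ (-q)) atTop (𝓝 (Cq * 0)) :=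
      (tendsto_rpow_neg_atTop hq).const_mul Cq
    rw [mul_zero] at h
    obtain ⟨x, h1, h2⟩ := ((h.eventually (gt_mem_nhds hη'0)).and (eventually_gt_atTop 0)).exists
    exact ⟨x, h2, h1⟩
  obtain ⟨K, hK0, hK⟩ : ∃ K : ℝ, 0 < K ∧ Cu / K ≤ η' := by
    refine ⟨(|Cu| + 1) / η', by positivity, ?_⟩
    rw [div_div_eq_mul_div, div_le_iff₀ (by positivity), mul_comm]
    gcongr
    linarith [le_abs_self Cu]
  obtain ⟨α, β, hα, hβ, hev⟩ := hZ x hx0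
  have hαβ : ∀ᶠ n in atTop, |α n| * K + β n < ε := by
    have : Tendsto (fun n => |α n| * K + β n) atTop (𝓝 (|0| * K + 0)) := (hα.abs.mul_const K).add hβ
    rw [abs_zero, zero_mul, zero_add] at this
    exact this.eventually (gt_mem_nhds hε)
  filter_upwards [hU, hev, hαβ, eventually_ge_atTop ⌈x⌉₊] with n hUn hn hlt hnx
  have h1 : P n {ω | ε ≤ |Z n ω|} ≤
      P n (bad n x ∪ {ω | ENNReal.ofReal K ≤ ENNReal.ofReal (U n ω)}) := by
    refine measure_mono_ae ?_
    filter_upwards [hn] with ω hω hε'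
    by_cases hb : ω ∈ bad n x
    · exact Or.inl hb
    refine Or.inr (ENNReal.ofReal_le_ofReal ?_)
    by_contra hc
    rw [not_le] at hc
    have h2 : ε ≤ |Z n ω| := hε'
    have h3 := hω hb
    have h4 : α n * U n ω ≤ |α n| * K := by
      calc α n * U n ω ≤ |α n| * U n ω := by gcongr; exacts [hU0 n ω, le_abs_self _]
        _ ≤ |α n| * K := by gcongr
    linarith
  have h2 : P n {ω | ENNReal.ofReal K ≤ ENNReal.ofReal (U n ω)} ≤ ENNReal.ofReal η' := by
    calc _ ≤ (∫⁻ ω, ENNReal.ofReal (U n ω) ∂(P n)) / ENNReal.ofReal K :=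
          meas_ge_le_lintegral_div hUn.1.ennreal_ofReal (by simpa using hK0) ENNReal.ofReal_ne_top
      _ ≤ ENNReal.ofReal Cu / ENNReal.ofReal K := by gcongr; exact hUn.2
      _ = ENNReal.ofReal (Cu / K) := (ENNReal.ofReal_div_of_pos hK0).symm
      _ ≤ _ := ENNReal.ofReal_le_ofReal hK
  calc _ ≤ _ := h1
    _ ≤ _ := measure_union_le _ _
    _ ≤ ENNReal.ofReal η' + ENNReal.ofReal η' := by
        refine add_le_add ((hbad n x ⟨hx0, ?_⟩).trans (ENNReal.ofReal_le_ofReal hx.le)) h2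
        exact Nat.ceil_le.1 hnx
    _ ≤ η := hη'

/-! ### Limits of Gaussian variables. -/

/-- An almost sure limit of centred Gaussian variables is a centred Gaussian variable. -/
theorem exists_map_eq_gaussianReal_of_tendsto {Ω : Type*} [MeasurableSpace Ω] {P : Measure Ω}
    [IsProbabilityMeasure P] {Z : ℕ → Ω → ℝ} {Y : Ω → ℝ}
    (hZ : ∀ m, ProbabilityTheory.HasGaussianLaw (Z m) P) (hmean : ∀ m, ∫ ω, Z m ω ∂P = 0)
    (hlim : ∀ᵐ ω ∂P, Tendsto (fun m => Z m ω) atTop (𝓝 (Y ω))) :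
    ∃ v : ℝ≥0, P.map Y = ProbabilityTheory.gaussianReal 0 v := by
  have hY : AEMeasurable Y P := aemeasurable_of_tendsto_metrizable_ae atTop
    (fun m => (hZ m).aemeasurable) hlim
  have : IsProbabilityMeasure (P.map Y) := Measure.isProbabilityMeasure_map hY
  set v : ℕ → ℝ≥0 := fun m => (ProbabilityTheory.variance (Z m) P).toNNReal
  have hφ : ∀ m t, charFun (P.map (Z m)) t = ((Real.exp (-(v m * t ^ 2 / 2)) : ℝ) : ℂ) := by
    intro m t
    rw [(hZ m).map_eq_gaussianReal, hmean m, ProbabilityTheory.charFun_gaussianReal]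
    push_cast
    congr 1
    ring
  have hconv : ∀ t, Tendsto (fun m => charFun (P.map (Z m)) t) atTop
      (𝓝 (charFun (P.map Y) t)) := by
    intro t
    have hc : Continuous fun x : ℝ => Complex.exp (t * x * Complex.I) := by fun_prop
    have e : ∀ W : Ω → ℝ, AEMeasurable W P →
        charFun (P.map W) t = ∫ ω, Complex.exp (t * W ω * Complex.I) ∂P := fun W hW => by
      rw [charFun_apply_real, integral_map hW hc.aestronglyMeasurable]
    rw [e Y hY]
    simp only [fun m => e (Z m) (hZ m).aemeasurable]
    refine tendsto_integral_of_dominated_convergence (fun _ => 1)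
      (fun m => hc.aestronglyMeasurable.comp_aemeasurable (hZ m).aemeasurable) (integrable_const _)
      (fun m => ae_of_all _ fun ω => ?_) ?_
    · rw [← Complex.ofReal_mul, Complex.norm_exp_ofReal_mul_I]
    · filter_upwards [hlim] with ω hω
      exact (hc.tendsto (Y ω)).comp hω
  -- A single frequency at which the limiting characteristic function does not vanish suffices: the
  -- logarithm of its modulus there determines the limit of the variances.
  obtain ⟨t₀, ht₀, hne⟩ : ∃ t₀ : ℝ, t₀ ≠ 0 ∧ charFun (P.map Y) t₀ ≠ 0 := by
    have hc : Continuous (charFun (P.map Y)) := continuous_charFun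
    have h0 : charFun (P.map Y) 0 ≠ 0 := by simp
    have h1 := hc.continuousAt.eventually_ne h0
    obtain ⟨t, h2, h3⟩ := ((h1.filter_mono nhdsWithin_le_nhds).and
      (self_mem_nhdsWithin : {x : ℝ | x ≠ 0} ∈ 𝓝[≠] 0)).exists
    exact ⟨t, h3, h2⟩
  have hv : ∃ V : ℝ, Tendsto (fun m => (v m : ℝ)) atTop (𝓝 V) := by
    have h1 := (hconv t₀).norm
    have h2 := (Real.continuousAt_log (norm_ne_zero_iff.2 hne)).tendsto.comp h1
    refine ⟨_, (h2.const_mul (-2 / t₀ ^ 2)).congr fun m => ?_⟩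
    rw [Function.comp_apply, hφ, Complex.norm_real, Real.norm_of_nonneg (Real.exp_nonneg _),
      Real.log_exp]
    field_simp
  obtain ⟨V, hV⟩ := hv
  have hV0 : 0 ≤ V := ge_of_tendsto' hV fun m => (v m).2
  lift V to ℝ≥0 using hV0
  refine ⟨V, Measure.ext_of_charFun (funext fun t => ?_)⟩
  refine tendsto_nhds_unique (hconv t) ?_
  have h1 : Tendsto (fun m => Real.exp (-(v m * t ^ 2 / 2))) atTop
      (𝓝 (Real.exp (-(V * t ^ 2 / 2)))) :=
    (Real.continuous_exp.tendsto _).comp (((hV.mul_const _).div_const _).neg)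
  have h2 := (Complex.continuous_ofReal.tendsto _).comp h1
  simp only [Function.comp_def] at h2
  simp only [hφ]
  convert h2 using 2
  rw [ProbabilityTheory.charFun_gaussianReal]
  push_cast
  congr 1
  ring

/-- A jointly Gaussian pair from an almost sure limit of its first coordinate. -/
theorem hasGaussianLaw_prodMk_of_tendsto {Ω : Type*} [MeasurableSpace Ω] {P : Measure Ω}
    [IsProbabilityMeasure P] {Z : ℕ → Ω → ℝ} {Y N : Ω → ℝ} (hN : AEMeasurable N P)
    (hZ : ∀ m a c, ProbabilityTheory.HasGaussianLaw (fun ω => a * Z m ω + c * N ω) P)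
    (hmean : ∀ m a c, ∫ ω, (a * Z m ω + c * N ω) ∂P = 0)
    (hlim : ∀ᵐ ω ∂P, Tendsto (fun m => Z m ω) atTop (𝓝 (Y ω))) :
    ProbabilityTheory.HasGaussianLaw (fun ω => (Y ω, N ω)) P := by
  have hY : AEMeasurable Y P := by
    refine aemeasurable_of_tendsto_metrizable_ae atTop (fun m => ?_) hlim
    simpa using (hZ m 1 0).aemeasurable
  -- Every linear functional of the pair is an almost sure limit of the combinations in `hZ`, hence
  -- Gaussian on the line.
  refine ⟨ProbabilityTheory.isGaussian_of_map_eq_gaussianReal fun ℓ => ⟨0, ?_⟩⟩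
  have e : ∀ y n : ℝ, ℓ (y, n) = ℓ (1, 0) * y + ℓ (0, 1) * n := by
    intro y n
    have : (y, n) = y • ((1 : ℝ), (0 : ℝ)) + n • ((0 : ℝ), (1 : ℝ)) := by simp
    rw [this, map_add, map_smul, map_smul, smul_eq_mul, smul_eq_mul]
    ring
  rw [AEMeasurable.map_map_of_aemeasurable (by fun_prop) (hY.prodMk hN)]
  refine exists_map_eq_gaussianReal_of_tendsto (fun m => hZ m (ℓ (1, 0)) (ℓ (0, 1)))
    (fun m => hmean m _ _) ?_
  filter_upwards [hlim] with ω hω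
  rw [Function.comp_apply, e (Y ω) (N ω)]
  exact (hω.const_mul _).add_const _

/-! ### Time-changed Brownian motions and bridges. -/

/-- A centred Gaussian process on `[0, 1]` with the covariance of a Brownian motion (`θ = 0`) or of
a Brownian bridge of length `1 / θ`, run along the clock `L`. -/
structure IsTimeChangedGaussian {Ω : Type*} [MeasurableSpace Ω] (L : ℝ → ℝ) (θ : ℝ)
    (X : ℝ → Ω → ℝ) (P : Measure Ω) : Prop where
  continuous : ∀ ω, Continuous fun u => X u ω
  measurable : ∀ u, Measurable (X u)
  gaussian : ProbabilityTheory.IsGaussianProcess X P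
  mean : ∀ u, ∫ ω, X u ω ∂P = 0
  integral_mul : ∀ u v, 0 ≤ u → u ≤ v → v ≤ 1 → ∫ ω, X u ω * X v ω ∂P = L u - θ * L u * L v

/-- A process with almost surely continuous paths coincides almost surely with one all of whose
paths are continuous and all of whose marginals are measurable. -/
theorem exists_continuous_modification {Ω : Type*} [MeasurableSpace Ω] {P : Measure Ω}
    {V : ℝ → Ω → ℝ} (hV : ∀ u, AEMeasurable (V u) P) (hc : ∀ᵐ ω ∂P, Continuous fun u => V u ω) :
    ∃ X : ℝ → Ω → ℝ, (∀ ω, Continuous fun u => X u ω) ∧ (∀ u, Measurable (X u)) ∧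
      ∀ᵐ ω ∂P, ∀ u, V u ω = X u ω := by
  -- Countably many times suffice: off one null set the path is continuous and agrees with
  -- measurable versions at all rationals, so its value at `u` is a limit of measurable functions.
  have hgood : ∀ᵐ ω ∂P, (Continuous fun u => V u ω) ∧ ∀ r : ℚ, V r ω = (hV r).mk (V r) ω :=
    hc.and (ae_all_iff.2 fun r => (hV r).ae_eq_mk)
  obtain ⟨N, hsub, hN, hN0⟩ := exists_measurable_superset_of_null (ae_iff.1 hgood)
  have hNc : ∀ ω ∉ N, (Continuous fun u => V u ω) ∧ ∀ r : ℚ, V r ω = (hV r).mk (V r) ω := by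
    intro ω hω
    by_contra h
    exact hω (hsub h)
  refine ⟨fun u => Nᶜ.indicator (V u), fun ω => ?_, fun u => ?_, ?_⟩
  · by_cases hω : ω ∈ N
    · simp only [indicator_of_notMem (notMem_compl_iff.2 hω)]
      exact continuous_const
    · simp only [indicator_of_mem (mem_compl hω)]
      exact (hNc ω hω).1
  · obtain ⟨r, hr⟩ : ∃ r : ℕ → ℚ, Tendsto (fun n => (r n : ℝ)) atTop (𝓝 u) := by
      obtain ⟨x, hx, hxu⟩ := mem_closure_iff_seq_limit.1 (Rat.denseRange_cast (𝕜 := ℝ) u)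
      choose r hr using hx
      exact ⟨r, by simpa only [hr] using hxu⟩
    refine measurable_of_tendsto_metrizable
      (f := fun n => Nᶜ.indicator ((hV (r n)).mk (V (r n)))) (fun n =>
        (hV (r n)).measurable_mk.indicator hN.compl) (tendsto_pi_nhds.2 fun ω => ?_)
    by_cases hω : ω ∈ N
    · simp only [indicator_of_notMem (notMem_compl_iff.2 hω)]
      exact tendsto_const_nhds
    · simp only [indicator_of_mem (mem_compl hω), ← (hNc ω hω).2]
      exact ((hNc ω hω).1.tendsto u).comp hr
  · filter_upwards [measure_eq_zero_iff_ae_notMem.1 hN0] with ω hω u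
    exact (indicator_of_mem (mem_compl hω) _).symm

theorem exists_isTimeChangedGaussian {Ω : Type*} [MeasurableSpace Ω] {P : Measure Ω}
    {B : ℝ≥0 → Ω → ℝ} {L : ℝ → ℝ} {θ : ℝ} (hL0 : 0 ≤ L 0) (hL : MonotoneOn L (Icc 0 1))
    (hLc : ContinuousOn L (Icc 0 1))
    (hB : ProbabilityTheory.IsGaussianProcess
      (fun t : Icc (0 : ℝ≥0) (L 1).toNNReal => B t) P)
    (hmean : ∀ t ≤ (L 1).toNNReal, ∫ ω, B t ω ∂P = 0)
    (hcov : ∀ s t, s ≤ t → t ≤ (L 1).toNNReal →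
      ProbabilityTheory.covariance (B s) (B t) P = (s : ℝ) - θ * s * t)
    (hcont : ∀ᵐ ω ∂P, ContinuousOn (fun t => B t ω) (Icc 0 (L 1).toNNReal)) :
    ∃ X : ℝ → Ω → ℝ, IsTimeChangedGaussian L θ X P ∧
      ∀ᵐ ω ∂P, ∀ u ∈ Icc (0 : ℝ) 1, timeChanged B L ω u = X u ω := by
  set T := (L 1).toNNReal
  set π : ℝ → Icc (0 : ℝ) 1 := projIcc 0 1 zero_le_one
  have hLT : ∀ u ∈ Icc (0 : ℝ) 1, (L u).toNNReal ≤ T := fun u hu =>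
    Real.toNNReal_le_toNNReal (hL hu (by simp) hu.2)
  have hLn : ∀ u ∈ Icc (0 : ℝ) 1, 0 ≤ L u := fun u hu => hL0.trans (hL (by simp) hu hu.1)
  -- Projecting onto `[0, 1]` before applying the clock gives paths defined and continuous on the
  -- whole line, although the path of `B` is only controlled on `[0, T]`.
  let τ : ℝ → Icc (0 : ℝ≥0) T := fun u => ⟨(L (π u)).toNNReal, zero_le, hLT _ (π u).2⟩
  have hτ : Continuous fun u => ((τ u : Icc (0 : ℝ≥0) T) : ℝ≥0) :=
    continuous_real_toNNReal.comp (hLc.domRestrict.comp continuous_projIcc)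
  have hG := hB.comp_right τ
  obtain ⟨X, hXc, hXm, hX⟩ := exists_continuous_modification (P := P)
    (V := fun u ω => B (τ u) ω) (fun u => hG.aemeasurable u) (by
      filter_upwards [hcont] with ω hω
      exact hω.comp_continuous hτ fun u => (τ u).2)
  have hXe : ∀ u, (fun ω => B (τ u) ω) =ᵐ[P] X u := fun u => by
    filter_upwards [hX] with ω hω using hω u
  have hXG : ProbabilityTheory.IsGaussianProcess X P := hG.congr hXe
  have := hXG.isProbabilityMeasure
  have hXmean : ∀ u, ∫ ω, X u ω ∂P = 0 := fun u => by
    rw [← integral_congr_ae (hXe u)]; exact hmean _ (τ u).2.2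
  have hproj : ∀ u ∈ Icc (0 : ℝ) 1, (π u : ℝ) = u := fun u hu => by
    simp only [π, projIcc_of_mem zero_le_one hu]
  refine ⟨X, ⟨hXc, hXm, hXG, hXmean, fun u v hu huv hv => ?_⟩, ?_⟩
  · have huI : u ∈ Icc (0 : ℝ) 1 := ⟨hu, huv.trans hv⟩
    have hvI : v ∈ Icc (0 : ℝ) 1 := ⟨hu.trans huv, hv⟩
    have h1 := ProbabilityTheory.covariance_eq_sub (hXG.hasGaussianLaw_eval u).memLp_two
      (hXG.hasGaussianLaw_eval v).memLp_two
    rw [hXmean, hXmean, zero_mul, sub_zero] at h1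
    have h2 := hcov (τ u) (τ v) (by
      simp only [τ, hproj u huI, hproj v hvI]
      exact Real.toNNReal_le_toNNReal (hL huI hvI huv)) (τ v).2.2
    have h3 : ProbabilityTheory.covariance (X u) (X v) P =
        ProbabilityTheory.covariance (B (τ u)) (B (τ v)) P := by
      rw [ProbabilityTheory.covariance, ProbabilityTheory.covariance,
        ← integral_congr_ae (hXe u), ← integral_congr_ae (hXe v)]
      refine integral_congr_ae ?_
      filter_upwards [hX] with ω hω
      rw [hω u, hω v]
    rw [h2, h1] at h3
    simp only [τ, hproj u huI, hproj v hvI, Real.coe_toNNReal _ (hLn u huI),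
      Real.coe_toNNReal _ (hLn v hvI)] at h3
    simpa using h3
  · filter_upwards [hX] with ω hω u hu
    rw [← hω u]
    simp only [τ, hproj u hu, timeChanged]

/-! ### Exchange of expectation and integral; absolute Gaussian moments. -/

section Fubini

variable {Ω : Type*} [MeasurableSpace Ω] {P : Measure Ω} [IsProbabilityMeasure P]

/-- Path continuity and marginal measurability give joint measurability; the uniform first moment
then gives joint integrability. -/
theorem integrable_uncurry_of_bound {W : ℝ → Ω → ℝ} {M : ℝ} (hc : ∀ ω, Continuous fun u => W u ω)
    (hm : ∀ u, Measurable (W u)) (hi : ∀ u, Integrable (W u) P)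
    (hM : ∀ u ∈ Icc (0 : ℝ) 1, ∫ ω, |W u ω| ∂P ≤ M) :
    Integrable (Function.uncurry W) ((volume.restrict (Ioc 0 1)).prod P) := by
  have hsm : StronglyMeasurable (Function.uncurry W) :=
    stronglyMeasurable_uncurry_of_continuous_of_stronglyMeasurable hc fun u =>
      (hm u).stronglyMeasurable
  refine (integrable_prod_iff hsm.aestronglyMeasurable).2 ⟨ae_of_all _ hi, ?_⟩
  refine Integrable.of_bound (hsm.norm.integral_prod_right).aestronglyMeasurable M ?_
  filter_upwards [ae_restrict_mem measurableSet_Ioc] with u hu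
  rw [Real.norm_of_nonneg (integral_nonneg fun _ => norm_nonneg _)]
  exact hM u ⟨hu.1.le, hu.2⟩

theorem integral_intervalIntegral_swap {W : ℝ → Ω → ℝ} {M : ℝ}
    (hc : ∀ ω, Continuous fun u => W u ω)
    (hm : ∀ u, Measurable (W u)) (hi : ∀ u, Integrable (W u) P)
    (hM : ∀ u ∈ Icc (0 : ℝ) 1, ∫ ω, |W u ω| ∂P ≤ M) {φ : ℝ → ℝ} (hφ : Continuous φ) :
    Integrable (fun ω => ∫ u in (0 : ℝ)..1, W u ω * φ u) P ∧
      ∫ ω, (∫ u in (0 : ℝ)..1, W u ω * φ u) ∂P =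
        ∫ u in (0 : ℝ)..1, (∫ ω, W u ω ∂P) * φ u := by
  obtain ⟨K, hK⟩ := hφ.continuousOn.exists_abs_le_unit
  have hK0 : 0 ≤ K := (abs_nonneg _).trans (hK 0 (by simp))
  have h := integrable_uncurry_of_bound (P := P) (W := fun u ω => W u ω * φ u) (M := M * K)
    (fun ω => (hc ω).mul hφ) (fun u => (hm u).mul_const _) (fun u => (hi u).mul_const _)
    fun u hu => by
      simp only [abs_mul]
      rw [integral_mul_const]
      have := hM u hu
      have := hK u hu
      gcongr
      exact (integral_nonneg fun _ => abs_nonneg _).trans (hM u hu)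
  simp only [intervalIntegral.integral_of_le zero_le_one]
  refine ⟨h.integral_prod_right, ?_⟩
  rw [← integral_integral_swap h]
  simp only [integral_mul_const]

end Fubini

theorem gaussianReal_zero_eq_map (v : ℝ≥0) : ProbabilityTheory.gaussianReal 0 v =
    (ProbabilityTheory.gaussianReal 0 1).map (fun x => Real.sqrt v * x) := by
  rw [ProbabilityTheory.gaussianReal_map_const_mul]
  congr 1
  · simp
  · ext; simp

/-- Absolute moments of the standard normal distribution. -/
noncomputable def normalAbsMoment (r : ℝ) : ℝ :=
  ∫ x, |x| ^ r ∂(ProbabilityTheory.gaussianReal 0 1)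

theorem normalAbsMoment_nonneg (r : ℝ) : 0 ≤ normalAbsMoment r :=
  integral_nonneg fun _ => Real.rpow_nonneg (abs_nonneg _) _

theorem integrable_abs_rpow_gaussianReal (v : ℝ≥0) {r : ℝ} (hr : 0 ≤ r) :
    Integrable (fun x => |x| ^ r) (ProbabilityTheory.gaussianReal 0 v) := by
  have h := ProbabilityTheory.memLp_id_gaussianReal (μ := 0) (v := v) r.toNNReal
  have := h.integrable_norm_rpow'
  simpa [hr] using this

theorem normalAbsMoment_one_pos : 0 < normalAbsMoment 1 := by
  refine (integral_pos_iff_support_of_nonneg (fun _ => Real.rpow_nonneg (abs_nonneg _) _)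
    (integrable_abs_rpow_gaussianReal 1 zero_le_one)).2 ?_
  have h0 : NullSingletonClass (ProbabilityTheory.gaussianReal 0 1) :=
    ProbabilityTheory.nullSingletonClass_gaussianReal one_ne_zero
  have e : Function.support (fun x : ℝ => |x| ^ (1 : ℝ)) = {0}ᶜ := by
    ext x; simp
  rw [e, prob_compl_eq_one_sub (measurableSet_singleton 0), measure_singleton]
  simp

section Moments

variable {Ω : Type*} [MeasurableSpace Ω] {P : Measure Ω} {Y : Ω → ℝ} {v : ℝ≥0}

theorem aemeasurable_of_map_eq_gaussianReal (hY : P.map Y = ProbabilityTheory.gaussianReal 0 v) :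
    AEMeasurable Y P :=
  AEMeasurable.of_map_ne_zero (by rw [hY]; exact IsProbabilityMeasure.ne_zero _)

theorem integrable_abs_rpow_of_map (hY : P.map Y = ProbabilityTheory.gaussianReal 0 v) {r : ℝ}
    (hr : 0 ≤ r) : Integrable (fun ω => |Y ω| ^ r) P := by
  have h := integrable_abs_rpow_gaussianReal v hr
  rw [← hY] at h
  exact h.comp_aemeasurable (aemeasurable_of_map_eq_gaussianReal hY)

theorem integral_abs_rpow_of_map (hY : P.map Y = ProbabilityTheory.gaussianReal 0 v) {r : ℝ}
    (hr : 0 ≤ r) : ∫ ω, |Y ω| ^ r ∂P = Real.sqrt v ^ r * normalAbsMoment r := by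
  have hc : Continuous fun x : ℝ => |x| ^ r := continuous_abs.rpow_const fun _ => Or.inr hr
  rw [← integral_map (aemeasurable_of_map_eq_gaussianReal hY)
    (f := fun x => |x| ^ r) hc.aestronglyMeasurable, hY, gaussianReal_zero_eq_map,
    integral_map (by fun_prop) hc.aestronglyMeasurable]
  simp only [abs_mul, abs_of_nonneg (Real.sqrt_nonneg _)]
  simp only [Real.mul_rpow (Real.sqrt_nonneg _) (abs_nonneg _)]
  rw [integral_const_mul, normalAbsMoment]

/-- The first absolute moment controls the variance of a centred Gaussian variable. -/
theorem sqrt_variance_le_of_map (hY : P.map Y = ProbabilityTheory.gaussianReal 0 v) {M : ℝ}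
    (hM : ∫ ω, |Y ω| ∂P ≤ M) : Real.sqrt v ≤ M / normalAbsMoment 1 := by
  have h := integral_abs_rpow_of_map hY zero_le_one
  simp only [Real.rpow_one] at h
  rw [le_div_iff₀ normalAbsMoment_one_pos, ← h]
  exact hM

end Moments

/-! ### The law and the covariances of the smoothed Gaussian process. -/

/-- One fixed sequence of equidistant partitions serves all paths at once, so that a smoothed
Gaussian path is a pointwise limit of fixed linear combinations of increments. -/
theorem HasRSIntegral.tendsto_sum {f X : ℝ → ℝ} {a c I : ℝ} (hac : a ≤ c)
    (h : HasRSIntegral f X a c I) :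
    Tendsto (fun m : ℕ => ∑ i ∈ Finset.range (m + 1), f (a + i * ((c - a) / (m + 1)))
      * (X (a + (i + 1) * ((c - a) / (m + 1))) - X (a + i * ((c - a) / (m + 1))))) atTop (𝓝 I) := by
  rw [Metric.tendsto_atTop]
  intro ε hε
  obtain ⟨δ, hδ, h⟩ := h ε hε
  obtain ⟨N, hN⟩ := exists_nat_gt ((c - a) / δ)
  refine ⟨N, fun m hm => ?_⟩
  have hm0 : (0 : ℝ) < m + 1 := by positivity
  have hstep0 : 0 ≤ (c - a) / (m + 1) := div_nonneg (by linarith) hm0.le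
  have hstep : (c - a) / (m + 1) < δ := by
    rw [div_lt_iff₀ hδ] at hN
    rw [div_lt_iff₀ hm0]
    have : (N : ℝ) ≤ m := by exact_mod_cast hm
    nlinarith
  have := h (m + 1) (fun i => a + i * ((c - a) / (m + 1))) (fun i => a + i * ((c - a) / (m + 1)))
    (by simp) (by push_cast; field_simp; ring) fun i _ => ⟨le_rfl, by push_cast; nlinarith, by
      push_cast; nlinarith⟩
  rw [Real.dist_eq]
  push_cast at this
  exact this

namespace IsTimeChangedGaussian

variable {Ω : Type*} [MeasurableSpace Ω] {P : Measure Ω} {L : ℝ → ℝ} {θ : ℝ} {X : ℝ → Ω → ℝ}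

theorem isRegulated (h : IsTimeChangedGaussian L θ X P) (ω : Ω) :
    IsRegulatedOnUnit fun u => X u ω :=
  (h.continuous ω).continuousOn.isCadlagOnUnit.isRegulatedOnUnit

theorem memLp_two (h : IsTimeChangedGaussian L θ X P) (u : ℝ) : MemLp (X u) 2 P :=
  (h.gaussian.hasGaussianLaw_eval u).memLp_two

theorem integrable (h : IsTimeChangedGaussian L θ X P) (u : ℝ) : Integrable (X u) P :=
  (h.gaussian.hasGaussianLaw_eval u).integrable

theorem integrable_mul (h : IsTimeChangedGaussian L θ X P) (u v : ℝ) :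
    Integrable (fun ω => X u ω * X v ω) P := (h.memLp_two u).integrable_mul (h.memLp_two v)

/-- For a bridge the covariance of increments keeps the Brownian form up to a factor that depends on
the long increment only and is close to one for short windows. -/
theorem integral_sub_mul_sub (h : IsTimeChangedGaussian L θ X P) {s u v : ℝ} (hs : 0 ≤ s)
    (hsu : s ≤ u) (huv : u ≤ v) (hv : v ≤ 1) :
    ∫ ω, (X u ω - X s ω) * (X v ω - X s ω) ∂P = (1 - θ * (L v - L s)) * (L u - L s) := by
  have e : (fun ω => (X u ω - X s ω) * (X v ω - X s ω)) = fun ω =>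
      X u ω * X v ω - X s ω * X u ω - X s ω * X v ω + X s ω * X s ω := by ext; ring
  have i1 : Integrable (fun ω => X u ω * X v ω - X s ω * X u ω) P :=
    (h.integrable_mul u v).sub (h.integrable_mul s u)
  have i2 : Integrable (fun ω => X u ω * X v ω - X s ω * X u ω - X s ω * X v ω) P :=
    i1.sub (h.integrable_mul s v)
  rw [e, integral_add i2 (h.integrable_mul s s), integral_sub i1 (h.integrable_mul s v),
    integral_sub (h.integrable_mul u v) (h.integrable_mul s u),
    h.integral_mul u v (hs.trans hsu) huv hv,
    h.integral_mul s u hs hsu (huv.trans hv), h.integral_mul s v hs (hsu.trans huv) hv,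
    h.integral_mul s s hs le_rfl (hsu.trans (huv.trans hv))]
  ring

/-- The bridge term `θ * (L u - L v) ^ 2` only lowers the Brownian variance of the increment. -/
theorem integral_sq_sub_le (h : IsTimeChangedGaussian L θ X P) (hθ : 0 ≤ θ) {A : ℝ}
    (hA : ∀ u ∈ Icc (0 : ℝ) 1, ∀ v ∈ Icc (0 : ℝ) 1, |L u - L v| ≤ A * |u - v|) {u v : ℝ}
    (hu : u ∈ Icc (0 : ℝ) 1) (hv : v ∈ Icc (0 : ℝ) 1) :
    ∫ ω, (X u ω - X v ω) ^ 2 ∂P ≤ A * |u - v| := by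
  wlog hvu : v ≤ u generalizing u v
  · have := this hv hu (le_of_not_ge hvu)
    rw [abs_sub_comm] at this
    simpa only [sub_sq_comm (X u _)] using this
  have e := h.integral_sub_mul_sub hv.1 hvu le_rfl hu.2
  simp only [← pow_two] at e
  rw [e]
  refine le_trans ?_ ((le_abs_self _).trans (hA u hu v hv))
  nlinarith [mul_nonneg hθ (sq_nonneg (L u - L v))]

theorem integral_abs_sub_le [IsProbabilityMeasure P] (h : IsTimeChangedGaussian L θ X P)
    (hθ : 0 ≤ θ) {A : ℝ}
    (hA : ∀ u ∈ Icc (0 : ℝ) 1, ∀ v ∈ Icc (0 : ℝ) 1, |L u - L v| ≤ A * |u - v|) {u v : ℝ}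
    (hu : u ∈ Icc (0 : ℝ) 1) (hv : v ∈ Icc (0 : ℝ) 1) :
    ∫ ω, |X u ω - X v ω| ∂P ≤ Real.sqrt (A * |u - v|) := by
  have hm : MemLp (fun ω => X u ω - X v ω) 2 P := (h.memLp_two u).sub (h.memLp_two v)
  have h2 := h.integral_sq_sub_le hθ hA hu hv
  have hA0 : 0 ≤ A * |u - v| := (abs_nonneg _).trans (hA u hu v hv)
  refine Real.le_sqrt_of_sq_le (le_trans ?_ h2)
  have hma : MemLp (fun ω => |X u ω - X v ω|) 2 P := hm.abs
  -- Nonnegativity of the variance of the absolute increment is Jensen's inequality `(E|Z|)^2 ≤ E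
  -- Z^2`.
  have h3 := ProbabilityTheory.variance_nonneg (fun ω => |X u ω - X v ω|) P
  rw [ProbabilityTheory.variance_eq_sub hma] at h3
  simp only [Pi.pow_apply, sq_abs] at h3
  linarith

end IsTimeChangedGaussian

/-- The kernel and its derivative vanish off the window. The covariance computation needs this
because its formula holds only for `u` between `s` and `v`. -/
theorem IsSmoothingKernel.smoothed_congr_window {k F G : ℝ → ℝ} (hk : IsSmoothingKernel k) {b t : ℝ}
    (hb : 0 < b) (h : ∀ u ∈ Icc (0 : ℝ) 1, |t - u| < b → F u = G u) :
    smoothed k b F t = smoothed k b G t := by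
  have h1 : ∀ u ∈ Icc (0 : ℝ) 1, k ((t - u) / b) * F u = k ((t - u) / b) * G u := by
    intro u hu
    rcases le_or_gt b |t - u| with h' | h'
    · rw [hk.eq_zero_div hb h', zero_mul, zero_mul]
    · rw [h u hu h']
  have h2 : ∫ u in (0 : ℝ)..1, F u * deriv k ((t - u) / b) =
      ∫ u in (0 : ℝ)..1, G u * deriv k ((t - u) / b) := by
    refine intervalIntegral.integral_congr fun u hu => ?_
    rw [uIcc_of_le zero_le_one] at hu
    rcases le_or_gt b |t - u| with h' | h'
    · simp only [hk.deriv_eq_zero_div hb h', mul_zero]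
    · simp only [h u hu h']
  have e1 := h1 1 (by simp)
  have e0 := h1 0 (by simp)
  rw [sub_zero] at e0
  rw [smoothed, smoothed, h2, mul_assoc, mul_assoc, mul_assoc, mul_assoc, e1, e0]

namespace IsTimeChangedGaussian

variable {Ω : Type*} [MeasurableSpace Ω] {P : Measure Ω} {L : ℝ → ℝ} {θ : ℝ} {X : ℝ → Ω → ℝ}
  {k : ℝ → ℝ}

theorem measurable_smoothed (h : IsTimeChangedGaussian L θ X P) (hk : IsSmoothingKernel k)
    (b t : ℝ) : Measurable fun ω => smoothed k b (fun u => X u ω) t := by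
  have hsm : StronglyMeasurable fun z : Ω × ℝ => X z.2 z.1 * deriv k ((t - z.2) / b) := by
    have h1 : StronglyMeasurable (Function.uncurry X) :=
      stronglyMeasurable_uncurry_of_continuous_of_stronglyMeasurable h.continuous fun u =>
        (h.measurable u).stronglyMeasurable
    exact (h1.comp_measurable measurable_swap).mul
      ((hk.continuous_deriv_comp b t).stronglyMeasurable.comp_measurable measurable_snd)
  have h2 : Measurable fun ω => ∫ u in (0 : ℝ)..1, X u ω * deriv k ((t - u) / b) := by
    simp only [intervalIntegral.integral_of_le zero_le_one]
    exact hsm.integral_prod_right.measurable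
  exact (((h.measurable 1).const_mul _).sub ((h.measurable 0).const_mul _)).add (h2.const_mul _)

theorem continuous_smoothed (h : IsTimeChangedGaussian L θ X P) (hk : IsSmoothingKernel k)
    (b : ℝ) (ω : Ω) : Continuous fun t => smoothed k b (fun u => X u ω) t :=
  hk.continuous_smoothed ((h.continuous ω).intervalIntegrable _ _) b

/-- Linear combinations of increments are Gaussian. -/
theorem hasGaussianLaw_sum_increments (h : IsTimeChangedGaussian L θ X P) {ι : Type*}
    (s : Finset ι) (c x y : ι → ℝ) :
    ProbabilityTheory.HasGaussianLaw (fun ω => ∑ i ∈ s, c i * (X (y i) ω - X (x i) ω)) P := by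
  classical
  have h1 : ProbabilityTheory.IsGaussianProcess (fun (i : ι) ω => X (y i) ω - X (x i) ω) P :=
    ProbabilityTheory.IsGaussianProcess.of_isGaussianProcess h.gaussian fun i => ⟨{y i, x i},
      { toFun z := z ⟨y i, by simp⟩ - z ⟨x i, by simp⟩
        map_add' z z' := by simp; abel
        map_smul' r z := by simp; ring },
      by simp⟩
  simpa using (h1.smul c).hasGaussianLaw_fun_sum (I := s)

theorem integral_sum_increments (h : IsTimeChangedGaussian L θ X P) {ι : Type*}
    (s : Finset ι) (c x y : ι → ℝ) :
    ∫ ω, ∑ i ∈ s, c i * (X (y i) ω - X (x i) ω) ∂P = 0 := by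
  have hi : ∀ i ∈ s, Integrable (fun ω => c i * (X (y i) ω - X (x i) ω)) P := fun i _ =>
    ((h.integrable _).sub (h.integrable _)).const_mul _
  rw [integral_finsetSum _ hi]
  refine Finset.sum_eq_zero fun i _ => ?_
  rw [integral_const_mul, integral_sub (h.integrable _) (h.integrable _), h.mean, h.mean]
  simp

/-- The smoothed process is a limit of linear combinations of increments. -/
theorem exists_tendsto_smoothed (h : IsTimeChangedGaussian L θ X P)
    (hk : IsSmoothingKernel k) {b t : ℝ} (hb : 0 < b) (ht : t ∈ Icc (0 : ℝ) 1) :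
    ∃ c x y : ℕ → ℕ → ℝ, ∀ ω, Tendsto (fun m => ∑ i ∈ Finset.range (m + 1),
      c m i * (X (y m i) ω - X (x m i) ω)) atTop (𝓝 (smoothed k b (fun u => X u ω) t)) := by
  have hac : max 0 (t - b) ≤ min 1 (t + b) :=
    (max_le ht.1 (by linarith)).trans (le_min ht.2 (by linarith : t ≤ t + b))
  have hR := fun ω => ((h.isRegulated ω).hasRSIntegral_smoothed hk hb ht).tendsto_sum hac
  exact ⟨fun m i => rescaledKernel k b
    (t - (max 0 (t - b) + i * ((min 1 (t + b) - max 0 (t - b)) / (m + 1)))), _, _, hR⟩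

/-- The smoothed process at a point and an increment of the path are jointly Gaussian. -/
theorem hasGaussianLaw_prodMk [IsProbabilityMeasure P] (h : IsTimeChangedGaussian L θ X P)
    (hk : IsSmoothingKernel k) {b t : ℝ} (hb : 0 < b) (ht : t ∈ Icc (0 : ℝ) 1) (s v : ℝ) :
    ProbabilityTheory.HasGaussianLaw
      (fun ω => (smoothed k b (fun u => X u ω) t, X v ω - X s ω)) P := by
  obtain ⟨c, x, y, hlim⟩ := h.exists_tendsto_smoothed hk hb ht
  -- The extra increment from `s` to `v` is indexed by `none`, so that the combination is again a
  -- finite sum of increments.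
  have hcomb : ∀ (m : ℕ) (r q : ℝ), (fun ω => r * (∑ i ∈ Finset.range (m + 1),
      c m i * (X (y m i) ω - X (x m i) ω)) + q * (X v ω - X s ω)) =
      fun ω => ∑ i ∈ Finset.insertNone (Finset.range (m + 1)),
        (i.elim q fun i => r * c m i) * (X (i.elim v (y m)) ω - X (i.elim s (x m)) ω) := by
    intro m r q
    ext ω
    rw [Finset.sum_insertNone, Finset.mul_sum, add_comm]
    simp only [Option.elim, mul_assoc]
  refine hasGaussianLaw_prodMk_of_tendsto
    ((h.measurable v).sub (h.measurable s)).aemeasurable ?_ ?_ (ae_of_all _ hlim)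
  · intro m r q
    rw [hcomb]
    exact h.hasGaussianLaw_sum_increments _ _ _ _
  · intro m r q
    rw [hcomb]
    exact h.integral_sum_increments _ _ _ _

theorem exists_map_smoothed [IsProbabilityMeasure P] (h : IsTimeChangedGaussian L θ X P)
    (hk : IsSmoothingKernel k) {b t : ℝ} (hb : 0 < b) (ht : t ∈ Icc (0 : ℝ) 1) :
    ∃ v : ℝ≥0, P.map (fun ω => smoothed k b (fun u => X u ω) t) =
      ProbabilityTheory.gaussianReal 0 v := by
  obtain ⟨c, x, y, hlim⟩ := h.exists_tendsto_smoothed hk hb ht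
  exact exists_map_eq_gaussianReal_of_tendsto
    (fun m => h.hasGaussianLaw_sum_increments (Finset.range (m + 1)) _ _ _)
    (fun m => h.integral_sum_increments _ _ _ _) (ae_of_all _ hlim)

/-- The smoothed process is of order `b^{-1/2}`. -/
theorem integral_abs_smoothed_le [IsProbabilityMeasure P] (h : IsTimeChangedGaussian L θ X P)
    (hk : IsSmoothingKernel k) (hθ : 0 ≤ θ) {A K : ℝ}
    (hA : ∀ u ∈ Icc (0 : ℝ) 1, ∀ v ∈ Icc (0 : ℝ) 1, |L u - L v| ≤ A * |u - v|)
    (hK : ∀ y, |k y| ≤ K) {b t : ℝ} (hb : 0 < b) (ht : t ∈ Icc (0 : ℝ) 1) :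
    ∫ ω, |smoothed k b (fun u => X u ω) t| ∂P ≤
      (2 * K + ∫ y, |deriv k y|) * Real.sqrt A / Real.sqrt b := by
  have hA0 : 0 ≤ A := by
    have := (abs_nonneg _).trans (hA 0 (by simp) 1 (by simp)); simpa using this
  have hK0 : 0 ≤ K := (abs_nonneg _).trans (hK 0)
  -- A factor `z` carrying the kernel or its derivative vanishes unless `|t - u| < b`, and there the
  -- increment from `t` has first absolute moment at most `√(A b)`.
  have hE : ∀ u ∈ Icc (0 : ℝ) 1, ∀ z : ℝ, (b ≤ |t - u| → z = 0) →
      |z| * ∫ ω, |X u ω - X t ω| ∂P ≤ |z| * Real.sqrt (A * b) := by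
    intro u hu z hz
    rcases le_or_gt b |t - u| with h' | h'
    · rw [hz h', abs_zero, zero_mul, zero_mul]
    · refine mul_le_mul_of_nonneg_left ((h.integral_abs_sub_le hθ hA hu ht).trans
        (Real.sqrt_le_sqrt ?_)) (abs_nonneg _)
      rw [abs_sub_comm]
      gcongr
  have hd : ∀ u, Integrable (fun ω => |X u ω - X t ω|) P := fun u =>
    ((h.integrable u).sub (h.integrable t)).abs
  have hM : ∀ u ∈ Icc (0 : ℝ) 1, ∫ ω, |(|X u ω - X t ω|)| ∂P ≤ Real.sqrt (A * 1) := by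
    intro u hu
    simp only [abs_abs]
    refine (h.integral_abs_sub_le hθ hA hu ht).trans (Real.sqrt_le_sqrt ?_)
    gcongr
    rw [abs_le]; constructor <;> linarith [hu.1, hu.2, ht.1, ht.2]
  have hφ : Continuous fun u => |deriv k ((t - u) / b)| := (hk.continuous_deriv_comp b t).abs
  obtain ⟨hI, hS⟩ := integral_intervalIntegral_swap (P := P) (W := fun u ω => |X u ω - X t ω|)
    (fun ω => ((h.continuous ω).sub continuous_const).abs)
    (fun u => ((h.measurable u).sub (h.measurable t)).abs) hd hM hφ
  have hpath : ∀ ω, |smoothed k b (fun u => X u ω) t| ≤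
      b⁻¹ * |k ((t - 1) / b)| * |X 1 ω - X t ω| + b⁻¹ * |k (t / b)| * |X 0 ω - X t ω|
        + (b ^ 2)⁻¹ * ∫ u in (0 : ℝ)..1, |X u ω - X t ω| * |deriv k ((t - u) / b)| := by
    intro ω
    -- Recentring at `X t` brings in the small increments; without it the boundary and interior
    -- terms would be of order `1 / b`.
    rw [← hk.smoothed_sub_const ((h.continuous ω).intervalIntegrable _ _) (X t ω), smoothed]
    refine (abs_add_le _ _).trans (add_le_add ((abs_sub _ _).trans (add_le_add ?_ ?_)) ?_)
    · rw [abs_mul, abs_mul, abs_of_pos (inv_pos.2 hb)]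
    · rw [abs_mul, abs_mul, abs_of_pos (inv_pos.2 hb)]
    · rw [abs_mul, abs_of_pos (inv_pos.2 (by positivity))]
      gcongr
      simp only [← abs_mul]
      exact intervalIntegral.abs_integral_le_integral_abs zero_le_one
  have i1 : Integrable (fun ω => b⁻¹ * |k ((t - 1) / b)| * |X 1 ω - X t ω|) P :=
    (hd 1).const_mul _
  have i2 : Integrable (fun ω => b⁻¹ * |k (t / b)| * |X 0 ω - X t ω|) P := (hd 0).const_mul _
  have i12 : Integrable (fun ω => b⁻¹ * |k ((t - 1) / b)| * |X 1 ω - X t ω|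
      + b⁻¹ * |k (t / b)| * |X 0 ω - X t ω|) P := i1.add i2
  have i3 : Integrable (fun ω => (b ^ 2)⁻¹ *
      ∫ u in (0 : ℝ)..1, |X u ω - X t ω| * |deriv k ((t - u) / b)|) P := hI.const_mul _
  have hle := integral_mono_of_nonneg (ae_of_all P fun ω => abs_nonneg _) (i12.add i3)
    (ae_of_all _ hpath)
  have hsb := Real.sq_sqrt hb.le
  have hsb0 := Real.sqrt_pos.2 hb
  have b1 : ∫ ω, b⁻¹ * |k ((t - 1) / b)| * |X 1 ω - X t ω| ∂P ≤ b⁻¹ * (K * Real.sqrt (A * b)) := by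
    rw [integral_const_mul, mul_assoc]
    refine mul_le_mul_of_nonneg_left ?_ (inv_nonneg.2 hb.le)
    refine (hE 1 (by simp) _ fun h' => hk.eq_zero_div hb h').trans ?_
    gcongr
    exact hK _
  have b2 : ∫ ω, b⁻¹ * |k (t / b)| * |X 0 ω - X t ω| ∂P ≤ b⁻¹ * (K * Real.sqrt (A * b)) := by
    rw [integral_const_mul, mul_assoc]
    refine mul_le_mul_of_nonneg_left ?_ (inv_nonneg.2 hb.le)
    refine (hE 0 (by simp) _ fun h' => hk.eq_zero_div hb (by rwa [sub_zero] at h')).trans ?_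
    gcongr
    exact hK _
  have b3 : ∫ ω, ((b ^ 2)⁻¹ *
      ∫ u in (0 : ℝ)..1, |X u ω - X t ω| * |deriv k ((t - u) / b)|) ∂P ≤
      (b ^ 2)⁻¹ * (Real.sqrt (A * b) * (b * ∫ y, |deriv k y|)) := by
    rw [integral_const_mul, hS]
    gcongr
    calc _ ≤ ∫ u in (0 : ℝ)..1, Real.sqrt (A * b) * |deriv k ((t - u) / b)| := by
          rw [intervalIntegral.integral_of_le zero_le_one, intervalIntegral.integral_of_le zero_le_one]
          refine integral_mono_of_nonneg (ae_of_all _ fun u => mul_nonneg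
            (integral_nonneg fun _ => abs_nonneg _) (abs_nonneg _)) ?_ ?_
          · exact ((hφ.const_mul _).integrableOn_Ioc)
          · filter_upwards [ae_restrict_mem measurableSet_Ioc] with u hu
            rw [mul_comm, mul_comm (Real.sqrt _)]
            exact hE u ⟨hu.1.le, hu.2⟩ _ fun h' => hk.deriv_eq_zero_div hb h'
      _ ≤ _ := by
          rw [intervalIntegral.integral_const_mul]
          gcongr
          exact hk.integral_abs_deriv_le hb t
  have e : ∫ ω, (b⁻¹ * |k ((t - 1) / b)| * |X 1 ω - X t ω| + b⁻¹ * |k (t / b)| * |X 0 ω - X t ω|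
        + (b ^ 2)⁻¹ * ∫ u in (0 : ℝ)..1, |X u ω - X t ω| * |deriv k ((t - u) / b)|) ∂P =
      ∫ ω, b⁻¹ * |k ((t - 1) / b)| * |X 1 ω - X t ω| ∂P +
      ∫ ω, b⁻¹ * |k (t / b)| * |X 0 ω - X t ω| ∂P + ∫ ω, ((b ^ 2)⁻¹ *
      ∫ u in (0 : ℝ)..1, |X u ω - X t ω| * |deriv k ((t - u) / b)|) ∂P := by
    rw [integral_add i12 i3, integral_add i1 i2]
  have e2 : (2 * K + ∫ y, |deriv k y|) * Real.sqrt A / Real.sqrt b =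
      b⁻¹ * (K * Real.sqrt (A * b)) + b⁻¹ * (K * Real.sqrt (A * b)) +
      (b ^ 2)⁻¹ * (Real.sqrt (A * b) * (b * ∫ y, |deriv k y|)) := by
    rw [Real.sqrt_mul hA0]
    set r := Real.sqrt b
    rw [← hsb]
    field_simp
    ring
  refine hle.trans ?_
  simp only [Pi.add_apply]
  rw [e, e2]
  linarith

/-- The covariance of the smoothed process with an increment over an interval which contains the
window of the kernel. -/
theorem integral_smoothed_mul [IsProbabilityMeasure P] (h : IsTimeChangedGaussian L θ X P)
    (hk : IsSmoothingKernel k) (hθ : 0 ≤ θ) {A : ℝ} {L' : ℝ → ℝ}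
    (hA : ∀ u ∈ Icc (0 : ℝ) 1, ∀ v ∈ Icc (0 : ℝ) 1, |L u - L v| ≤ A * |u - v|)
    (hL : ∀ u ∈ Icc (0 : ℝ) 1, HasDerivWithinAt L (L' u) (Icc 0 1) u)
    (hL' : ContinuousOn L' (Icc 0 1)) {b t s v : ℝ} (hb : 0 < b)
    (hs : s ∈ Icc (0 : ℝ) 1) (hv : v ∈ Icc (0 : ℝ) 1)
    (hwin : ∀ u ∈ Icc (0 : ℝ) 1, |t - u| < b → u ∈ Icc s v) :
    ∫ ω, smoothed k b (fun u => X u ω) t * (X v ω - X s ω) ∂P =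
      (1 - θ * (L v - L s)) * ∫ u in (0 : ℝ)..1, rescaledKernel k b (t - u) * L' u := by
  have hA0 : 0 ≤ A := by
    have := (abs_nonneg _).trans (hA 0 (by simp) 1 (by simp)); simpa using this
  have hmem : ∀ u w, MemLp (fun ω => X u ω - X w ω) 2 P := fun u w =>
    (h.memLp_two u).sub (h.memLp_two w)
  have hi : ∀ u, Integrable (fun ω => (X u ω - X s ω) * (X v ω - X s ω)) P := fun u =>
    (hmem u s).integrable_mul (hmem v s)
  have hsq : ∀ u ∈ Icc (0 : ℝ) 1, ∫ ω, (X u ω - X s ω) ^ 2 ∂P ≤ A := fun u hu => by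
    refine (h.integral_sq_sub_le hθ hA hu hs).trans (mul_le_of_le_one_right hA0 ?_)
    rw [abs_le]; constructor <;> linarith [hu.1, hu.2, hs.1, hs.2]
  have hM : ∀ u ∈ Icc (0 : ℝ) 1, ∫ ω, |(X u ω - X s ω) * (X v ω - X s ω)| ∂P ≤ A := by
    intro u hu
    have j : Integrable (fun ω => (X u ω - X s ω) ^ 2 / 2 + (X v ω - X s ω) ^ 2 / 2) P :=
      ((hmem u s).integrable_sq.div_const 2).add ((hmem v s).integrable_sq.div_const 2)
    refine (integral_mono (hi u).abs j fun ω => ?_).trans ?_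
    · simp only
      rw [abs_mul]
      nlinarith [sq_nonneg (|X u ω - X s ω| - |X v ω - X s ω|), sq_abs (X u ω - X s ω),
        sq_abs (X v ω - X s ω)]
    · rw [integral_add ((hmem u s).integrable_sq.div_const 2)
        ((hmem v s).integrable_sq.div_const 2), integral_div, integral_div]
      linarith [hsq u hu, hsq v hv]
  obtain ⟨hI, hS⟩ := integral_intervalIntegral_swap (P := P)
    (W := fun u ω => (X u ω - X s ω) * (X v ω - X s ω))
    (fun ω => ((h.continuous ω).sub continuous_const).mul continuous_const)
    (fun u => ((h.measurable u).sub (h.measurable s)).mul ((h.measurable v).sub (h.measurable s)))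
    hi hM (hk.continuous_deriv_comp b t)
  have hpath : ∀ ω, smoothed k b (fun u => X u ω) t * (X v ω - X s ω) =
      b⁻¹ * k ((t - 1) / b) * ((X 1 ω - X s ω) * (X v ω - X s ω))
        - b⁻¹ * k (t / b) * ((X 0 ω - X s ω) * (X v ω - X s ω)) + (b ^ 2)⁻¹ *
        ∫ u in (0 : ℝ)..1, (X u ω - X s ω) * (X v ω - X s ω) * deriv k ((t - u) / b) := by
    intro ω
    rw [← hk.smoothed_sub_const ((h.continuous ω).intervalIntegrable _ _) (X s ω), smoothed]
    have : ∫ u in (0 : ℝ)..1, (X u ω - X s ω) * (X v ω - X s ω) * deriv k ((t - u) / b) =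
        (∫ u in (0 : ℝ)..1, (X u ω - X s ω) * deriv k ((t - u) / b)) * (X v ω - X s ω) := by
      rw [← intervalIntegral.integral_mul_const]
      congr 1; ext u; ring
    rw [this]; ring
  have i1 : Integrable (fun ω => b⁻¹ * k ((t - 1) / b) * ((X 1 ω - X s ω) * (X v ω - X s ω))
      - b⁻¹ * k (t / b) * ((X 0 ω - X s ω) * (X v ω - X s ω))) P :=
    ((hi 1).const_mul _).sub ((hi 0).const_mul _)
  simp only [hpath]
  rw [integral_add i1 (hI.const_mul _), integral_sub ((hi 1).const_mul _) ((hi 0).const_mul _),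
    integral_const_mul, integral_const_mul, integral_const_mul, hS]
  -- Expectation commutes with smoothing, and on the window the covariance is a constant times `L u
  -- - L s`. Smoothing a differentiable function amounts to smoothing its derivative.
  have hsm : smoothed k b (fun u => ∫ ω, (X u ω - X s ω) * (X v ω - X s ω) ∂P) t =
      smoothed k b (fun u => (1 - θ * (L v - L s)) * (L u - L s)) t := by
    refine hk.smoothed_congr_window hb fun u hu hut => ?_
    have := hwin u hu hut
    exact h.integral_sub_mul_sub hs.1 this.1 this.2 hv.2
  rw [smoothed_const_mul, hk.smoothed_sub_const, hk.smoothed_of_hasDerivWithinAt hL hL'] at hsm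
  · rw [← hsm, smoothed]
  · have : ContinuousOn L (Icc 0 1) := fun u hu => (hL u hu).continuousWithinAt
    exact this.isCadlagOnUnit.isRegulatedOnUnit.intervalIntegrable

end IsTimeChangedGaussian

/-! ### Decomposition of the scaled error into Gaussian part, bias and coupling error. -/

/-- The event that the path `Λ_n` is further than `x n^{-1 + 1/q}` from its approximation. -/
def couplingFailure {Ω : Type*} (lam : ℝ → ℝ) (q : ℝ) (n : ℕ) (Lam X : ℝ → Ω → ℝ) (x : ℝ) : Set Ω :=
  {ω | ∃ t ∈ Icc (0 : ℝ) 1, x < (n : ℝ) ^ (1 - 1 / q) *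
    |(Lam t ω - ∫ u in (0 : ℝ)..t, lam u) - (Real.sqrt n)⁻¹ * X t ω|}

/-- The size of the error in the strong approximation of the scaled estimator. -/
noncomputable def couplingRate (q : ℝ) (b : ℕ → ℝ) (n : ℕ) : ℝ :=
  Real.sqrt (n * b n) / b n * (n : ℝ) ^ (-1 + 1 / q)

theorem couplingRate_nonneg {q : ℝ} {b : ℕ → ℝ} (hb : ∀ n, 0 < b n) (n : ℕ) :
    0 ≤ couplingRate q b n := by
  have := hb n
  unfold couplingRate
  positivity

/-- The path of `Y_n`. -/
noncomputable def gaussianPath {Ω : Type*} (k : ℝ → ℝ) (b : ℝ) (X : ℝ → Ω → ℝ) (ω : Ω) (t : ℝ) : ℝ :=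
  Real.sqrt b * smoothed k b (fun u => X u ω) t

/-- The scaled estimation error is the sum of a Gaussian process, the scaled bias and an error
controlled by the quality of the strong approximation. -/
theorem IsSmoothingKernel.exists_abs_decomposition_le {k lam : ℝ → ℝ} (hk : IsSmoothingKernel k)
    (hlam : ContinuousOn lam (Icc 0 1)) :
    ∃ C > 0, ∀ (n : ℕ) (b d : ℝ) (Λ X : ℝ → ℝ), 0 < n → 0 < b → IsCadlagOnUnit Λ → Continuous X →
      (∀ t ∈ Icc (0 : ℝ) 1, |(Λ t - ∫ u in (0 : ℝ)..t, lam u) - (Real.sqrt n)⁻¹ * X t| ≤ d) →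
      ∀ t ∈ Icc (0 : ℝ) 1, |Real.sqrt (n * b) * (kernelSmooth k b Λ t - lam t) -
        (Real.sqrt b * smoothed k b X t + scaledBias k lam n b t)| ≤
          C * (Real.sqrt (n * b) / b * d) := by
  obtain ⟨C, hC0, hC⟩ := hk.exists_abs_smoothed_le
  refine ⟨C, hC0, fun n b d Λ X hn hb hΛ hX hd t ht => ?_⟩
  have hΛ' := hlam.hasDerivWithinAt_integral
  have hc : ContinuousOn (fun t => ∫ v in (0 : ℝ)..t, lam v) (Icc 0 1) := fun u hu =>
    (hΛ' u hu).continuousWithinAt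
  have i1 := hΛ.isRegulatedOnUnit.intervalIntegrable
  have i2 := hc.isCadlagOnUnit.isRegulatedOnUnit.intervalIntegrable
  have i3 : IntervalIntegrable (fun u => (Real.sqrt n)⁻¹ * X u) volume 0 1 :=
    (continuous_const.mul hX).intervalIntegrable _ _
  have i4 : IntervalIntegrable (fun t => (Λ t - ∫ u in (0 : ℝ)..t, lam u) -
      (Real.sqrt n)⁻¹ * X t) volume 0 1 := (i1.sub i2).sub i3
  have i5 : IntervalIntegrable (fun t => (∫ u in (0 : ℝ)..t, lam u) + (Real.sqrt n)⁻¹ * X t)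
      volume 0 1 := i2.add i3
  -- Linearity of smoothing applied to `Λ = primitive + n^{-1/2} X + remainder`; the remainder is
  -- bounded by `d`, so its smoothing is at most `C * d / b`.
  have e : kernelSmooth k b Λ t = (∫ u in (0 : ℝ)..1, rescaledKernel k b (t - u) * lam u) +
      (Real.sqrt n)⁻¹ * smoothed k b X t + smoothed k b (fun t => (Λ t - ∫ u in (0 : ℝ)..t, lam u) -
      (Real.sqrt n)⁻¹ * X t) t := by
    rw [hΛ.isRegulatedOnUnit.kernelSmooth_eq hk hb ht,
      ← hk.smoothed_of_hasDerivWithinAt hΛ' hlam b t, ← smoothed_const_mul,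
      ← hk.smoothed_add i2 i3, ← hk.smoothed_add i5 i4]
    exact smoothed_congr (fun u _ => by ring) t
  have hn0 : (0 : ℝ) < Real.sqrt n := Real.sqrt_pos.2 (by exact_mod_cast hn)
  have e2 : Real.sqrt (n * b) * (Real.sqrt n)⁻¹ = Real.sqrt b := by
    rw [Real.sqrt_mul (by positivity)]; field_simp
  have h := hC b hb _ d hd t
  rw [e, scaledBias, ← e2]
  set R := smoothed k b (fun t => (Λ t - ∫ u in (0 : ℝ)..t, lam u) - (Real.sqrt n)⁻¹ * X t) t
  set I := ∫ u in (0 : ℝ)..1, rescaledKernel k b (t - u) * lam u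
  have e3 : Real.sqrt (n * b) * (I + (Real.sqrt n)⁻¹ * smoothed k b X t + R - lam t) -
      (Real.sqrt (n * b) * (Real.sqrt n)⁻¹ * smoothed k b X t + Real.sqrt (n * b) * (I - lam t)) =
      Real.sqrt (n * b) * R := by ring
  rw [e3, abs_mul, abs_of_nonneg (Real.sqrt_nonneg _)]
  calc _ ≤ Real.sqrt (n * b) * (C * d / b) := by gcongr
    _ = _ := by ring

theorem abs_le_of_notMem_couplingFailure {Ω : Type*} {lam : ℝ → ℝ} {q : ℝ} {n : ℕ}
    {Lam X : ℝ → Ω → ℝ} {x : ℝ} {ω : Ω} (hn : 0 < n)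
    (hω : ω ∉ couplingFailure lam q n Lam X x) :
    ∀ t ∈ Icc (0 : ℝ) 1, |(Lam t ω - ∫ u in (0 : ℝ)..t, lam u) - (Real.sqrt n)⁻¹ * X t ω| ≤
      x * (n : ℝ) ^ (-1 + 1 / q) := by
  intro t ht
  have hn' : (0 : ℝ) < n := by exact_mod_cast hn
  by_contra h
  rw [not_le] at h
  refine hω ⟨t, ht, ?_⟩
  have e : (-1 + 1 / q) = -(1 - 1 / q) := by ring
  rw [e, Real.rpow_neg hn'.le, ← div_eq_mul_inv, div_lt_iff₀ (Real.rpow_pos_of_pos hn' _)] at h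
  linarith

section Moments

variable {Ω : Type*} [MeasurableSpace Ω] {P : Measure Ω} {L : ℝ → ℝ}
  {θ : ℝ} {X : ℝ → Ω → ℝ} {k : ℝ → ℝ}

theorem IsTimeChangedGaussian.continuous_gaussianPath (h : IsTimeChangedGaussian L θ X P)
    (hk : IsSmoothingKernel k) (b : ℝ) (ω : Ω) : Continuous (gaussianPath k b X ω) :=
  (h.continuous_smoothed hk b ω).const_mul _

theorem IsTimeChangedGaussian.measurable_gaussianPath (h : IsTimeChangedGaussian L θ X P)
    (hk : IsSmoothingKernel k) (b t : ℝ) : Measurable fun ω => gaussianPath k b X ω t :=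
  (h.measurable_smoothed hk b t).const_mul _

theorem IsTimeChangedGaussian.stronglyMeasurable_gaussianPath (h : IsTimeChangedGaussian L θ X P)
    (hk : IsSmoothingKernel k) (b : ℝ) :
    StronglyMeasurable (Function.uncurry fun t ω => gaussianPath k b X ω t) :=
  stronglyMeasurable_uncurry_of_continuous_of_stronglyMeasurable
    (fun ω => h.continuous_gaussianPath hk b ω)
    fun t => (h.measurable_gaussianPath hk b t).stronglyMeasurable

/-- The marginals of the Gaussian process `Y_n` are centred and their variances are bounded. -/
theorem IsSmoothingKernel.exists_gaussianPath_law (hk : IsSmoothingKernel k) {A : ℝ}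
    (hA : ∀ u ∈ Icc (0 : ℝ) 1, ∀ v ∈ Icc (0 : ℝ) 1, |L u - L v| ≤ A * |u - v|) (hθ : 0 ≤ θ) :
    ∃ D : ℝ, 0 ≤ D ∧ ∀ {Ω : Type*} [MeasurableSpace Ω] {P : Measure Ω} [IsProbabilityMeasure P]
      {X : ℝ → Ω → ℝ}, IsTimeChangedGaussian L θ X P → ∀ b > 0, ∀ t ∈ Icc (0 : ℝ) 1,
      ∃ v : ℝ≥0, P.map (fun ω => gaussianPath k b X ω t) = ProbabilityTheory.gaussianReal 0 v ∧
        Real.sqrt v ≤ D := by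
  obtain ⟨K, hK0, hK, -⟩ := hk.exists_bound
  have hI : 0 ≤ ∫ y, |deriv k y| := integral_nonneg fun _ => abs_nonneg _
  refine ⟨(2 * K + ∫ y, |deriv k y|) * Real.sqrt A / normalAbsMoment 1,
    div_nonneg (by positivity) normalAbsMoment_one_pos.le, fun {Ω} _ P _ X h b hb t ht => ?_⟩
  obtain ⟨v, hv⟩ := h.exists_map_smoothed hk hb ht
  have hm := h.measurable_smoothed hk b t
  have hv' : P.map (fun ω => gaussianPath k b X ω t) =
      ProbabilityTheory.gaussianReal 0 (⟨Real.sqrt b ^ 2, sq_nonneg _⟩ * v) := by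
    have h1 := ProbabilityTheory.gaussianReal_map_const_mul (μ := 0) (v := v) (Real.sqrt b)
    rw [mul_zero, ← hv, Measure.map_map (by fun_prop) hm] at h1
    exact h1
  -- For a centred Gaussian variable a bound on the first absolute moment is a bound on the standard
  -- deviation, which avoids a double integral for the variance. The factor `√b` cancels the order
  -- `1 / √b` of the smoothed path.
  refine ⟨_, hv', sqrt_variance_le_of_map hv' ?_⟩
  simp only [gaussianPath, abs_mul, abs_of_nonneg (Real.sqrt_nonneg b)]
  rw [integral_const_mul]
  have h2 := h.integral_abs_smoothed_le hk hθ hA hK hb ht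
  have hsb := Real.sqrt_pos.2 hb
  calc _ ≤ Real.sqrt b * ((2 * K + ∫ y, |deriv k y|) * Real.sqrt A / Real.sqrt b) := by gcongr
    _ = _ := by field_simp

/-- Absolute moments of `Y_n` are bounded. -/
theorem IsSmoothingKernel.exists_gaussianPath_moment (hk : IsSmoothingKernel k) {A : ℝ}
    (hA : ∀ u ∈ Icc (0 : ℝ) 1, ∀ v ∈ Icc (0 : ℝ) 1, |L u - L v| ≤ A * |u - v|) (hθ : 0 ≤ θ)
    {r : ℝ} (hr : 0 ≤ r) :
    ∃ D : ℝ, 0 ≤ D ∧ ∀ {Ω : Type*} [MeasurableSpace Ω] {P : Measure Ω} [IsProbabilityMeasure P]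
      {X : ℝ → Ω → ℝ}, IsTimeChangedGaussian L θ X P → ∀ b > 0, ∀ t ∈ Icc (0 : ℝ) 1,
      Integrable (fun ω => |gaussianPath k b X ω t| ^ r) P ∧
        ∫ ω, |gaussianPath k b X ω t| ^ r ∂P ≤ D := by
  obtain ⟨D, hD0, hD⟩ := hk.exists_gaussianPath_law hA hθ
  refine ⟨D ^ r * normalAbsMoment r, mul_nonneg (Real.rpow_nonneg hD0 r)
    (normalAbsMoment_nonneg r), fun {Ω} _ P _ X h b hb t ht => ?_⟩
  obtain ⟨v, hv, hvD⟩ := hD h b hb t ht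
  refine ⟨integrable_abs_rpow_of_map hv hr, ?_⟩
  rw [integral_abs_rpow_of_map hv hr]
  have := normalAbsMoment_nonneg r
  gcongr

/-- Integrals of a nonnegative function of `Y_n` over a region: expectation. -/
theorem lintegral_ofReal_setIntegral_le [IsProbabilityMeasure P] {F : ℝ → Ω → ℝ} {ν : Measure ℝ}
    [IsFiniteMeasure ν] {D : ℝ}
    (hD : 0 ≤ D) (hF0 : ∀ t ω, 0 ≤ F t ω) (hF : StronglyMeasurable (Function.uncurry F))
    (hFi : ∀ᵐ t ∂ν, Integrable (F t) P ∧ ∫ ω, F t ω ∂P ≤ D) :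
    ∫⁻ ω, ENNReal.ofReal (∫ t, F t ω ∂ν) ∂P ≤ ENNReal.ofReal (D * ν.real univ) := by
  calc _ ≤ ∫⁻ ω, ∫⁻ t, ENNReal.ofReal (F t ω) ∂ν ∂P := by
        refine lintegral_mono fun ω => ?_
        by_cases hi : Integrable (fun t => F t ω) ν
        · rw [ofReal_integral_eq_lintegral_ofReal hi (ae_of_all _ fun t => hF0 t ω)]
        · rw [integral_undef hi]; simp
    _ = ∫⁻ t, ∫⁻ ω, ENNReal.ofReal (F t ω) ∂P ∂ν :=
        lintegral_lintegral_swap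
          (f := fun ω t => ENNReal.ofReal (F t ω))
          (hF.measurable.comp measurable_swap).ennreal_ofReal.aemeasurable
    _ ≤ ∫⁻ _, ENNReal.ofReal D ∂ν := by
        refine lintegral_mono_ae ?_
        filter_upwards [hFi] with t ht
        rw [← ofReal_integral_eq_lintegral_ofReal ht.1 (ae_of_all _ fun ω => hF0 t ω)]
        exact ENNReal.ofReal_le_ofReal ht.2
    _ = ENNReal.ofReal (D * ν.real univ) := by
        rw [lintegral_const, ENNReal.ofReal_mul hD, Measure.real,
          ENNReal.ofReal_toReal (measure_ne_top _ _)]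

end Moments

/-! ### Comparison of the `L_p` integrals over a boundary region. -/

/-- The standing assumptions on the strong approximation of the estimators `Λ_n` by the Gaussian
processes `X_n` with continuous paths. -/
structure StrongApproximation (k lam L : ℝ → ℝ) (θ q Cq : ℝ) (μ : Measure ℝ) {Ω : ℕ → Type*}
    [∀ n, MeasurableSpace (Ω n)] (P : ∀ n, Measure (Ω n)) (Lam X : ∀ n, ℝ → Ω n → ℝ)
    (b : ℕ → ℝ) : Prop where
  kernel : IsSmoothingKernel k
  lam_continuousOn : ContinuousOn lam (Icc 0 1)
  lam_lipschitz : ∃ A, ∀ u ∈ Icc (0 : ℝ) 1, ∀ v ∈ Icc (0 : ℝ) 1, |lam u - lam v| ≤ A * |u - v|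
  clock_lipschitz : ∃ A, ∀ u ∈ Icc (0 : ℝ) 1, ∀ v ∈ Icc (0 : ℝ) 1, |L u - L v| ≤ A * |u - v|
  theta_nonneg : 0 ≤ θ
  cadlag : ∀ n ω, IsCadlagOnUnit fun t => Lam n t ω
  gaussian : ∀ n, IsTimeChangedGaussian L θ (X n) (P n)
  q_gt : 5 / 2 < q
  coupling : ∀ n : ℕ, ∀ x ∈ Ioc (0 : ℝ) n,
    P n (couplingFailure lam q n (Lam n) (X n) x) ≤ ENNReal.ofReal (Cq * x ^ (-q))
  weight : ∃ W > 0, ∀ e r, 0 ≤ r → μ (endRegion e r) ≤ ENNReal.ofReal (W * r)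
  b_pos : ∀ n, 0 < b n
  b_zero : Tendsto b atTop (𝓝 0)
  nb : Tendsto (fun n : ℕ => (n : ℝ) * b n) atTop atTop

/-- The average of `1 + |Y_n|^p` over a boundary region. -/
noncomputable def gaussianLoad {Ω : Type*} (k : ℝ → ℝ) (b p : ℝ) (X : ℝ → Ω → ℝ) (μ : Measure ℝ)
    (e : ℝ) (ω : Ω) : ℝ :=
  b⁻¹ * ∫ t in endRegion e b, (1 + |gaussianPath k b X ω t| ^ p) ∂μ

namespace StrongApproximation

variable {k lam L : ℝ → ℝ} {θ q Cq : ℝ} {μ : Measure ℝ} {Ω : ℕ → Type*}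
    [∀ n, MeasurableSpace (Ω n)] {P : ∀ n, Measure (Ω n)} {Lam X : ∀ n, ℝ → Ω n → ℝ}
    {b : ℕ → ℝ}

theorem measure_unit_ne_top (h : StrongApproximation k lam L θ q Cq μ P Lam X b) :
    μ (Icc 0 1) ≠ ∞ := by
  obtain ⟨W, _, hW⟩ := h.weight
  rw [← endRegion_zero_one]
  exact ((hW 0 1 zero_le_one).trans_lt ENNReal.ofReal_lt_top).ne

theorem exists_measureReal_le (h : StrongApproximation k lam L θ q Cq μ P Lam X b) :
    ∃ W > 0, ∀ e r, 0 ≤ r → μ.real (endRegion e r) ≤ W * r := by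
  obtain ⟨W, hW0, hW⟩ := h.weight
  exact ⟨W, hW0, fun e r hr => ENNReal.toReal_le_of_le_ofReal (by positivity) (hW e r hr)⟩

theorem isFiniteMeasure_restrict (h : StrongApproximation k lam L θ q Cq μ P Lam X b) (e r : ℝ) :
    IsFiniteMeasure (μ.restrict (endRegion e r)) :=
  ⟨by
    rw [Measure.restrict_apply_univ]
    exact (measure_mono (endRegion_subset e r)).trans_lt h.measure_unit_ne_top.lt_top⟩

theorem continuousOn_error (h : StrongApproximation k lam L θ q Cq μ P Lam X b) (n : ℕ) (ω : Ω n) :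
    ContinuousOn (fun t => kernelSmooth k (b n) (fun u => Lam n u ω) t - lam t) (Icc 0 1) := by
  refine ContinuousOn.sub ?_ h.lam_continuousOn
  have hr := (h.cadlag n ω).isRegulatedOnUnit
  refine (h.kernel.continuous_smoothed hr.intervalIntegrable (b n)).continuousOn.congr
    fun t ht => ?_
  exact hr.kernelSmooth_eq h.kernel (h.b_pos n) ht

theorem continuous_gaussianPath (h : StrongApproximation k lam L θ q Cq μ P Lam X b) (n : ℕ)
    (ω : Ω n) : Continuous (gaussianPath k (b n) (X n) ω) :=
  (h.gaussian n).continuous_gaussianPath h.kernel (b n) ω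

theorem continuousOn_load (h : StrongApproximation k lam L θ q Cq μ P Lam X b) {p : ℝ} (hp : 0 ≤ p)
    (n : ℕ) (ω : Ω n) :
    ContinuousOn (fun t => 1 + |gaussianPath k (b n) (X n) ω t| ^ p) (Icc 0 1) :=
  (continuous_const.add ((h.continuous_gaussianPath n ω).abs.rpow_const
    fun _ => Or.inr hp)).continuousOn

theorem gaussianLoad_nonneg (h : StrongApproximation k lam L θ q Cq μ P Lam X b) (p e : ℝ) (n : ℕ)
    (ω : Ω n) : 0 ≤ gaussianLoad k (b n) p (X n) μ e ω :=
  mul_nonneg (inv_nonneg.2 (h.b_pos n).le) (integral_nonneg fun t => by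
    have := Real.rpow_nonneg (abs_nonneg (gaussianPath k (b n) (X n) ω t)) p
    simp only [Pi.zero_apply]
    linarith)

/-- By Tonelli, the moments of `Y_n` are bounded uniformly in `t` and the region has measure at most
`W * b n`, which the factor `(b n)⁻¹` in the load cancels. -/
theorem exists_lintegral_gaussianLoad_le [∀ n, IsProbabilityMeasure (P n)]
    (h : StrongApproximation k lam L θ q Cq μ P Lam X b) {p : ℝ} (hp : 0 ≤ p) (e : ℝ) :
    ∃ C, 0 < C ∧ ∀ n, AEMeasurable (fun ω => gaussianLoad k (b n) p (X n) μ e ω) (P n) ∧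
      ∫⁻ ω, ENNReal.ofReal (gaussianLoad k (b n) p (X n) μ e ω) ∂(P n) ≤ ENNReal.ofReal C := by
  obtain ⟨A, hA⟩ := h.clock_lipschitz
  obtain ⟨D, hD0, hD⟩ := h.kernel.exists_gaussianPath_moment hA h.theta_nonneg hp
  obtain ⟨W, hW0, hW⟩ := h.exists_measureReal_le
  refine ⟨(1 + D) * W, by positivity, fun n => ?_⟩
  have := h.isFiniteMeasure_restrict e (b n)
  have hb := h.b_pos n
  have hsm : StronglyMeasurable
      (Function.uncurry fun t ω => 1 + |gaussianPath k (b n) (X n) ω t| ^ p) := by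
    have h1 := (h.gaussian n).stronglyMeasurable_gaussianPath h.kernel (b n)
    have h2 : Continuous fun z : ℝ => 1 + |z| ^ p :=
      continuous_const.add (continuous_abs.rpow_const fun _ => Or.inr hp)
    exact h2.comp_stronglyMeasurable h1
  constructor
  · refine Measurable.aemeasurable (Measurable.const_mul ?_ _)
    exact hsm.integral_prod_left.measurable
  · have hF := lintegral_ofReal_setIntegral_le (P := P n) (ν := μ.restrict (endRegion e (b n)))
      (F := fun t ω => 1 + |gaussianPath k (b n) (X n) ω t| ^ p) (D := 1 + D) (by positivity)
      (fun t ω => by positivity) hsm (by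
        filter_upwards [ae_restrict_mem (measurableSet_endRegion e (b n))] with t ht
        obtain ⟨h1, h2⟩ := hD (h.gaussian n) (b n) hb t ht.1
        refine ⟨(integrable_const _).add h1, ?_⟩
        rw [integral_add (integrable_const _) h1]
        simpa using h2)
    rw [measureReal_restrict_apply_univ] at hF
    simp only [gaussianLoad, ENNReal.ofReal_mul (inv_nonneg.2 hb.le)]
    rw [lintegral_const_mul' _ _ ENNReal.ofReal_ne_top]
    calc _ ≤ ENNReal.ofReal (b n)⁻¹ * ENNReal.ofReal ((1 + D) * μ.real (endRegion e (b n))) := by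
          gcongr
      _ = ENNReal.ofReal ((b n)⁻¹ * ((1 + D) * μ.real (endRegion e (b n)))) :=
          (ENNReal.ofReal_mul (inv_nonneg.2 hb.le)).symm
      _ ≤ _ := by
          refine ENNReal.ofReal_le_ofReal ?_
          have := hW e (b n) hb.le
          calc _ ≤ (b n)⁻¹ * ((1 + D) * (W * b n)) := by gcongr
            _ = _ := by field_simp

theorem exists_abs_scaledBias_le (h : StrongApproximation k lam L θ q Cq μ P Lam X b) :
    ∃ C > 0, ∀ n, b n ≤ 1 → ∀ t ∈ Icc (0 : ℝ) 1,
      |scaledBias k lam n (b n) t| ≤ C * Real.sqrt (n * b n) := by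
  obtain ⟨A, hA⟩ := h.lam_lipschitz
  obtain ⟨M, hM⟩ := h.lam_continuousOn.exists_abs_le_unit
  have hA0 : 0 ≤ A := by
    have := (abs_nonneg _).trans (hA 0 (by simp) 1 (by simp)); simpa using this
  have hM0 : 0 ≤ M := (abs_nonneg _).trans (hM 0 (by simp))
  refine ⟨A + M + 1, by positivity, fun n hb t ht => ?_⟩
  refine (h.kernel.abs_scaledBias_le (h.b_pos n) hb h.lam_continuousOn hA hM n ht).trans ?_
  exact mul_le_mul_of_nonneg_right (by linarith) (Real.sqrt_nonneg _)

/-- Off the failure event, the scaled estimation error is close to `Y_n + g_(n)`. -/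
theorem exists_abs_sub_le (h : StrongApproximation k lam L θ q Cq μ P Lam X b) :
    ∃ C > 0, ∀ n, 0 < n → ∀ x > 0, ∀ ω ∉ couplingFailure lam q n (Lam n) (X n) x,
      ∀ t ∈ Icc (0 : ℝ) 1,
      |Real.sqrt (n * b n) * (kernelSmooth k (b n) (fun u => Lam n u ω) t - lam t) -
        (gaussianPath k (b n) (X n) ω t + scaledBias k lam n (b n) t)| ≤
        C * x * couplingRate q b n := by
  obtain ⟨C, hC0, hC⟩ := h.kernel.exists_abs_decomposition_le h.lam_continuousOn
  refine ⟨C, hC0, fun n hn x hx ω hω t ht => ?_⟩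
  refine (hC n (b n) _ _ _ hn (h.b_pos n) (h.cadlag n ω) ((h.gaussian n).continuous ω)
    (abs_le_of_notMem_couplingFailure hn hω) t ht).trans (le_of_eq ?_)
  rw [couplingRate]; ring

theorem rpow_half_mul_abs_rpow {y z p : ℝ} (hy : 0 ≤ y) :
    y ^ (p / 2) * |z| ^ p = |Real.sqrt y * z| ^ p := by
  rw [abs_mul, abs_of_nonneg (Real.sqrt_nonneg y), Real.mul_rpow (Real.sqrt_nonneg y) (abs_nonneg z),
    Real.sqrt_eq_rpow, ← Real.rpow_mul hy]
  congr 2; ring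

/-- The effect of the strong approximation on the `L_p` error over a boundary region. -/
theorem exists_abs_error_sub_gaussian_le (h : StrongApproximation k lam L θ q Cq μ P Lam X b)
    {p : ℝ} (hp : 1 ≤ p) (e : ℝ) :
    ∃ C > 0, ∀ n, 0 < n → b n ≤ 1 → ∀ x > 0, ∀ ω ∉ couplingFailure lam q n (Lam n) (X n) x,
      |(∫ t in endRegion e (b n), ((n : ℝ) * b n) ^ (p / 2) *
          |kernelSmooth k (b n) (fun u => Lam n u ω) t - lam t| ^ p ∂μ)
        - ∫ t in endRegion e (b n),
          |gaussianPath k (b n) (X n) ω t + scaledBias k lam n (b n) t| ^ p ∂μ| ≤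
      C * b n * (x * couplingRate q b n * gaussianLoad k (b n) p (X n) μ e ω
        + (x * couplingRate q b n * Real.sqrt (n * b n) ^ (p - 1)
          + (x * couplingRate q b n) ^ p)) := by
  obtain ⟨C₁, hC₁0, hC₁⟩ := h.exists_abs_sub_le
  obtain ⟨C₂, hC₂0, hC₂⟩ := h.exists_abs_scaledBias_le
  obtain ⟨C₃, hC₃0, hC₃⟩ := exists_abs_perturbation_le hp
  obtain ⟨W, hW0, hW⟩ := h.exists_measureReal_le
  have hμ := h.measure_unit_ne_top
  have hp0 : 0 ≤ p := by linarith
  refine ⟨C₃ * (C₁ + C₁ * C₂ ^ (p - 1) * W + C₁ ^ p * W), by positivity,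
    fun n hn hb1 x hx ω hω => ?_⟩
  have hb := h.b_pos n
  have hr := couplingRate_nonneg (q := q) h.b_pos n
  have hnb : (0 : ℝ) ≤ n * b n := by positivity
  set r := couplingRate q b n
  set G := Real.sqrt (n * b n)
  have hG : 0 ≤ G := Real.sqrt_nonneg _
  set Y := gaussianPath k (b n) (X n) ω
  set g := scaledBias k lam n (b n)
  set E := fun t => kernelSmooth k (b n) (fun u => Lam n u ω) t - lam t with hE
  have hEc : ContinuousOn E (Icc 0 1) := h.continuousOn_error n ω
  have hYc : ContinuousOn Y (Icc 0 1) := (h.continuous_gaussianPath n ω).continuousOn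
  have hgc : ContinuousOn g (Icc 0 1) := h.kernel.continuousOn_scaledBias h.lam_continuousOn n (b n)
  have hl := h.continuousOn_load hp0 n ω
  set ρ := C₁ * x * r
  have hρ : 0 ≤ ρ := by positivity
  have hf : ∀ t, ((n : ℝ) * b n) ^ (p / 2) * |E t| ^ p = |G * E t| ^ p := fun t =>
    rpow_half_mul_abs_rpow hnb
  -- The perturbation is the whole coupling remainder, of size at most `ρ`. Only the first term on
  -- the right is random; it integrates to a multiple of the load.
  have hpt : ∀ t ∈ endRegion e (b n), |(|G * E t| ^ p) - |Y t + g t| ^ p| ≤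
      C₃ * ρ * (1 + |Y t| ^ p) + C₃ * (ρ * (C₂ * G) ^ (p - 1) + ρ ^ p) := by
    intro t ht
    have h1 := hC₃ (Y t) (g t) (G * E t - (Y t + g t)) (C₂ * G) ρ (hC₂ n hb1 t ht.1)
      (hC₁ n hn x hx ω hω t ht.1)
    rw [add_sub_cancel] at h1
    refine h1.trans (le_of_eq ?_)
    ring
  have key := abs_setIntegral_sub_le hμ (f := fun t => |G * E t| ^ p)
    (g := fun t => |Y t + g t| ^ p)
    (h := fun t => C₃ * ρ * (1 + |Y t| ^ p) + C₃ * (ρ * (C₂ * G) ^ (p - 1) + ρ ^ p))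
    ((continuousOn_const.mul hEc).abs.rpow_const fun _ _ => Or.inr hp0)
    ((hYc.add hgc).abs.rpow_const fun _ _ => Or.inr hp0)
    ((continuousOn_const.mul hl).add continuousOn_const) hpt
  simp only [← hf] at key
  refine key.trans ?_
  have := h.isFiniteMeasure_restrict e (b n)
  rw [integral_add ((hl.integrableOn_endRegion hμ e (b n)).const_mul _) (integrable_const _),
    integral_const_mul, integral_const, measureReal_restrict_apply_univ, smul_eq_mul]
  have hU : ∫ t in endRegion e (b n), (1 + |Y t| ^ p) ∂μ =
      b n * gaussianLoad k (b n) p (X n) μ e ω := by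
    rw [gaussianLoad, mul_inv_cancel_left₀ hb.ne']
  have hU0 := h.gaussianLoad_nonneg p e n ω
  rw [hU]
  set U := gaussianLoad k (b n) p (X n) μ e ω
  have e1 : ρ ^ p = C₁ ^ p * (x * r) ^ p := by
    rw [← Real.mul_rpow hC₁0.le (by positivity)]; congr 1; ring
  have e2 : (C₂ * G) ^ (p - 1) = C₂ ^ (p - 1) * G ^ (p - 1) := Real.mul_rpow hC₂0.le hG
  have hT : 0 ≤ C₃ * (ρ * (C₂ * G) ^ (p - 1) + ρ ^ p) := by positivity
  calc _ ≤ C₃ * ρ * (b n * U) + W * b n * (C₃ * (ρ * (C₂ * G) ^ (p - 1) + ρ ^ p)) := by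
        gcongr; exact hW e (b n) hb.le
    _ = C₃ * b n * (C₁ * (x * r * U) + C₁ * C₂ ^ (p - 1) * W * (x * r * G ^ (p - 1))
          + C₁ ^ p * W * (x * r) ^ p) := by
        rw [e1, e2]; simp only [ρ]; ring
    _ ≤ C₃ * b n * ((C₁ + C₁ * C₂ ^ (p - 1) * W + C₁ ^ p * W) * (x * r * U)
          + (C₁ + C₁ * C₂ ^ (p - 1) * W + C₁ ^ p * W) * (x * r * G ^ (p - 1))
          + (C₁ + C₁ * C₂ ^ (p - 1) * W + C₁ ^ p * W) * (x * r) ^ p) := by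
        have t1 : 0 ≤ C₁ * C₂ ^ (p - 1) * W := by positivity
        have t2 : 0 ≤ C₁ ^ p * W := by positivity
        gcongr <;> linarith
    _ = _ := by ring

/-- The effect of the Gaussian part on the `L_p` error over a boundary region. -/
theorem exists_abs_gaussian_sub_bias_le (h : StrongApproximation k lam L θ q Cq μ P Lam X b)
    {p : ℝ} (hp : 1 ≤ p) (e : ℝ) :
    ∃ C > 0, ∀ n, b n ≤ 1 → ∀ ω : Ω n,
      |(∫ t in endRegion e (b n),
          |gaussianPath k (b n) (X n) ω t + scaledBias k lam n (b n) t| ^ p ∂μ)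
        - ∫ t in endRegion e (b n), |scaledBias k lam n (b n) t| ^ p ∂μ| ≤
      C * b n * (Real.sqrt (n * b n) ^ (p - 1) + 1) * gaussianLoad k (b n) p (X n) μ e ω := by
  obtain ⟨C₂, hC₂0, hC₂⟩ := h.exists_abs_scaledBias_le
  obtain ⟨C₃, hC₃0, hC₃⟩ := exists_abs_add_rpow_sub_le hp
  have hμ := h.measure_unit_ne_top
  have hp0 : 0 ≤ p := by linarith
  refine ⟨C₃ * (C₂ ^ (p - 1) + 1), by positivity, fun n hb1 ω => ?_⟩
  have hb := h.b_pos n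
  set G := Real.sqrt (n * b n)
  have hG : 0 ≤ G := Real.sqrt_nonneg _
  set Y := gaussianPath k (b n) (X n) ω
  set g := scaledBias k lam n (b n)
  have hYc : ContinuousOn Y (Icc 0 1) := (h.continuous_gaussianPath n ω).continuousOn
  have hgc : ContinuousOn g (Icc 0 1) := h.kernel.continuousOn_scaledBias h.lam_continuousOn n (b n)
  have hl := h.continuousOn_load hp0 n ω
  have hpt : ∀ t ∈ endRegion e (b n), |(|Y t + g t| ^ p) - |g t| ^ p| ≤
      C₃ * ((C₂ * G) ^ (p - 1) + 1) * (1 + |Y t| ^ p) := by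
    intro t ht
    rw [mul_assoc]
    exact hC₃ (Y t) (g t) (C₂ * G) (hC₂ n hb1 t ht.1)
  have key := abs_setIntegral_sub_le hμ (f := fun t => |Y t + g t| ^ p) (g := fun t => |g t| ^ p)
    (h := fun t => C₃ * ((C₂ * G) ^ (p - 1) + 1) * (1 + |Y t| ^ p))
    ((hYc.add hgc).abs.rpow_const fun _ _ => Or.inr hp0)
    (hgc.abs.rpow_const fun _ _ => Or.inr hp0) (continuousOn_const.mul hl) hpt
  refine key.trans ?_
  rw [integral_const_mul]
  have hU : ∫ t in endRegion e (b n), (1 + |Y t| ^ p) ∂μ =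
      b n * gaussianLoad k (b n) p (X n) μ e ω := by
    rw [gaussianLoad, mul_inv_cancel_left₀ hb.ne']
  have hU0 := h.gaussianLoad_nonneg p e n ω
  rw [hU, Real.mul_rpow hC₂0.le hG]
  set U := gaussianLoad k (b n) p (X n) μ e ω
  have t1 : 0 ≤ C₂ ^ (p - 1) := by positivity
  have t2 : 0 ≤ G ^ (p - 1) := by positivity
  have t3 : C₂ ^ (p - 1) * G ^ (p - 1) + 1 ≤ (C₂ ^ (p - 1) + 1) * (G ^ (p - 1) + 1) := by nlinarith
  calc _ ≤ C₃ * ((C₂ ^ (p - 1) + 1) * (G ^ (p - 1) + 1)) * (b n * U) := by gcongr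
    _ = _ := by ring

end StrongApproximation

/-! ### Rates. -/

theorem tendsto_zero_of_sq {s : ℕ → ℝ} (h0 : ∀ n, 0 ≤ s n)
    (h : Tendsto (fun n => s n ^ 2) atTop (𝓝 0)) : Tendsto s atTop (𝓝 0) := by
  have := h.sqrt
  rw [Real.sqrt_zero] at this
  exact this.congr fun n => Real.sqrt_sq (h0 n)

section Rates

variable {p q : ℝ} {b : ℕ → ℝ}

/-- Both sides are positive monomials in `n` and `b'`, so comparing logarithms leaves a linear
identity. The right-hand side is the second expression in `CouplingRates`. -/
theorem sq_sqrt_mul_couplingRate {n b' : ℝ} (hn : 0 < n) (hb : 0 < b') :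
    (Real.sqrt b' * Real.sqrt (n * b') ^ (p - 1) *
      (Real.sqrt (n * b') / b' * n ^ (-1 + 1 / q))) ^ 2 = b' ^ (p - 1) * n ^ (p - 2 + 2 / q) := by
  have h1 : 0 < n * b' := mul_pos hn hb
  refine Real.log_injOn_pos (mem_Ioi.2 (by positivity)) (mem_Ioi.2 (by positivity)) ?_
  rw [Real.log_pow, Real.log_mul (by positivity) (by positivity),
    Real.log_mul (by positivity) (by positivity), Real.log_mul (by positivity) (by positivity),
    Real.log_div (by positivity) (by positivity), Real.log_rpow (by positivity),
    Real.log_rpow hn, Real.log_sqrt hb.le, Real.log_sqrt h1.le,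
    Real.log_mul (by positivity) (by positivity), Real.log_mul (by positivity) (by positivity),
    Real.log_rpow hb, Real.log_rpow hn]
  push_cast
  ring

theorem sq_sqrt_mul_couplingRate_rpow {n b' : ℝ} (hn : 0 < n) (hb : 0 < b') :
    (Real.sqrt b' * (Real.sqrt (n * b') / b' * n ^ (-1 + 1 / q)) ^ p) ^ 2 =
      (n * b') ^ (1 - p) * n ^ (-1 + 2 * p / q) := by
  have h1 : 0 < n * b' := mul_pos hn hb
  refine Real.log_injOn_pos (mem_Ioi.2 (by positivity)) (mem_Ioi.2 (by positivity)) ?_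
  rw [Real.log_pow, Real.log_mul (by positivity) (by positivity), Real.log_rpow (by positivity),
    Real.log_mul (by positivity) (by positivity),
    Real.log_div (by positivity) (by positivity),
    Real.log_rpow hn, Real.log_sqrt hb.le, Real.log_sqrt h1.le,
    Real.log_mul (x := (n * b') ^ (1 - p)) (by positivity) (by positivity), Real.log_rpow h1,
    Real.log_rpow hn, Real.log_mul (by positivity) (by positivity)]
  push_cast
  ring

theorem sq_sqrt_mul_rpow {n b' : ℝ} (hp : 0 < p) (hn : 0 < n) (hb : 0 < b') :
    (Real.sqrt b' * Real.sqrt (n * b') ^ (p - 1)) ^ 2 = (b' * n ^ (1 - 1 / p)) ^ p := by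
  have h1 : 0 < n * b' := mul_pos hn hb
  refine Real.log_injOn_pos (mem_Ioi.2 (by positivity)) (mem_Ioi.2 (by positivity)) ?_
  rw [Real.log_pow, Real.log_mul (by positivity) (by positivity), Real.log_rpow (by positivity),
    Real.log_sqrt hb.le, Real.log_sqrt h1.le, Real.log_mul (by positivity) (by positivity),
    Real.log_rpow (by positivity), Real.log_mul (by positivity) (by positivity), Real.log_rpow hn]
  push_cast
  field_simp
  ring

theorem tendsto_natCast_rpow_neg {r : ℝ} (hr : r < 0) :
    Tendsto (fun n : ℕ => (n : ℝ) ^ r) atTop (𝓝 0) := by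
  have := (tendsto_rpow_neg_atTop (neg_pos.2 hr)).comp (tendsto_natCast_atTop_atTop (R := ℝ))
  simpa [Function.comp_def] using this

theorem CouplingRates.tendsto_mul (hb : ∀ n, 0 < b n) (h : CouplingRates p q b) :
    Tendsto (fun n : ℕ => Real.sqrt (b n) * Real.sqrt (n * b n) ^ (p - 1) * couplingRate q b n)
      atTop (𝓝 0) := by
  refine tendsto_zero_of_sq (fun n => ?_) ?_
  · have := couplingRate_nonneg (q := q) hb n
    positivity
  · refine h.2.congr' ?_
    filter_upwards [eventually_gt_atTop 0] with n hn
    exact (sq_sqrt_mul_couplingRate (by exact_mod_cast hn) (hb n)).symm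

/-- The first rate condition says that the coupling rate is `O(√(nb))`. Replacing `p - 1` of its `p`
factors by `√(nb)` reduces the claim to `CouplingRates.tendsto_mul`. -/
theorem CouplingRates.tendsto_rpow (hp : 1 ≤ p) (hb : ∀ n, 0 < b n) (h : CouplingRates p q b) :
    Tendsto (fun n : ℕ => Real.sqrt (b n) * couplingRate q b n ^ p) atTop (𝓝 0) := by
  obtain ⟨K, hK⟩ := h.1.bound
  have h1 := (h.tendsto_mul hb).const_mul (|K| ^ (p - 1))
  rw [mul_zero] at h1
  refine tendsto_of_tendsto_of_tendsto_of_le_of_le' tendsto_const_nhds h1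
    (Eventually.of_forall fun n => ?_) ?_
  · have := couplingRate_nonneg (q := q) hb n
    positivity
  · filter_upwards [hK] with n hn
    have hr := couplingRate_nonneg (q := q) hb n
    have hbn := hb n
    have h2 : couplingRate q b n ≤ |K| * Real.sqrt (n * b n) := by
      rw [norm_one, mul_one, Real.norm_of_nonneg (by positivity)] at hn
      rw [couplingRate]
      calc _ = Real.sqrt (n * b n) * ((b n)⁻¹ * (n : ℝ) ^ (-1 + 1 / q)) := by ring
        _ ≤ Real.sqrt (n * b n) * |K| := by gcongr; exact hn.trans (le_abs_self K)
        _ = _ := mul_comm _ _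
    have e : couplingRate q b n ^ p = couplingRate q b n ^ (p - 1) * couplingRate q b n := by
      rw [← Real.rpow_add_one' hr (by linarith)]; congr 1; ring
    rw [e]
    calc _ ≤ Real.sqrt (b n) * ((|K| * Real.sqrt (n * b n)) ^ (p - 1) * couplingRate q b n) := by
          gcongr
      _ = _ := by rw [Real.mul_rpow (abs_nonneg K) (Real.sqrt_nonneg _)]; ring

/-- When `2 * p ≤ q`, the exponent `p - 2 + 2 / q` is at most `(1 - 1 / p) * (p - 1)`, so the square
is at most `(b n^{1-1/p})^{p-1}`. For `p = 1` this bound is trivial, and the square is `n^{-1+2/q}`,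
which tends to zero since `q > 2`. -/
theorem tendsto_mul_of_two_mul_le (hp : 1 ≤ p) (hq : 5 / 2 < q) (hpq : 2 * p ≤ q)
    (hb : ∀ n, 0 < b n) (h : Tendsto (fun n : ℕ => b n * (n : ℝ) ^ (1 - 1 / p)) atTop (𝓝 0)) :
    Tendsto (fun n : ℕ => Real.sqrt (b n) * Real.sqrt (n * b n) ^ (p - 1) * couplingRate q b n)
      atTop (𝓝 0) := by
  refine tendsto_zero_of_sq (fun n => ?_) ?_
  · have := couplingRate_nonneg (q := q) hb n
    positivity
  have hq0 : 0 < q := by linarith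
  rcases hp.eq_or_lt with rfl | hp1
  · refine (tendsto_natCast_rpow_neg (r := -1 + 2 / q) ?_).congr' ?_
    · have : 2 / q < 1 := by rw [div_lt_one hq0]; linarith
      linarith
    · filter_upwards [eventually_gt_atTop 0] with n hn
      rw [couplingRate, sq_sqrt_mul_couplingRate (by exact_mod_cast hn) (hb n)]
      norm_num
  · have h1 : Tendsto (fun n : ℕ => (b n * (n : ℝ) ^ (1 - 1 / p)) ^ (p - 1)) atTop (𝓝 0) := by
      have := h.rpow_const (p := p - 1) (Or.inr (by linarith))
      rwa [Real.zero_rpow (by linarith)] at this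
    refine tendsto_of_tendsto_of_tendsto_of_le_of_le' tendsto_const_nhds h1
      (Eventually.of_forall fun n => sq_nonneg _) ?_
    filter_upwards [eventually_gt_atTop 0] with n hn
    have hn0 : (0 : ℝ) < n := by exact_mod_cast hn
    have hn1 : (1 : ℝ) ≤ n := by exact_mod_cast hn
    rw [couplingRate, sq_sqrt_mul_couplingRate hn0 (hb n), Real.mul_rpow (hb n).le (by positivity),
      ← Real.rpow_mul hn0.le]
    have := hb n
    refine mul_le_mul_of_nonneg_left (Real.rpow_le_rpow_of_exponent_le hn1 ?_) (by positivity)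
    have h2 : 2 / q ≤ 1 / p := by rw [div_le_div_iff₀ hq0 (by linarith)]; linarith
    have h3 : (1 - 1 / p) * (p - 1) = p - 2 + 1 / p := by field_simp; ring
    rw [h3]; linarith

/-- The square equals `(nb)^{1-p} n^{-1+2p/q}`. For `p > 1` the first factor vanishes in the limit
and the second is at most one; for `p = 1` the second decays by itself. -/
theorem tendsto_rpow_of_two_mul_le (hp : 1 ≤ p) (hq : 5 / 2 < q) (hpq : 2 * p ≤ q)
    (hb : ∀ n, 0 < b n) (hnb : Tendsto (fun n : ℕ => (n : ℝ) * b n) atTop atTop) :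
    Tendsto (fun n : ℕ => Real.sqrt (b n) * couplingRate q b n ^ p) atTop (𝓝 0) := by
  refine tendsto_zero_of_sq (fun n => ?_) ?_
  · have := couplingRate_nonneg (q := q) hb n
    positivity
  have hq0 : 0 < q := by linarith
  rcases hp.eq_or_lt with rfl | hp1
  · refine (tendsto_natCast_rpow_neg (r := -1 + 2 / q) ?_).congr' ?_
    · have : 2 / q < 1 := by rw [div_lt_one hq0]; linarith
      linarith
    · filter_upwards [eventually_gt_atTop 0] with n hn
      rw [couplingRate, sq_sqrt_mul_couplingRate_rpow (by exact_mod_cast hn) (hb n)]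
      norm_num
  · have h1 : Tendsto (fun n : ℕ => ((n : ℝ) * b n) ^ (1 - p)) atTop (𝓝 0) := by
      have := (tendsto_rpow_neg_atTop (y := p - 1) (by linarith)).comp hnb
      simpa [Function.comp_def] using this
    refine tendsto_of_tendsto_of_tendsto_of_le_of_le' tendsto_const_nhds h1
      (Eventually.of_forall fun n => sq_nonneg _) ?_
    filter_upwards [eventually_gt_atTop 0] with n hn
    have hn0 : (0 : ℝ) < n := by exact_mod_cast hn
    have hn1 : (1 : ℝ) ≤ n := by exact_mod_cast hn
    have := hb n
    rw [couplingRate, sq_sqrt_mul_couplingRate_rpow hn0 (hb n)]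
    refine mul_le_of_le_one_right (by positivity) (Real.rpow_le_one_of_one_le_of_nonpos hn1 ?_)
    have : 2 * p / q ≤ 1 := by rw [div_le_one hq0]; exact hpq
    linarith

/-- The square is `(b n^{1-1/p})^p`: the bandwidth condition of (ii) is exactly what makes the
Gaussian part negligible there. -/
theorem tendsto_sqrt_mul_rpow (hp : 1 ≤ p) (hb : ∀ n, 0 < b n)
    (h : Tendsto (fun n : ℕ => b n * (n : ℝ) ^ (1 - 1 / p)) atTop (𝓝 0)) :
    Tendsto (fun n : ℕ => Real.sqrt (b n) * Real.sqrt (n * b n) ^ (p - 1)) atTop (𝓝 0) := by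
  refine tendsto_zero_of_sq (fun n => by positivity) ?_
  have h1 := h.rpow_const (p := p) (Or.inr (by linarith))
  rw [Real.zero_rpow (by linarith)] at h1
  refine h1.congr' ?_
  filter_upwards [eventually_gt_atTop 0] with n hn
  exact (sq_sqrt_mul_rpow (by linarith) (by exact_mod_cast hn) (hb n)).symm

end Rates

/-! ### Claim (ii) and the approximation in claim (iii). -/

namespace StrongApproximation

variable {k lam L : ℝ → ℝ} {θ q Cq : ℝ} {μ : Measure ℝ} {Ω : ℕ → Type*}
    [∀ n, MeasurableSpace (Ω n)] {P : ∀ n, Measure (Ω n)} [∀ n, IsProbabilityMeasure (P n)]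
    {Lam X : ∀ n, ℝ → Ω n → ℝ} {b : ℕ → ℝ}

/-- A bound by multiples of the load, valid off the failure events, gives convergence to zero. -/
theorem tendstoZeroInProb (h : StrongApproximation k lam L θ q Cq μ P Lam X b) {p : ℝ} (hp : 0 ≤ p)
    (e : ℝ) {Z : ∀ n, Ω n → ℝ}
    (hZ : ∀ x > 0, ∃ α β : ℕ → ℝ, Tendsto α atTop (𝓝 0) ∧ Tendsto β atTop (𝓝 0) ∧
      ∀ᶠ n in atTop, ∀ ω ∉ couplingFailure lam q n (Lam n) (X n) x,
        |Z n ω| ≤ α n * gaussianLoad k (b n) p (X n) μ e ω + β n) :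
    TendstoZeroInProb P Z := by
  obtain ⟨Cu, _, hCu⟩ := h.exists_lintegral_gaussianLoad_le hp e
  refine tendstoZeroInProb_of_bound (Cq := Cq) (Cu := Cu) (by linarith [h.q_gt] : 0 < q)
    (fun n ω => h.gaussianLoad_nonneg p e n ω) h.coupling (Eventually.of_forall hCu) fun x hx => ?_
  obtain ⟨α, β, hα, hβ, hev⟩ := hZ x hx
  exact ⟨α, β, hα, hβ, hev.mono fun n hn => ae_of_all _ fun ω hω => hn ω hω⟩

omit [∀ n, IsProbabilityMeasure (P n)] in
theorem eventually_le_one (h : StrongApproximation k lam L θ q Cq μ P Lam X b) :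
    ∀ᶠ n in atTop, 0 < n ∧ b n ≤ 1 ∧ 1 ≤ Real.sqrt (n * b n) := by
  filter_upwards [eventually_gt_atTop 0, h.b_zero.eventually (ge_mem_nhds zero_lt_one),
    h.nb.eventually_ge_atTop 1] with n h1 h2 h3
  exact ⟨h1, h2, Real.one_le_sqrt.2 h3⟩

theorem inv_sqrt_mul_self {x : ℝ} (hx : 0 < x) (y z : ℝ) :
    (Real.sqrt x)⁻¹ * (y * x * z) = y * Real.sqrt x * z := by
  have h1 := Real.sqrt_pos.2 hx
  have h2 := Real.sq_sqrt hx.le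
  nth_rewrite 2 [← h2]
  field_simp

omit [∀ n, IsProbabilityMeasure (P n)] in
theorem exists_bound_error_sub_gaussian (h : StrongApproximation k lam L θ q Cq μ P Lam X b) {p : ℝ}
    (hp : 1 ≤ p) (e : ℝ)
    (hα : Tendsto (fun n : ℕ => Real.sqrt (b n) * Real.sqrt (n * b n) ^ (p - 1) *
      couplingRate q b n) atTop (𝓝 0))
    (hβ : Tendsto (fun n : ℕ => Real.sqrt (b n) * couplingRate q b n ^ p) atTop (𝓝 0)) (x : ℝ)
    (hx : 0 < x) : ∃ α β : ℕ → ℝ, Tendsto α atTop (𝓝 0) ∧ Tendsto β atTop (𝓝 0) ∧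
      ∀ᶠ n in atTop, ∀ ω ∉ couplingFailure lam q n (Lam n) (X n) x, (Real.sqrt (b n))⁻¹ *
        |(∫ t in endRegion e (b n), ((n : ℝ) * b n) ^ (p / 2) *
            |kernelSmooth k (b n) (fun u => Lam n u ω) t - lam t| ^ p ∂μ)
          - ∫ t in endRegion e (b n),
            |gaussianPath k (b n) (X n) ω t + scaledBias k lam n (b n) t| ^ p ∂μ| ≤
        α n * gaussianLoad k (b n) p (X n) μ e ω + β n := by
  obtain ⟨C, hC0, hC⟩ := h.exists_abs_error_sub_gaussian_le hp e
  refine ⟨fun n => C * x * (Real.sqrt (b n) * Real.sqrt (n * b n) ^ (p - 1) * couplingRate q b n),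
    fun n => C * x * (Real.sqrt (b n) * Real.sqrt (n * b n) ^ (p - 1) * couplingRate q b n) +
      C * x ^ p * (Real.sqrt (b n) * couplingRate q b n ^ p), ?_, ?_, ?_⟩
  · simpa using hα.const_mul (C * x)
  · simpa using (hα.const_mul (C * x)).add (hβ.const_mul (C * x ^ p))
  · filter_upwards [h.eventually_le_one] with n hn ω hω
    have hb := h.b_pos n
    have hr := couplingRate_nonneg (q := q) h.b_pos n
    have hU := h.gaussianLoad_nonneg p e n ω
    have h1 := hC n hn.1 hn.2.1 x hx ω hω
    set r := couplingRate q b n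
    set G := Real.sqrt (n * b n)
    set U := gaussianLoad k (b n) p (X n) μ e ω
    -- Since `n b ≥ 1` eventually, the load term `√b * r` is absorbed in `√b * G ^ (p - 1) * r`,
    -- which is known to vanish.
    have hG : 1 ≤ G ^ (p - 1) := Real.one_le_rpow hn.2.2 (by linarith)
    calc _ ≤ (Real.sqrt (b n))⁻¹ * (C * b n * (x * r * U + (x * r * G ^ (p - 1) + (x * r) ^ p))) := by
          gcongr
      _ = C * Real.sqrt (b n) * (x * r * U + (x * r * G ^ (p - 1) + (x * r) ^ p)) :=
          inv_sqrt_mul_self hb _ _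
      _ = C * x * (Real.sqrt (b n) * 1 * r) * U + (C * x * (Real.sqrt (b n) * G ^ (p - 1) * r) +
            C * x ^ p * (Real.sqrt (b n) * r ^ p)) := by
          rw [Real.mul_rpow hx.le hr]; ring
      _ ≤ _ := by gcongr

/-- The `L_p` error over a boundary region is approximated by its Gaussian counterpart. -/
theorem tendstoZeroInProb_error_sub_gaussian (h : StrongApproximation k lam L θ q Cq μ P Lam X b)
    {p : ℝ} (hp : 1 ≤ p) (e : ℝ)
    (hα : Tendsto (fun n : ℕ => Real.sqrt (b n) * Real.sqrt (n * b n) ^ (p - 1) *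
      couplingRate q b n) atTop (𝓝 0))
    (hβ : Tendsto (fun n : ℕ => Real.sqrt (b n) * couplingRate q b n ^ p) atTop (𝓝 0)) :
    TendstoZeroInProb P fun n ω => (Real.sqrt (b n))⁻¹ *
        |(∫ t in endRegion e (b n), ((n : ℝ) * b n) ^ (p / 2) *
            |kernelSmooth k (b n) (fun u => Lam n u ω) t - lam t| ^ p ∂μ)
          - ∫ t in endRegion e (b n),
            |gaussianPath k (b n) (X n) ω t + scaledBias k lam n (b n) t| ^ p ∂μ| := by
  refine h.tendstoZeroInProb (p := p) (by linarith) e fun x hx => ?_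
  obtain ⟨α, β, h1, h2, h3⟩ := h.exists_bound_error_sub_gaussian hp e hα hβ x hx
  refine ⟨α, β, h1, h2, h3.mono fun n hn ω hω => ?_⟩
  rw [abs_of_nonneg (by positivity)]
  exact hn ω hω

/-- For small bandwidths the `L_p` error over a boundary region is approximated by the bias. -/
theorem tendstoZeroInProb_error_sub_bias (h : StrongApproximation k lam L θ q Cq μ P Lam X b)
    {p : ℝ} (hp : 1 ≤ p) (e : ℝ)
    (hα : Tendsto (fun n : ℕ => Real.sqrt (b n) * Real.sqrt (n * b n) ^ (p - 1) *
      couplingRate q b n) atTop (𝓝 0))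
    (hβ : Tendsto (fun n : ℕ => Real.sqrt (b n) * couplingRate q b n ^ p) atTop (𝓝 0))
    (hγ : Tendsto (fun n : ℕ => Real.sqrt (b n) * Real.sqrt (n * b n) ^ (p - 1)) atTop (𝓝 0)) :
    TendstoZeroInProb P fun n ω => (Real.sqrt (b n))⁻¹ *
        ((∫ t in endRegion e (b n), ((n : ℝ) * b n) ^ (p / 2) *
            |kernelSmooth k (b n) (fun u => Lam n u ω) t - lam t| ^ p ∂μ)
          - ∫ t in endRegion e (b n), |scaledBias k lam n (b n) t| ^ p ∂μ) := by
  obtain ⟨C, hC0, hC⟩ := h.exists_abs_gaussian_sub_bias_le hp e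
  refine h.tendstoZeroInProb (p := p) (by linarith) e fun x hx => ?_
  obtain ⟨α, β, h1, h2, h3⟩ := h.exists_bound_error_sub_gaussian hp e hα hβ x hx
  refine ⟨fun n => α n + 2 * C * (Real.sqrt (b n) * Real.sqrt (n * b n) ^ (p - 1)), β,
    by simpa using h1.add (hγ.const_mul (2 * C)), h2, ?_⟩
  filter_upwards [h3, h.eventually_le_one] with n hn hn' ω hω
  have hb := h.b_pos n
  have hU := h.gaussianLoad_nonneg p e n ω
  have e1 := hn ω hω
  have e2 := hC n hn'.2.1 ω
  set G := Real.sqrt (n * b n)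
  set U := gaussianLoad k (b n) p (X n) μ e ω
  set T := ∫ t in endRegion e (b n), ((n : ℝ) * b n) ^ (p / 2) *
            |kernelSmooth k (b n) (fun u => Lam n u ω) t - lam t| ^ p ∂μ
  set S := ∫ t in endRegion e (b n),
            |gaussianPath k (b n) (X n) ω t + scaledBias k lam n (b n) t| ^ p ∂μ
  set V := ∫ t in endRegion e (b n), |scaledBias k lam n (b n) t| ^ p ∂μ
  have hG : 1 ≤ G ^ (p - 1) := Real.one_le_rpow hn'.2.2 (by linarith)
  rw [abs_mul, abs_of_nonneg (by positivity)]
  calc _ ≤ (Real.sqrt (b n))⁻¹ * (|T - S| + |S - V|) := by gcongr; exact abs_sub_le T S V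
    _ = (Real.sqrt (b n))⁻¹ * |T - S| + (Real.sqrt (b n))⁻¹ * |S - V| := mul_add _ _ _
    _ ≤ (α n * U + β n) + (Real.sqrt (b n))⁻¹ * (C * b n * ((2 * G ^ (p - 1)) * U)) := by
        gcongr
        refine e2.trans ?_
        rw [mul_assoc (C * b n)]
        gcongr
        linarith
    _ = _ := by rw [inv_sqrt_mul_self hb]; ring

end StrongApproximation

/-! ### Claim (i): the expected error. -/

theorem couplingRate_eq {q : ℝ} {b : ℕ → ℝ} (n : ℕ) :
    couplingRate q b n = (b n)⁻¹ * (n : ℝ) ^ (-1 + 1 / q) * Real.sqrt (n * b n) := by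
  rw [couplingRate]; ring

/-- For bandwidths of larger order than `n^{-1/3}` the coupling error is negligible with respect
to the bias. -/
theorem tendsto_inv_mul_rpow_of_cube {q : ℝ} (hq : 5 / 2 < q) {b : ℕ → ℝ} (hb : ∀ n, 0 < b n)
    (h : Tendsto (fun n : ℕ => (n : ℝ) * b n ^ 3) atTop atTop) :
    Tendsto (fun n : ℕ => (b n)⁻¹ * (n : ℝ) ^ (-1 + 1 / q)) atTop (𝓝 0) := by
  have hq0 : 0 < q := by linarith
  have h1 : -(2 / 3) + 1 / q < 0 := by
    have : 1 / q < 2 / 3 := by rw [div_lt_iff₀ hq0]; linarith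
    linarith
  refine tendsto_of_tendsto_of_tendsto_of_le_of_le' tendsto_const_nhds (tendsto_natCast_rpow_neg h1)
    (Eventually.of_forall fun n => ?_) ?_
  · have := hb n
    positivity
  · filter_upwards [h.eventually_ge_atTop 1, eventually_gt_atTop 0] with n hn hn0
    have hn' : (0 : ℝ) < n := by exact_mod_cast hn0
    have hbn := hb n
    -- From `n b^3 ≥ 1`; the product is then at most `n^{-2/3+1/q}`, with negative exponent.
    have h2 : (b n)⁻¹ ≤ (n : ℝ) ^ (1 / 3 : ℝ) := by
      have h3 : (b n)⁻¹ ^ 3 ≤ ((n : ℝ) ^ (1 / 3 : ℝ)) ^ 3 := by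
        rw [← Real.rpow_natCast ((n : ℝ) ^ (1 / 3 : ℝ)), ← Real.rpow_mul hn'.le]
        norm_num
        rw [inv_le_iff_one_le_mul₀ (by positivity)]
        exact hn
      exact le_of_pow_le_pow_left₀ (by norm_num) (by positivity) h3
    calc _ ≤ (n : ℝ) ^ (1 / 3 : ℝ) * (n : ℝ) ^ (-1 + 1 / q) := by gcongr
      _ = _ := by rw [← Real.rpow_add hn']; congr 1; ring

namespace StrongApproximation

variable {k lam L : ℝ → ℝ} {θ q Cq : ℝ} {μ : Measure ℝ} {Ω : ℕ → Type*}
    [∀ n, MeasurableSpace (Ω n)] {P : ∀ n, Measure (Ω n)}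
    {Lam X : ∀ n, ℝ → Ω n → ℝ} {b : ℕ → ℝ}

/-- Off the failure event, the bias dominates the `L_p` error over a boundary region. -/
theorem exists_le_error (h : StrongApproximation k lam L θ q Cq μ P Lam X b) {p : ℝ}
    (hp : 1 ≤ p) {e : ℝ} (he : e ∈ ({0, 1} : Set ℝ)) (hlame : lam e ≠ 0)
    (hwe : ∃ a > 0, ∃ r₀ > 0, ∀ r, 0 ≤ r → r ≤ r₀ → ENNReal.ofReal (a * r) ≤ μ (endRegion e r))
    (hb3 : Tendsto (fun n : ℕ => (n : ℝ) * b n ^ 3) atTop atTop) :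
    ∃ a > 0, ∀ x > 0, ∀ᶠ n in atTop, ∀ ω ∉ couplingFailure lam q n (Lam n) (X n) x,
      b n * (a * Real.sqrt (n * b n) - gaussianLoad k (b n) p (X n) μ e ω) ≤
        ∫ t in endRegion e (b n), ((n : ℝ) * b n) ^ (p / 2) *
          |kernelSmooth k (b n) (fun u => Lam n u ω) t - lam t| ^ p ∂μ := by
  obtain ⟨A, hA⟩ := h.lam_lipschitz
  -- The lower bound on the bias degenerates at distance `b` from the endpoint, so only half of the
  -- region is used.
  obtain ⟨σ, hσ, a₁, ha₁, b₁, hb₁, hbias⟩ := h.kernel.exists_le_scaledBias h.lam_continuousOn hA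
    (c := 1 / 2) (by norm_num) (by norm_num) he hlame
  obtain ⟨a₂, ha₂, r₀, hr₀, hμr⟩ := hwe
  obtain ⟨C, hC0, hC⟩ := h.exists_abs_sub_le
  have hμ := h.measure_unit_ne_top
  have hp0 : 0 ≤ p := by linarith
  refine ⟨a₁ / 2 * (a₂ / 2), by positivity, fun x hx => ?_⟩
  have hrate : ∀ᶠ n : ℕ in atTop, C * x * ((b n)⁻¹ * (n : ℝ) ^ (-1 + 1 / q)) ≤ a₁ / 4 := by
    have := (tendsto_inv_mul_rpow_of_cube h.q_gt h.b_pos hb3).const_mul (C * x)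
    rw [mul_zero] at this
    exact this.eventually (ge_mem_nhds (by positivity))
  have hG1 : ∀ᶠ n : ℕ in atTop, 1 ≤ a₁ / 4 * Real.sqrt (n * b n) := by
    have h1 : Tendsto (fun n : ℕ => Real.sqrt (n * b n)) atTop atTop :=
      Real.tendsto_sqrt_atTop.comp h.nb
    exact (h1.const_mul_atTop (by positivity : 0 < a₁ / 4)).eventually_ge_atTop 1
  filter_upwards [h.eventually_le_one, hrate, hG1, h.b_zero.eventually (ge_mem_nhds hb₁),
    h.b_zero.eventually (ge_mem_nhds hr₀)] with n hn hr hG hnb hnr ω hω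
  have hb := h.b_pos n
  have hE := h.continuousOn_error n ω
  have hl := h.continuousOn_load hp0 n ω
  have hclose := hC n hn.1 x hx ω hω
  rw [couplingRate_eq] at hclose
  have hbias' := hbias (b n) hb hnb n
  have hμ' := hμr (b n / 2) (by positivity) (by linarith)
  have hfin := h.isFiniteMeasure_restrict e (b n)
  have hsub : endRegion e (1 / 2 * b n) ⊆ endRegion e (b n) :=
    endRegion_mono e (by linarith)
  have heq : b n / 2 = 1 / 2 * b n := by ring
  rw [heq] at hμ'
  set R := endRegion e (1 / 2 * b n)
  have hRfin : μ R ≠ ∞ :=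
    ((measure_mono (endRegion_subset _ _)).trans_lt hμ.lt_top).ne
  have hμR : a₂ * (1 / 2 * b n) ≤ μ.real R := (ENNReal.ofReal_le_iff_le_toReal hRfin).1 hμ'
  set G := Real.sqrt (n * b n)
  have hnb0 : (0 : ℝ) ≤ n * b n := by positivity
  have hG0 : 0 ≤ G := Real.sqrt_nonneg _
  set Y := gaussianPath k (b n) (X n) ω
  set g := scaledBias k lam n (b n)
  set E := fun t => kernelSmooth k (b n) (fun u => Lam n u ω) t - lam t
  simp only [rpow_half_mul_abs_rpow hnb0]
  -- The bias is at least `a₁ * G`. One quarter of it absorbs the coupling error, another the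
  -- constant left by linearizing `p`-th powers through `y - 1 ≤ |y| ^ p`.
  have hpt : ∀ t ∈ R, a₁ / 2 * G - (1 + |Y t| ^ p) ≤ |G * E t| ^ p := by
    intro t ht
    have h1 := hbias' t ht
    have h2 := hclose t ht.1
    have h3 : a₁ * G ≤ |g t| := by
      refine h1.trans ((le_abs_self _).trans (le_of_eq ?_))
      rcases hσ with rfl | rfl <;> simp [g]
    have h4 : |g t| ≤ |G * E t| + |Y t| + |G * E t - (Y t + g t)| := by
      have e1 : g t = G * E t - Y t - (G * E t - (Y t + g t)) := by ring
      calc |g t| = |G * E t - Y t - (G * E t - (Y t + g t))| := by rw [← e1]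
        _ ≤ |G * E t - Y t| + |G * E t - (Y t + g t)| := abs_sub _ _
        _ ≤ _ := by gcongr; exact abs_sub _ _
    have h5 : |G * E t - (Y t + g t)| ≤ a₁ / 4 * G := by
      refine h2.trans ?_
      calc _ = C * x * ((b n)⁻¹ * (n : ℝ) ^ (-1 + 1 / q)) * G := by ring
        _ ≤ _ := by gcongr
    have h6 : ∀ y : ℝ, y - 1 ≤ |y| ^ p := by
      intro y
      rcases le_total 1 |y| with hy | hy
      · linarith [Real.self_le_rpow_of_one_le hy hp, le_abs_self y]
      · linarith [Real.rpow_nonneg (abs_nonneg y) p, le_abs_self y]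
    have h7 := h6 |G * E t|
    have h8 := h6 |Y t|
    rw [abs_abs] at h7 h8
    linarith
  have hi1 : IntegrableOn (fun t => 1 + |Y t| ^ p) (endRegion e (b n)) μ :=
    hl.integrableOn_endRegion hμ e (b n)
  have hi2 : IntegrableOn (fun t => |G * E t| ^ p) (endRegion e (b n)) μ :=
    ContinuousOn.integrableOn_endRegion hμ ((continuousOn_const.mul hE).abs.rpow_const
      fun _ _ => Or.inr hp0) e (b n)
  have hic : IntegrableOn (fun _ => a₁ / 2 * G) R μ := integrableOn_const hRfin
  calc _ = a₂ * (1 / 2 * b n) * (a₁ / 2 * G) - ∫ t in endRegion e (b n), (1 + |Y t| ^ p) ∂μ := by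
        rw [gaussianLoad]
        field_simp
        ring
    _ ≤ μ.real R * (a₁ / 2 * G) - ∫ t in R, (1 + |Y t| ^ p) ∂μ := by
        refine sub_le_sub (by gcongr) ?_
        exact setIntegral_mono_set hi1 (ae_of_all _ fun t => by positivity) hsub.eventuallyLE
    _ = ∫ t in R, (a₁ / 2 * G - (1 + |Y t| ^ p)) ∂μ := by
        rw [integral_sub hic (hi1.mono_set hsub), setIntegral_const, smul_eq_mul]
    _ ≤ ∫ t in R, |G * E t| ^ p ∂μ :=
        setIntegral_mono_on (hic.sub (hi1.mono_set hsub)) (hi2.mono_set hsub)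
          (measurableSet_endRegion _ _) hpt
    _ ≤ _ := setIntegral_mono_set hi2 (ae_of_all _ fun t => by positivity) hsub.eventuallyLE

/-- The failure event and the event of a large load have small probability. -/
theorem exists_measure_bad_le [∀ n, IsProbabilityMeasure (P n)]
    (h : StrongApproximation k lam L θ q Cq μ P Lam X b) {p : ℝ} (hp : 0 ≤ p) (e : ℝ) :
    ∃ x > 0, ∃ K > 0, ∀ᶠ n in atTop, P n (couplingFailure lam q n (Lam n) (X n) x ∪
      {ω | K ≤ gaussianLoad k (b n) p (X n) μ e ω}) ≤ 1 / 2 := by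
  obtain ⟨Cu, hCu0, hCu⟩ := h.exists_lintegral_gaussianLoad_le hp e
  have hq : 0 < q := by linarith [h.q_gt]
  obtain ⟨x, hx0, hx⟩ : ∃ x : ℝ, 0 < x ∧ Cq * x ^ (-q) < 1 / 4 := by
    have h : Tendsto (fun x : ℝ => Cq * x ^ (-q)) atTop (𝓝 (Cq * 0)) :=
      (tendsto_rpow_neg_atTop hq).const_mul Cq
    rw [mul_zero] at h
    obtain ⟨x, h1, h2⟩ := ((h.eventually (gt_mem_nhds (by norm_num : (0 : ℝ) < 1 / 4))).and
      (eventually_gt_atTop 0)).exists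
    exact ⟨x, h2, h1⟩
  refine ⟨x, hx0, 4 * Cu, by positivity, ?_⟩
  filter_upwards [eventually_ge_atTop ⌈x⌉₊] with n hnx
  have h1 : P n {ω | 4 * Cu ≤ gaussianLoad k (b n) p (X n) μ e ω} ≤ ENNReal.ofReal (1 / 4) := by
    calc _ ≤ P n {ω | ENNReal.ofReal (4 * Cu) ≤
            ENNReal.ofReal (gaussianLoad k (b n) p (X n) μ e ω)} :=
          measure_mono fun ω hω => ENNReal.ofReal_le_ofReal hω
      _ ≤ (∫⁻ ω, ENNReal.ofReal (gaussianLoad k (b n) p (X n) μ e ω) ∂(P n)) /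
            ENNReal.ofReal (4 * Cu) :=
          meas_ge_le_lintegral_div (hCu n).1.ennreal_ofReal (by simpa using hCu0)
            ENNReal.ofReal_ne_top
      _ ≤ ENNReal.ofReal Cu / ENNReal.ofReal (4 * Cu) := by gcongr; exact (hCu n).2
      _ = ENNReal.ofReal (Cu / (4 * Cu)) := (ENNReal.ofReal_div_of_pos (by positivity)).symm
      _ = _ := by congr 1; field_simp
  calc _ ≤ _ := measure_union_le _ _
    _ ≤ ENNReal.ofReal (1 / 4) + ENNReal.ofReal (1 / 4) := by
        refine add_le_add ((h.coupling n x ⟨hx0, ?_⟩).trans (ENNReal.ofReal_le_ofReal hx.le)) h1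
        exact Nat.ceil_le.1 hnx
    _ = ENNReal.ofReal (1 / 2) := by
        rw [← ENNReal.ofReal_add (by norm_num) (by norm_num)]; norm_num
    _ = 1 / 2 := by
        rw [ENNReal.ofReal_div_of_pos (by norm_num)]; simp

/-- The expected `L_p` error over a boundary region explodes if `n b ^ 3 → ∞`. -/
theorem tendsto_lintegral_error [∀ n, IsProbabilityMeasure (P n)]
    (h : StrongApproximation k lam L θ q Cq μ P Lam X b) {p : ℝ}
    (hp : 1 ≤ p) {e : ℝ} (he : e ∈ ({0, 1} : Set ℝ)) (hlame : lam e ≠ 0)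
    (hwe : ∃ a > 0, ∃ r₀ > 0, ∀ r, 0 ≤ r → r ≤ r₀ → ENNReal.ofReal (a * r) ≤ μ (endRegion e r))
    (hb3 : Tendsto (fun n : ℕ => (n : ℝ) * b n ^ 3) atTop atTop) :
    Tendsto (fun n : ℕ => ENNReal.ofReal (((n : ℝ) * b n) ^ (p / 2)) *
      ∫⁻ ω, ENNReal.ofReal (∫ t in endRegion e (b n),
        |kernelSmooth k (b n) (fun u => Lam n u ω) t - lam t| ^ p ∂μ) ∂(P n)) atTop (𝓝 ∞) := by
  obtain ⟨a, ha, herr⟩ := h.exists_le_error hp he hlame hwe hb3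
  obtain ⟨x, hx, K, hK, hbad⟩ := h.exists_measure_bad_le (by linarith : 0 ≤ p) e
  -- Here `b √(nb) = √(n b^3)`, which is where the bandwidth condition enters.
  have hlim : Tendsto (fun n : ℕ => b n * (a * Real.sqrt (n * b n) - K)) atTop atTop := by
    have h1 : Tendsto (fun n : ℕ => a * Real.sqrt (n * b n ^ 3) + -(b n * K)) atTop atTop := by
      refine Tendsto.atTop_add ((Real.tendsto_sqrt_atTop.comp hb3).const_mul_atTop ha)
        (C := -(0 * K)) (h.b_zero.mul_const K).neg
    refine h1.congr fun n => ?_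
    have hb := h.b_pos n
    have h2 : Real.sqrt (n * b n ^ 3) = b n * Real.sqrt (n * b n) := by
      rw [show (n : ℝ) * b n ^ 3 = b n ^ 2 * (n * b n) by ring, Real.sqrt_mul (sq_nonneg _),
        Real.sqrt_sq hb.le]
    rw [h2]; ring
  have hlim2 : Tendsto (fun n : ℕ => ENNReal.ofReal (b n * (a * Real.sqrt (n * b n) - K)) *
      (1 / 2)) atTop (𝓝 ∞) := by
    have h1 := ENNReal.tendsto_ofReal_atTop.comp hlim
    have h2 := ENNReal.Tendsto.mul_const (b := 1 / 2) h1 (Or.inl ENNReal.top_ne_zero)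
    rwa [ENNReal.top_mul (by simp)] at h2
  refine tendsto_of_tendsto_of_tendsto_of_le_of_le' hlim2 tendsto_const_nhds ?_
    (Eventually.of_forall fun _ => le_top)
  filter_upwards [herr x hx, hbad] with n hn hnbad
  have hb := h.b_pos n
  set bad := couplingFailure lam q n (Lam n) (X n) x ∪
      {ω | K ≤ gaussianLoad k (b n) p (X n) μ e ω}
  -- The failure event is an uncountable union and need not be measurable, so the complement of a
  -- measurable hull is used.
  set S := (toMeasurable (P n) bad)ᶜ
  have hS : MeasurableSet S := (measurableSet_toMeasurable _ _).compl
  have hSp : 1 / 2 ≤ P n S := by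
    rw [prob_compl_eq_one_sub (measurableSet_toMeasurable _ _), measure_toMeasurable]
    calc (1 : ℝ≥0∞) / 2 = 1 - 1 / 2 := by simp
      _ ≤ _ := tsub_le_tsub_left hnbad 1
  rw [← lintegral_const_mul' _ _ ENNReal.ofReal_ne_top]
  calc _ ≤ ENNReal.ofReal (b n * (a * Real.sqrt (n * b n) - K)) * P n S := by gcongr
    _ = ∫⁻ _ in S, ENNReal.ofReal (b n * (a * Real.sqrt (n * b n) - K)) ∂(P n) := by
        rw [setLIntegral_const]
    _ ≤ ∫⁻ ω in S, ENNReal.ofReal (((n : ℝ) * b n) ^ (p / 2)) * ENNReal.ofReal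
          (∫ t in endRegion e (b n),
            |kernelSmooth k (b n) (fun u => Lam n u ω) t - lam t| ^ p ∂μ) ∂(P n) := by
        refine setLIntegral_mono' hS fun ω hω => ?_
        have hω' : ω ∉ bad := fun hm => hω (subset_toMeasurable _ _ hm)
        have h1 := hn ω fun hm => hω' (Or.inl hm)
        have h2 : gaussianLoad k (b n) p (X n) μ e ω ≤ K := by
          by_contra hc
          exact hω' (Or.inr (not_le.1 hc).le)
        rw [← ENNReal.ofReal_mul (by positivity), ← integral_const_mul]
        refine ENNReal.ofReal_le_ofReal (le_trans ?_ h1)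
        gcongr
    _ ≤ _ := setLIntegral_le_lintegral _ _

end StrongApproximation

/-! ### Covariance of `|Y + g|^p` with a Gaussian variable. -/

/-- Both sides are even in `y`. For `0 ≤ y ≤ g`, Bernoulli gives `|y + g|^p ≥ g^p + p g^{p-1} y`,
while `|y - g|^p ≤ g^p`. For `y ≥ g` the quartic term makes the left side nonpositive, so the bound
holds on the whole line and can be integrated. -/
theorem le_mul_abs_add_rpow_sub {p g : ℝ} (hp : 1 ≤ p) (hg : 0 < g) (y : ℝ) :
    p * g ^ (p - 1) * (y ^ 2 - y ^ 4 / g ^ 2) ≤ y * (|y + g| ^ p - |y - g| ^ p) := by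
  wlog hy : 0 ≤ y generalizing y
  · have h := this (-y) (by linarith)
    rw [show -y + g = -(y - g) by ring, show -y - g = -(y + g) by ring, abs_neg, abs_neg] at h
    rw [show y ^ 2 - y ^ 4 / g ^ 2 = (-y) ^ 2 - (-y) ^ 4 / g ^ 2 by ring]
    linarith
  have hp0 : 0 ≤ p := by linarith
  have hc : 0 ≤ p * g ^ (p - 1) := by positivity
  rcases le_total y g with h | h
  · have h1 : g ^ p + p * g ^ (p - 1) * y ≤ |y + g| ^ p := by
      have h2 := one_add_mul_self_le_rpow_one_add (s := y / g)
        (le_trans (by norm_num) (div_nonneg hy hg.le)) hp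
      have h3 : |y + g| = g * (1 + y / g) := by
        rw [abs_of_nonneg (by linarith)]; field_simp; ring
      have h4 : g ^ p = g ^ (p - 1) * g := by
        rw [← Real.rpow_add_one hg.ne']; congr 1; ring
      rw [h3, Real.mul_rpow hg.le (by positivity)]
      calc _ = g ^ p * (1 + p * (y / g)) := by rw [h4]; field_simp
        _ ≤ _ := by gcongr
    have h5 : |y - g| ^ p ≤ g ^ p := by
      refine Real.rpow_le_rpow (abs_nonneg _) ?_ hp0
      rw [abs_sub_comm, abs_of_nonneg (by linarith)]; linarith
    calc _ ≤ p * g ^ (p - 1) * y ^ 2 := by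
          refine mul_le_mul_of_nonneg_left ?_ hc
          have : 0 ≤ y ^ 4 / g ^ 2 := by positivity
          linarith
      _ = y * (g ^ p + p * g ^ (p - 1) * y - g ^ p) := by ring
      _ ≤ _ := by gcongr
  · have h1 : y ^ 2 - y ^ 4 / g ^ 2 ≤ 0 := by
      rw [sub_nonpos, le_div_iff₀ (by positivity)]
      have : g ^ 2 ≤ y ^ 2 := by gcongr
      nlinarith [sq_nonneg y]
    have h2 : |y - g| ^ p ≤ |y + g| ^ p := by
      refine Real.rpow_le_rpow (abs_nonneg _) ?_ hp0
      rw [abs_of_nonneg (by linarith), abs_of_nonneg (by linarith)]; linarith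
    exact (mul_nonpos_of_nonneg_of_nonpos hc h1).trans (mul_nonneg hy (by linarith))

section GaussianReal

open ProbabilityTheory

theorem integrable_mul_abs_add_rpow (v : ℝ≥0) {p : ℝ} (hp : 0 ≤ p) (g : ℝ) :
    Integrable (fun x => x * |x + g| ^ p) (gaussianReal 0 v) := by
  have hc : Continuous fun x : ℝ => x * |x + g| ^ p :=
    continuous_id.mul ((continuous_id.add continuous_const).abs.rpow_const fun _ => Or.inr hp)
  refine Integrable.mono' (((integrable_abs_rpow_gaussianReal v (by linarith : 0 ≤ p + 1)).add
    ((integrable_abs_rpow_gaussianReal v zero_le_one).const_mul (|g| ^ p))).const_mul (2 ^ p))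
    hc.aestronglyMeasurable (ae_of_all _ fun x => ?_)
  have h1 : |x + g| ^ p ≤ 2 ^ p * (|x| ^ p + |g| ^ p) :=
    (Real.rpow_le_rpow (abs_nonneg _) (abs_add_le x g) hp).trans
      (add_rpow_le_two_rpow_mul hp (abs_nonneg _) (abs_nonneg _))
  rw [Real.norm_eq_abs, abs_mul, abs_of_nonneg (Real.rpow_nonneg (abs_nonneg _) p)]
  simp only [Pi.add_apply]
  rw [Real.rpow_add_one' (abs_nonneg x) (by linarith), Real.rpow_one]
  calc _ ≤ |x| * (2 ^ p * (|x| ^ p + |g| ^ p)) := by gcongr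
    _ = _ := by ring

theorem integral_sq_gaussianReal (v : ℝ≥0) : ∫ x, x ^ 2 ∂(gaussianReal 0 v) = v := by
  have h := variance_id_gaussianReal (μ := 0) (v := v)
  rw [variance_of_integral_eq_zero aemeasurable_id (by simp)] at h
  simpa using h

theorem integral_comp_neg_gaussianReal (v : ℝ≥0) (f : ℝ → ℝ) :
    ∫ x, f (-x) ∂(gaussianReal 0 v) = ∫ x, f x ∂(gaussianReal 0 v) := by
  have h := (MeasurableEquiv.neg ℝ).measurableEmbedding.integral_map (μ := gaussianReal 0 v) f
  have e : (gaussianReal 0 v).map (MeasurableEquiv.neg ℝ) = gaussianReal 0 v := by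
    have := gaussianReal_map_neg (μ := 0) (v := v)
    rwa [neg_zero] at this
  rw [e] at h
  exact h.symm

theorem integral_pow_four_gaussianReal (v : ℝ≥0) :
    Integrable (fun x => x ^ 4) (gaussianReal 0 v) ∧
      ∫ x, x ^ 4 ∂(gaussianReal 0 v) = (v : ℝ) ^ 2 * normalAbsMoment 4 := by
  have e : (fun x : ℝ => |x| ^ (4 : ℝ)) = fun x => x ^ 4 := by
    ext x
    rw [show (4 : ℝ) = ((4 : ℕ) : ℝ) by norm_num, Real.rpow_natCast,
      Even.pow_abs ⟨2, rfl⟩]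
  have h1 := integrable_abs_rpow_gaussianReal v (r := 4) (by norm_num)
  have h2 := integral_abs_rpow_of_map (P := gaussianReal 0 v) (Y := id) (v := v)
    Measure.map_id (r := 4) (by norm_num)
  simp only [id, e] at h1 h2
  refine ⟨h1, h2.trans ?_⟩
  rw [show (4 : ℝ) = ((4 : ℕ) : ℝ) by norm_num, Real.rpow_natCast]
  congr 1
  rw [show (4 : ℕ) = 2 * 2 by norm_num, pow_mul, Real.sq_sqrt v.coe_nonneg]

/-- Lower bound for the first Hermite coefficient of `x ↦ |x + g| ^ p` for large positive `g`. -/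
theorem le_integral_mul_abs_add_rpow (v : ℝ≥0) {p g : ℝ} (hp : 1 ≤ p) (hg : 0 < g)
    (hvg : 2 * normalAbsMoment 4 * v ≤ g ^ 2) :
    p / 4 * g ^ (p - 1) * v ≤ ∫ x, x * |x + g| ^ p ∂(gaussianReal 0 v) := by
  have hp0 : 0 ≤ p := by linarith
  obtain ⟨hi4, hI4⟩ := integral_pow_four_gaussianReal v
  have hi2 : Integrable (fun x : ℝ => x ^ 2) (gaussianReal 0 v) :=
    (memLp_id_gaussianReal 2).integrable_sq
  have hi := integrable_mul_abs_add_rpow v hp0 g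
  have hi' := integrable_mul_abs_add_rpow v hp0 (-g)
  -- Reflection makes the two halves of the symmetrized integrand contribute equally, hence half of
  -- the bound for their sum.
  have hneg : ∫ x, x * |x + -g| ^ p ∂(gaussianReal 0 v) =
      -∫ x, x * |x + g| ^ p ∂(gaussianReal 0 v) := by
    rw [← integral_comp_neg_gaussianReal, ← integral_neg]
    refine integral_congr_ae (ae_of_all _ fun x => ?_)
    simp only
    rw [show -x + -g = -(x + g) by ring, abs_neg]
    ring
  have hmono : ∫ x, p * g ^ (p - 1) * (x ^ 2 - x ^ 4 / g ^ 2) ∂(gaussianReal 0 v) ≤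
      ∫ x, (x * |x + g| ^ p - x * |x + -g| ^ p) ∂(gaussianReal 0 v) := by
    refine integral_mono ((hi2.sub (hi4.div_const _)).const_mul _) (hi.sub hi') fun x => ?_
    have := le_mul_abs_add_rpow_sub hp hg x
    rw [mul_sub x, sub_eq_add_neg x g] at this
    exact this
  rw [integral_sub hi hi', hneg, integral_const_mul, integral_sub hi2 (hi4.div_const _),
    integral_div, integral_sq_gaussianReal, hI4] at hmono
  -- The size condition on `g` makes the quartic correction at most half of the main term; with the
  -- symmetrization this gives the constant `p / 4`.
  have h1 : (v : ℝ) ^ 2 * normalAbsMoment 4 / g ^ 2 ≤ v / 2 := by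
    rw [div_le_div_iff₀ (by positivity) (by norm_num)]
    nlinarith [v.2]
  have h2 : p * g ^ (p - 1) * (v / 2) ≤
      p * g ^ (p - 1) * (v - (v : ℝ) ^ 2 * normalAbsMoment 4 / g ^ 2) :=
    mul_le_mul_of_nonneg_left (by linarith) (by positivity)
  linarith

/-- The same bound for large `g` of sign `σ`. -/
theorem le_mul_integral_mul_abs_add_rpow (v : ℝ≥0) {p g σ : ℝ} (hp : 1 ≤ p) (hσ : σ = 1 ∨ σ = -1)
    (hg : 0 < σ * g) (hvg : 2 * normalAbsMoment 4 * v ≤ (σ * g) ^ 2) :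
    p / 4 * (σ * g) ^ (p - 1) * v ≤ σ * ∫ x, x * |x + g| ^ p ∂(gaussianReal 0 v) := by
  have h := le_integral_mul_abs_add_rpow v hp hg hvg
  rcases hσ with rfl | rfl
  · simpa using h
  · have e : ∫ x, x * |x + -1 * g| ^ p ∂(gaussianReal 0 v) =
        -∫ x, x * |x + g| ^ p ∂(gaussianReal 0 v) := by
      rw [← integral_comp_neg_gaussianReal, ← integral_neg]
      refine integral_congr_ae (ae_of_all _ fun x => ?_)
      simp only
      rw [show -x + -1 * g = -(x + g) by ring, abs_neg]
      ring
    linarith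

end GaussianReal

section Regression

open ProbabilityTheory

variable {Ω : Type*} [MeasurableSpace Ω] {P : Measure Ω} [IsProbabilityMeasure P] {Y N : Ω → ℝ}

/-- Gaussian regression. -/
theorem integral_comp_mul_of_hasGaussianLaw (h : HasGaussianLaw (fun ω => (Y ω, N ω)) P)
    (hY : ∫ ω, Y ω ∂P = 0) (hN : ∫ ω, N ω ∂P = 0) {f : ℝ → ℝ} (hf : Measurable f)
    (hfY : Integrable (fun ω => f (Y ω)) P) (hfYY : Integrable (fun ω => f (Y ω) * Y ω) P)
    (hv : ∫ ω, Y ω ^ 2 ∂P ≠ 0) :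
    Integrable (fun ω => f (Y ω) * N ω) P ∧ ∫ ω, f (Y ω) * N ω ∂P =
      (∫ ω, Y ω * N ω ∂P) / (∫ ω, Y ω ^ 2 ∂P) * ∫ ω, Y ω * f (Y ω) ∂P := by
  set r := (∫ ω, Y ω * N ω ∂P) / (∫ ω, Y ω ^ 2 ∂P) with hr
  set M : Ω → ℝ := fun ω => N ω - r * Y ω with hM
  have hYm := h.fst.memLp_two
  have hNm := h.snd.memLp_two
  have hMm : MemLp M 2 P := hNm.sub (hYm.const_mul r)
  have hYM : HasGaussianLaw (fun ω => (Y ω, M ω)) P := by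
    have := h.map_fun ((ContinuousLinearMap.fst ℝ ℝ ℝ).prod
      (ContinuousLinearMap.snd ℝ ℝ ℝ - r • ContinuousLinearMap.fst ℝ ℝ ℝ))
    simpa using this
  have hM0 : ∫ ω, M ω ∂P = 0 := by
    rw [hM, integral_sub h.snd.integrable (h.fst.integrable.const_mul r), integral_const_mul, hY,
      hN]
    simp
  have hcov : covariance Y M P = 0 := by
    rw [covariance_eq_sub hYm hMm, hY, zero_mul, sub_zero]
    have e : Y * M = fun ω => Y ω * N ω - r * Y ω ^ 2 := by
      ext ω; simp only [Pi.mul_apply, hM]; ring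
    have hi : Integrable (fun ω => Y ω * N ω) P := hYm.integrable_mul hNm
    rw [e, integral_sub hi (hYm.integrable_sq.const_mul r),
      integral_const_mul, hr, div_mul_cancel₀ _ hv, sub_self]
  -- The residual `M` of the regression of `N` on `Y` is uncorrelated with `Y`, hence independent of
  -- it by joint Gaussianity, and it is centred; only the multiple `r * Y` contributes.
  have hind := (hYM.indepFun_of_covariance_eq_zero hcov).comp hf measurable_id
  have hi : Integrable (fun ω => f (Y ω) * M ω) P :=
    hind.integrable_mul (X := fun ω => f (Y ω)) hfY (hMm.integrable one_le_two)
  have e : (fun ω => f (Y ω) * N ω) = fun ω => f (Y ω) * M ω + r * (f (Y ω) * Y ω) := by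
    ext ω; simp only [hM]; ring
  rw [e]
  refine ⟨hi.add (hfYY.const_mul r), ?_⟩
  rw [integral_add hi (hfYY.const_mul r), integral_const_mul]
  have h0 := hind.integral_fun_mul_eq_mul_integral hfY.aestronglyMeasurable
    hMm.aestronglyMeasurable
  simp only [Function.comp_def, id, hM0, mul_zero] at h0
  rw [h0, zero_add]
  congr 1
  exact integral_congr_ae (ae_of_all _ fun ω => mul_comm _ _)

/-- The covariance of `|Y + g| ^ p` with a variable `N` that is positively correlated with `Y`. -/
theorem le_mul_integral_abs_add_rpow_mul (h : HasGaussianLaw (fun ω => (Y ω, N ω)) P) {v : ℝ≥0}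
    (hY : P.map Y = gaussianReal 0 v) (hN : ∫ ω, N ω ∂P = 0) {p g σ κ : ℝ} (hp : 1 ≤ p)
    (hσ : σ = 1 ∨ σ = -1) (hg : 0 < σ * g) (hvg : 2 * normalAbsMoment 4 * v ≤ (σ * g) ^ 2)
    (hκ : 0 < κ) (hκ' : κ ≤ ∫ ω, Y ω * N ω ∂P) :
    κ * (p / 4 * (σ * g) ^ (p - 1)) ≤ σ * ∫ ω, |Y ω + g| ^ p * N ω ∂P := by
  have hp0 : 0 ≤ p := by linarith
  have hYm := h.fst.aemeasurable
  have hpow : ∫ ω, Y ω ^ 2 ∂P = v := by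
    rw [← integral_sq_gaussianReal v, ← hY, integral_map hYm (by fun_prop)]
  -- If the variance vanished, `Y` would be zero almost surely, against the positive correlation
  -- with `N`.
  have hv : (v : ℝ) ≠ 0 := by
    intro hv
    rw [hv, integral_eq_zero_iff_of_nonneg (fun ω => sq_nonneg _) h.fst.memLp_two.integrable_sq]
      at hpow
    have : ∫ ω, Y ω * N ω ∂P = 0 := by
      rw [← integral_zero Ω ℝ (μ := P)]
      refine integral_congr_ae ?_
      filter_upwards [hpow] with ω hω
      have h0 : Y ω = 0 := by simpa using hω
      rw [h0, zero_mul]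
    linarith
  have hc : Continuous fun x : ℝ => |x + g| ^ p :=
    (continuous_id.add continuous_const).abs.rpow_const fun _ => Or.inr hp0
  have hmean : ∫ ω, Y ω ∂P = 0 := by
    have h1 : ∫ x, x ∂(P.map Y) = 0 := by rw [hY, integral_id_gaussianReal]
    rwa [integral_map hYm (by fun_prop)] at h1
  have i1 : Integrable (fun ω => Y ω * |Y ω + g| ^ p) P := by
    have := integrable_mul_abs_add_rpow v hp0 g
    rw [← hY] at this
    exact this.comp_aemeasurable hYm
  have i2 : Integrable (fun ω => |Y ω + g| ^ p) P := by
    have h1 := ((integrable_abs_rpow_of_map hY hp0).add (integrable_const (|g| ^ p))).const_mul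
      (2 ^ p)
    refine h1.mono' (hc.aestronglyMeasurable.comp_aemeasurable hYm) (ae_of_all _ fun ω => ?_)
    rw [Real.norm_of_nonneg (Real.rpow_nonneg (abs_nonneg _) p)]
    exact (Real.rpow_le_rpow (abs_nonneg _) (abs_add_le _ g) hp0).trans
      (add_rpow_le_two_rpow_mul hp0 (abs_nonneg _) (abs_nonneg _))
  have hreg := (integral_comp_mul_of_hasGaussianLaw h hmean hN hc.measurable i2
    (by simpa only [mul_comm] using i1) (by rwa [hpow])).2
  have hI : ∫ ω, Y ω * |Y ω + g| ^ p ∂P = ∫ x, x * |x + g| ^ p ∂(gaussianReal 0 v) := by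
    have hc' : Continuous fun x : ℝ => x * |x + g| ^ p := continuous_id.mul hc
    rw [← hY, integral_map hYm hc'.aestronglyMeasurable]
  rw [hpow, hI] at hreg
  have hlow := le_mul_integral_mul_abs_add_rpow v hp hσ hg hvg
  have hv0 : (0 : ℝ) < v := lt_of_le_of_ne v.2 hv.symm
  rw [hreg]
  calc _ ≤ (∫ ω, Y ω * N ω ∂P) * (p / 4 * (σ * g) ^ (p - 1)) := by gcongr
    _ = (∫ ω, Y ω * N ω ∂P) / v * (p / 4 * (σ * g) ^ (p - 1) * v) := by field_simp
    _ ≤ (∫ ω, Y ω * N ω ∂P) / v * (σ * ∫ x, x * |x + g| ^ p ∂(gaussianReal 0 v)) := by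
        gcongr
        exact div_nonneg (hκ.le.trans hκ') hv0.le
    _ = _ := by ring

/-- The Cauchy–Schwarz inequality for the covariance with a centred variable. -/
theorem sq_integral_mul_le_variance_mul {F N : Ω → ℝ} (hF : MemLp F 2 P) (hN : MemLp N 2 P)
    (hN0 : ∫ ω, N ω ∂P = 0) :
    (∫ ω, F ω * N ω ∂P) ^ 2 ≤ variance F P * ∫ ω, N ω ^ 2 ∂P := by
  set m := ∫ ω, F ω ∂P
  set D := ∫ ω, N ω ^ 2 ∂P
  set I := ∫ ω, F ω * N ω ∂P
  have hFm : MemLp (fun ω => F ω - m) 2 P := hF.sub (memLp_const m)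
  have hI : ∫ ω, (F ω - m) * N ω ∂P = I := by
    have e : (fun ω => (F ω - m) * N ω) = fun ω => F ω * N ω - m * N ω := by ext; ring
    have hi : Integrable (fun ω => F ω * N ω) P := hF.integrable_mul hN
    rw [e, integral_sub hi ((hN.integrable one_le_two).const_mul m),
      integral_const_mul, hN0, mul_zero, sub_zero]
  have hV : variance F P = ∫ ω, (F ω - m) ^ 2 ∂P := variance_eq_integral hF.aemeasurable
  have hi : Integrable (fun ω => (F ω - m) * N ω) P := hFm.integrable_mul hN
  -- The second moment of `F - m - a * N` is a nonnegative quadratic in `a`; its discriminant yields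
  -- the inequality.
  have key : ∀ a : ℝ, 0 ≤ variance F P - 2 * a * I + a ^ 2 * D := by
    intro a
    have e : (fun ω => (F ω - m - a * N ω) ^ 2) = fun ω =>
        (F ω - m) ^ 2 - 2 * a * ((F ω - m) * N ω) + a ^ 2 * N ω ^ 2 := by ext; ring
    have h0 : 0 ≤ ∫ ω, (F ω - m - a * N ω) ^ 2 ∂P := integral_nonneg fun _ => sq_nonneg _
    have hi1 : Integrable (fun ω => (F ω - m) ^ 2 - 2 * a * ((F ω - m) * N ω)) P :=
      hFm.integrable_sq.sub (hi.const_mul _)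
    rw [e, integral_add hi1 (hN.integrable_sq.const_mul _),
      integral_sub hFm.integrable_sq (hi.const_mul _), integral_const_mul, integral_const_mul, hI,
      ← hV] at h0
    exact h0
  have hd := discrim_le_zero (a := D) (b := -2 * I) (c := variance F P) fun a => by
    have := key a; nlinarith
  rw [discrim] at hd
  nlinarith

end Regression

/-! ### Mixtures over a region and the lower bound for the variance. -/

section Fubini

variable {Ω : Type*} [MeasurableSpace Ω] {P : Measure Ω} [IsProbabilityMeasure P] {ν : Measure ℝ}
  [IsFiniteMeasure ν] {W : ℝ → Ω → ℝ} {M : ℝ}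

theorem integrable_uncurry_of_integral_abs_le (hW : StronglyMeasurable (Function.uncurry W))
    (hM : ∀ᵐ t ∂ν, Integrable (W t) P ∧ ∫ ω, |W t ω| ∂P ≤ M) :
    Integrable (Function.uncurry W) (ν.prod P) := by
  refine (integrable_prod_iff hW.aestronglyMeasurable).2 ⟨hM.mono fun t ht => ht.1, ?_⟩
  refine Integrable.of_bound (hW.norm.integral_prod_right).aestronglyMeasurable M ?_
  filter_upwards [hM] with t ht
  rw [Real.norm_of_nonneg (integral_nonneg fun _ => norm_nonneg _)]
  exact ht.2

theorem sq_integral_le_mul_integral_sq {f : ℝ → ℝ} (hf : MemLp f 2 ν) :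
    (∫ t, f t ∂ν) ^ 2 ≤ ν.real univ * ∫ t, f t ^ 2 ∂ν := by
  set I := ∫ t, f t ∂ν
  have hi : Integrable f ν := hf.integrable one_le_two
  have key : ∀ a : ℝ, 0 ≤ ν.real univ * (a * a) + -2 * I * a + ∫ t, f t ^ 2 ∂ν := by
    intro a
    have h0 : 0 ≤ ∫ t, (f t - a) ^ 2 ∂ν := integral_nonneg fun _ => sq_nonneg _
    have e : (fun t => (f t - a) ^ 2) = fun t => f t ^ 2 - 2 * a * f t + a ^ 2 := by ext; ring
    have hi1 : Integrable (fun t => f t ^ 2 - 2 * a * f t) ν := hf.integrable_sq.sub (hi.const_mul _)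
    rw [e, integral_add hi1 (integrable_const _), integral_sub hf.integrable_sq (hi.const_mul _),
      integral_const_mul, integral_const, smul_eq_mul] at h0
    linarith
  have hd := discrim_le_zero key
  rw [discrim] at hd
  nlinarith

/-- A mixture of square integrable variables is square integrable. -/
theorem memLp_two_integral (hW : StronglyMeasurable (Function.uncurry W))
    (hM : ∀ᵐ t ∂ν, Integrable (fun ω => W t ω ^ 2) P ∧ ∫ ω, W t ω ^ 2 ∂P ≤ M) :
    MemLp (fun ω => ∫ t, W t ω ∂ν) 2 P := by
  have hsm : StronglyMeasurable (Function.uncurry fun t ω => W t ω ^ 2) := hW.pow 2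
  have hi := integrable_uncurry_of_integral_abs_le (ν := ν) (P := P) hsm (M := M) (by
    simpa only [abs_pow, sq_abs] using hM)
  have hF : StronglyMeasurable fun ω => ∫ t, W t ω ∂ν := hW.integral_prod_left
  refine (memLp_two_iff_integrable_sq hF.aestronglyMeasurable).2 ?_
  refine Integrable.mono' ((hi.integral_prod_right).const_mul (ν.real univ))
    (hF.pow 2).aestronglyMeasurable ?_
  filter_upwards [hi.prod_left_ae] with ω hω
  have hWm : StronglyMeasurable fun t => W t ω := hW.comp_measurable measurable_prodMk_right
  rw [Real.norm_of_nonneg (sq_nonneg _)]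
  exact sq_integral_le_mul_integral_sq
    ((memLp_two_iff_integrable_sq hWm.aestronglyMeasurable).2 hω)

/-- Covariance of a mixture with a square integrable variable. -/
theorem integral_integral_mul (hW : StronglyMeasurable (Function.uncurry W))
    (hM : ∀ᵐ t ∂ν, Integrable (fun ω => W t ω ^ 2) P ∧ ∫ ω, W t ω ^ 2 ∂P ≤ M) {N : Ω → ℝ}
    (hN : Measurable N) (hN2 : MemLp N 2 P) :
    Integrable (fun t => ∫ ω, W t ω * N ω ∂P) ν ∧
      ∫ ω, (∫ t, W t ω ∂ν) * N ω ∂P = ∫ t, (∫ ω, W t ω * N ω ∂P) ∂ν := by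
  have hsm : StronglyMeasurable (Function.uncurry fun t ω => W t ω * N ω) :=
    hW.mul (hN.stronglyMeasurable.comp_measurable measurable_snd)
  have hi := integrable_uncurry_of_integral_abs_le (ν := ν) (P := P) hsm
    (M := M + ∫ ω, N ω ^ 2 ∂P) (by
      filter_upwards [hM] with t ht
      have hWm : StronglyMeasurable (W t) := hW.comp_measurable measurable_prodMk_left
      have h1 : MemLp (W t) 2 P := (memLp_two_iff_integrable_sq hWm.aestronglyMeasurable).2 ht.1
      have h2 : Integrable (fun ω => W t ω * N ω) P := h1.integrable_mul hN2
      refine ⟨h2, ?_⟩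
      calc ∫ ω, |W t ω * N ω| ∂P ≤ ∫ ω, (W t ω ^ 2 + N ω ^ 2) ∂P := by
            refine integral_mono h2.abs (ht.1.add hN2.integrable_sq) fun ω => ?_
            simp only
            rw [abs_mul, ← sq_abs (W t ω), ← sq_abs (N ω)]
            nlinarith [sq_nonneg (|W t ω| - |N ω|), sq_nonneg (|W t ω|), sq_nonneg (|N ω|)]
        _ ≤ _ := by
            rw [integral_add ht.1 hN2.integrable_sq]
            linarith [ht.2])
  refine ⟨hi.integral_prod_left, ?_⟩
  rw [integral_integral_swap hi]
  simp only [integral_mul_const]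

end Fubini

theorem integrable_sq_abs_add_rpow_of_map {Ω : Type*} [MeasurableSpace Ω] {P : Measure Ω}
    [IsProbabilityMeasure P] {Y : Ω → ℝ} {v : ℝ≥0}
    (hY : P.map Y = ProbabilityTheory.gaussianReal 0 v) {D g M p : ℝ} (hD : Real.sqrt v ≤ D)
    (hp : 0 ≤ p) (hg : |g| ≤ M) :
    Integrable (fun ω => (|Y ω + g| ^ p) ^ 2) P ∧ ∫ ω, (|Y ω + g| ^ p) ^ 2 ∂P ≤
      2 ^ (2 * p) * (D ^ (2 * p) * normalAbsMoment (2 * p) + M ^ (2 * p)) := by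
  have hp2 : 0 ≤ 2 * p := by positivity
  have hM := normalAbsMoment_nonneg (2 * p)
  have e : ∀ z : ℝ, (|z| ^ p) ^ 2 = |z| ^ (2 * p) := fun z => by
    rw [mul_comm, Real.rpow_mul (abs_nonneg z), Real.rpow_two]
  simp only [e]
  have hb : ∀ ω, |Y ω + g| ^ (2 * p) ≤ 2 ^ (2 * p) * (|Y ω| ^ (2 * p) + M ^ (2 * p)) := fun ω =>
    (Real.rpow_le_rpow (abs_nonneg _) ((abs_add_le (Y ω) g).trans (by gcongr)) hp2).trans
      (add_rpow_le_two_rpow_mul hp2 (abs_nonneg _) ((abs_nonneg _).trans hg))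
  have hi1 := integrable_abs_rpow_of_map hY hp2
  have hi : Integrable (fun ω => 2 ^ (2 * p) * (|Y ω| ^ (2 * p) + M ^ (2 * p))) P :=
    (hi1.add (integrable_const _)).const_mul _
  have hc : Continuous fun x : ℝ => |x + g| ^ (2 * p) :=
    (continuous_id.add continuous_const).abs.rpow_const fun _ => Or.inr hp2
  have hi2 : Integrable (fun ω => |Y ω + g| ^ (2 * p)) P := by
    refine hi.mono' (hc.aestronglyMeasurable.comp_aemeasurable
      (aemeasurable_of_map_eq_gaussianReal hY)) (ae_of_all _ fun ω => ?_)
    rw [Real.norm_of_nonneg (Real.rpow_nonneg (abs_nonneg _) _)]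
    exact hb ω
  refine ⟨hi2, (integral_mono hi2 hi hb).trans ?_⟩
  rw [integral_const_mul, integral_add hi1 (integrable_const _), integral_abs_rpow_of_map hY hp2]
  simp only [integral_const, probReal_univ, one_smul]
  gcongr

/-- The kernel keeps at least half of its mass, even at an endpoint, and the clock runs at speed at
least `c`. -/
theorem IsSmoothingKernel.le_integral_rescaledKernel_mul {k L' : ℝ → ℝ} (hk : IsSmoothingKernel k)
    (hL' : ContinuousOn L' (Icc 0 1)) {c b : ℝ} (hc : 0 ≤ c) (hcL : ∀ u ∈ Icc (0 : ℝ) 1, c ≤ L' u)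
    (hb : 0 < b) (hb' : b ≤ 1 / 2) {t : ℝ} (ht : t ∈ Icc (0 : ℝ) 1) :
    c / 2 ≤ ∫ u in (0 : ℝ)..1, rescaledKernel k b (t - u) * L' u := by
  have hcont := hk.continuous_rescaledKernel_sub b t
  have h1 := hk.half_le_kernelMass hb hb' ht
  calc c / 2 ≤ kernelMass k b t * c := by nlinarith
    _ = ∫ u in (0 : ℝ)..1, rescaledKernel k b (t - u) * c := by
        rw [intervalIntegral.integral_mul_const, kernelMass]
    _ ≤ _ := by
        refine intervalIntegral.integral_mono_on zero_le_one
          ((hcont.mul continuous_const).intervalIntegrable _ _) ?_ fun u hu => ?_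
        · refine ContinuousOn.intervalIntegrable ?_
          rw [uIcc_of_le zero_le_one]
          exact hcont.continuousOn.mul hL'
        · exact mul_le_mul_of_nonneg_left (hcL u hu)
            (mul_nonneg (inv_nonneg.2 hb.le) (hk.nonneg _))

namespace IsTimeChangedGaussian

variable {Ω : Type*} [MeasurableSpace Ω] {P : Measure Ω} [IsProbabilityMeasure P] {L : ℝ → ℝ}
  {θ : ℝ} {X : ℝ → Ω → ℝ} {k : ℝ → ℝ}

theorem hasGaussianLaw_gaussianPath_prodMk (h : IsTimeChangedGaussian L θ X P)
    (hk : IsSmoothingKernel k) {b t : ℝ} (hb : 0 < b) (ht : t ∈ Icc (0 : ℝ) 1) (s v : ℝ) :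
    ProbabilityTheory.HasGaussianLaw
      (fun ω => (gaussianPath k b X ω t, X v ω - X s ω)) P := by
  have := (h.hasGaussianLaw_prodMk hk hb ht s v).map_fun
    ((Real.sqrt b • ContinuousLinearMap.fst ℝ ℝ ℝ).prod (ContinuousLinearMap.snd ℝ ℝ ℝ))
  simpa [gaussianPath] using this

omit [IsProbabilityMeasure P] in
theorem stronglyMeasurable_abs_gaussianPath_add_rpow (h : IsTimeChangedGaussian L θ X P)
    (hk : IsSmoothingKernel k) {p : ℝ} (hp : 0 ≤ p) (b : ℝ) {g : ℝ → ℝ} (hg : Continuous g) :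
    StronglyMeasurable (Function.uncurry fun t ω => |gaussianPath k b X ω t + g t| ^ p) := by
  have h1 := (h.stronglyMeasurable_gaussianPath hk b).add
    (hg.stronglyMeasurable.comp_measurable (measurable_fst (β := Ω)))
  have h2 : Continuous fun z : ℝ => |z| ^ p := continuous_abs.rpow_const fun _ => Or.inr hp
  exact h2.comp_stronglyMeasurable h1

/-- Lower bound for the variance of the `L_p` norm of `Y_n + g` over a set on which `g` is large
and of constant sign, by comparison with an increment of the path. -/
theorem sq_le_variance_mul (h : IsTimeChangedGaussian L θ X P) (hk : IsSmoothingKernel k)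
    (hθ : 0 ≤ θ) {A : ℝ} {L' : ℝ → ℝ}
    (hA : ∀ u ∈ Icc (0 : ℝ) 1, ∀ v ∈ Icc (0 : ℝ) 1, |L u - L v| ≤ A * |u - v|)
    (hL : ∀ u ∈ Icc (0 : ℝ) 1, HasDerivWithinAt L (L' u) (Icc 0 1) u)
    (hL' : ContinuousOn L' (Icc 0 1)) {c : ℝ} (hc : 0 < c) (hcL : ∀ u ∈ Icc (0 : ℝ) 1, c ≤ L' u)
    {b : ℝ} (hb : 0 < b) (hb' : b ≤ 1 / 2) {μ : Measure ℝ} {R : Set ℝ} (hR : MeasurableSet R)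
    (hRI : R ⊆ Icc 0 1) (hμR : μ R ≠ ∞) {s v : ℝ} (hs : s ∈ Icc (0 : ℝ) 1) (hv : v ∈ Icc (0 : ℝ) 1)
    (hwin : ∀ t ∈ R, ∀ u ∈ Icc (0 : ℝ) 1, |t - u| < b → u ∈ Icc s v)
    (hsv : θ * (L v - L s) ≤ 1 / 2) {g : ℝ → ℝ} (hg : ContinuousOn g (Icc 0 1)) {σ γ D p : ℝ}
    (hσ : σ = 1 ∨ σ = -1) (hγ : 0 < γ) (hγg : ∀ t ∈ R, γ ≤ σ * g t) (hD : ∀ t ∈ Icc (0 : ℝ) 1,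
      ∃ v : ℝ≥0, P.map (fun ω => gaussianPath k b X ω t) = ProbabilityTheory.gaussianReal 0 v ∧
        Real.sqrt v ≤ D) (hDγ : 2 * normalAbsMoment 4 * D ^ 2 ≤ γ ^ 2) (hp : 1 ≤ p) :
    (μ.real R * (Real.sqrt b * (c / 4) * (p / 4 * γ ^ (p - 1)))) ^ 2 ≤
      ProbabilityTheory.variance (fun ω => ∫ t in R, |gaussianPath k b X ω t + g t| ^ p ∂μ) P *
        (A * |v - s|) := by
  have hp0 : 0 ≤ p := by linarith
  have hfin : IsFiniteMeasure (μ.restrict R) := ⟨by simpa using hμR.lt_top⟩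
  -- Extending `g` continuously to the line gives joint measurability of the integrand; nothing
  -- changes on `R`.
  set g' : ℝ → ℝ := fun t => g (projIcc 0 1 zero_le_one t)
  have hg' : Continuous g' := hg.domRestrict.comp continuous_projIcc
  have hgg : ∀ t ∈ Icc (0 : ℝ) 1, g' t = g t := fun t ht => by
    simp only [g', projIcc_of_mem zero_le_one ht]
  set W : ℝ → Ω → ℝ := fun t ω => |gaussianPath k b X ω t + g' t| ^ p with hWdef
  have hF : (fun ω => ∫ t in R, |gaussianPath k b X ω t + g t| ^ p ∂μ) =
      fun ω => ∫ t in R, W t ω ∂μ := by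
    ext ω
    exact setIntegral_congr_fun hR fun t ht => by simp only [hWdef, hgg t (hRI ht)]
  have hW := h.stronglyMeasurable_abs_gaussianPath_add_rpow hk hp0 b hg'
  obtain ⟨Mg, hMg⟩ := hg.exists_abs_le_unit
  have hM4 := normalAbsMoment_nonneg 4
  have hM : ∀ᵐ t ∂(μ.restrict R), Integrable (fun ω => W t ω ^ 2) P ∧ ∫ ω, W t ω ^ 2 ∂P ≤
      2 ^ (2 * p) * (D ^ (2 * p) * normalAbsMoment (2 * p) + Mg ^ (2 * p)) := by
    filter_upwards [ae_restrict_mem hR] with t ht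
    obtain ⟨v, hv, hvD⟩ := hD t (hRI ht)
    refine integrable_sq_abs_add_rpow_of_map hv hvD hp0 ?_
    rw [hgg t (hRI ht)]
    exact hMg t (hRI ht)
  set N : Ω → ℝ := fun ω => X v ω - X s ω with hN
  have hNm : Measurable N := (h.measurable v).sub (h.measurable s)
  have hN2 : MemLp N 2 P := (h.memLp_two v).sub (h.memLp_two s)
  have hN0 : ∫ ω, N ω ∂P = 0 := by
    rw [hN, integral_sub (h.integrable v) (h.integrable s), h.mean, h.mean, sub_zero]
  have hFL := memLp_two_integral hW hM
  obtain ⟨hint, hswap⟩ := integral_integral_mul hW hM hNm hN2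
  have hCS := sq_integral_mul_le_variance_mul hFL hN2 hN0
  rw [hF]
  set V := ProbabilityTheory.variance (fun ω => ∫ t in R, W t ω ∂μ) P
  have hV : 0 ≤ V := ProbabilityTheory.variance_nonneg _ _
  have hNN : ∫ ω, N ω ^ 2 ∂P ≤ A * |v - s| := h.integral_sq_sub_le hθ hA hv hs
  set κ := Real.sqrt b * (c / 4)
  have hκ : 0 < κ := by positivity
  have hpt : ∀ t ∈ R, κ * (p / 4 * γ ^ (p - 1)) ≤ σ * ∫ ω, W t ω * N ω ∂P := by
    intro t ht
    obtain ⟨w, hw, hwD⟩ := hD t (hRI ht)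
    have hgt := hγg t ht
    have hw2 : (w : ℝ) ≤ D ^ 2 := by
      rw [← Real.sq_sqrt w.coe_nonneg]; gcongr
    -- The smoothed clock speed is at least `c / 2` and the bridge factor at least `1 / 2` by `hsv`,
    -- which gives the `c / 4` in `κ`.
    have hYN : κ ≤ ∫ ω, gaussianPath k b X ω t * N ω ∂P := by
      have h1 := h.integral_smoothed_mul hk hθ hA hL hL' hb hs hv (hwin t ht)
      have h2 := hk.le_integral_rescaledKernel_mul hL' hc.le hcL hb hb' (hRI ht)
      simp only [gaussianPath, mul_assoc]
      rw [integral_const_mul, h1]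
      refine mul_le_mul_of_nonneg_left ?_ (Real.sqrt_nonneg b)
      nlinarith
    have h3 := le_mul_integral_abs_add_rpow_mul (h.hasGaussianLaw_gaussianPath_prodMk hk hb
      (hRI ht) s v) hw hN0 hp hσ (hγ.trans_le hgt) (le_trans (by gcongr)
        (hDγ.trans (by gcongr))) hκ hYN
    simp only [hWdef, hgg t (hRI ht)]
    refine le_trans ?_ h3
    gcongr
  have hlow : μ.real R * (κ * (p / 4 * γ ^ (p - 1))) ≤ σ * ∫ t in R, (∫ ω, W t ω * N ω ∂P) ∂μ := by
    rw [← integral_const_mul, ← smul_eq_mul, ← setIntegral_const]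
    exact setIntegral_mono_on (integrable_const _) (hint.const_mul σ) hR hpt
  have hσ2 : σ ^ 2 = 1 := by rcases hσ with rfl | rfl <;> norm_num
  calc _ ≤ (σ * ∫ t in R, (∫ ω, W t ω * N ω ∂P) ∂μ) ^ 2 := by gcongr
    _ = (∫ ω, (∫ t in R, W t ω ∂μ) * N ω ∂P) ^ 2 := by rw [mul_pow, hσ2, one_mul, hswap]
    _ ≤ _ := hCS
    _ ≤ _ := by gcongr

end IsTimeChangedGaussian

/-- Near an endpoint of `[0, 1]`, a window of length `2 b` contains all the smoothing windows. -/
theorem exists_window {e : ℝ} (he : e ∈ ({0, 1} : Set ℝ)) {b c : ℝ} (hb : 0 < b) (hb' : b ≤ 1 / 2)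
    (hc : c ≤ 1) : ∃ s ∈ Icc (0 : ℝ) 1, ∃ v ∈ Icc (0 : ℝ) 1, v - s = 2 * b ∧
      ∀ t ∈ endRegion e (c * b), ∀ u ∈ Icc (0 : ℝ) 1, |t - u| < b → u ∈ Icc s v := by
  have hcb : c * b ≤ b := mul_le_of_le_one_left hb.le hc
  rcases he with rfl | rfl
  · refine ⟨0, by simp, 2 * b, ⟨by linarith, by linarith⟩, by ring, fun t ht u hu htu => ?_⟩
    have h1 := (abs_le.1 ht.2).2
    exact ⟨hu.1, by linarith [(abs_lt.1 htu).1]⟩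
  · refine ⟨1 - 2 * b, ⟨by linarith, by linarith⟩, 1, by simp, by ring, fun t ht u hu htu => ?_⟩
    have h1 := (abs_le.1 ht.2).1
    exact ⟨by linarith [(abs_lt.1 htu).2], hu.2⟩

namespace StrongApproximation

variable {k lam L : ℝ → ℝ} {θ q Cq : ℝ} {μ : Measure ℝ} {Ω : ℕ → Type*}
    [∀ n, MeasurableSpace (Ω n)] {P : ∀ n, Measure (Ω n)} [∀ n, IsProbabilityMeasure (P n)]
    {Lam X : ∀ n, ℝ → Ω n → ℝ} {b : ℕ → ℝ}

/-- The variance of the `L_p` norm of `Y_n + g_(n)` over a boundary region is of larger order than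
the bandwidth, if `b n^{1 - 1/p} → ∞`. -/
theorem tendsto_variance (h : StrongApproximation k lam L θ q Cq μ P Lam X b) {p : ℝ}
    (hp : 1 ≤ p) {e : ℝ} (he : e ∈ ({0, 1} : Set ℝ)) (hlame : lam e ≠ 0)
    (hwe : ∃ a > 0, ∃ r₀ > 0, ∀ r, 0 ≤ r → r ≤ r₀ → ENNReal.ofReal (a * r) ≤ μ (endRegion e r))
    {L' : ℝ → ℝ} (hL : ∀ u ∈ Icc (0 : ℝ) 1, HasDerivWithinAt L (L' u) (Icc 0 1) u)
    (hL' : ContinuousOn L' (Icc 0 1)) {cL : ℝ} (hcL : 0 < cL)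
    (hcL' : ∀ u ∈ Icc (0 : ℝ) 1, cL ≤ L' u)
    (hbn : Tendsto (fun n : ℕ => b n * (n : ℝ) ^ (1 - 1 / p)) atTop atTop) {c : ℝ}
    (hc : c ∈ Ioo (0 : ℝ) 1) :
    Tendsto (fun n : ℕ => (b n)⁻¹ * ProbabilityTheory.variance
      (fun ω => ∫ t in endRegion e (c * b n),
        |gaussianPath k (b n) (X n) ω t + scaledBias k lam n (b n) t| ^ p ∂μ) (P n))
      atTop atTop := by
  obtain ⟨hc0, hc1⟩ := hc
  obtain ⟨A₀, hA₀⟩ := h.clock_lipschitz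
  obtain ⟨A, hA0, hA⟩ : ∃ A > 0, ∀ u ∈ Icc (0 : ℝ) 1, ∀ v ∈ Icc (0 : ℝ) 1,
      |L u - L v| ≤ A * |u - v| :=
    ⟨|A₀| + 1, by positivity, fun u hu v hv => (hA₀ u hu v hv).trans
      (mul_le_mul_of_nonneg_right (by linarith [le_abs_self A₀]) (abs_nonneg _))⟩
  obtain ⟨Al, hAl⟩ := h.lam_lipschitz
  obtain ⟨σ, hσ, a₁, ha₁, b₁, hb₁, hbias⟩ := h.kernel.exists_le_scaledBias h.lam_continuousOn hAl
    (by linarith : -1 < c) hc1 he hlame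
  obtain ⟨a₂, ha₂, r₀, hr₀, hμr⟩ := hwe
  obtain ⟨D, hD0, hD⟩ := h.kernel.exists_gaussianPath_law hA h.theta_nonneg
  have hθ := h.theta_nonneg
  have hp0 : 0 < p := by linarith
  set K := a₂ * c * (cL / 4) * (p / 4 * a₁ ^ (p - 1)) with hK
  have hK0 : 0 < K := by positivity
  have hlim : Tendsto (fun n : ℕ => K ^ 2 / (2 * A) * (b n * (n : ℝ) ^ (1 - 1 / p)) ^ p) atTop
      atTop := ((tendsto_rpow_atTop hp0).comp hbn).const_mul_atTop (by positivity)
  have hG : ∀ᶠ n : ℕ in atTop, 2 * normalAbsMoment 4 * D ^ 2 ≤ (a₁ * Real.sqrt (n * b n)) ^ 2 := by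
    have h1 : Tendsto (fun n : ℕ => a₁ ^ 2 * ((n : ℝ) * b n)) atTop atTop :=
      h.nb.const_mul_atTop (by positivity)
    filter_upwards [h1.eventually_ge_atTop (2 * normalAbsMoment 4 * D ^ 2)] with n hn
    have hb := h.b_pos n
    rwa [mul_pow, Real.sq_sqrt (by positivity)]
  -- For small bandwidths the bridge correction over a window of length `2 b` is at most one half;
  -- for Brownian motion it is zero.
  have hθA : ∀ᶠ n in atTop, θ * (A * (2 * b n)) ≤ 1 / 2 := by
    have h1 := ((h.b_zero.const_mul 2).const_mul A).const_mul θ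
    simp only [mul_zero] at h1
    exact h1.eventually (ge_mem_nhds (by norm_num))
  refine tendsto_atTop_mono' _ ?_ hlim
  filter_upwards [h.eventually_le_one, hG, hθA, h.b_zero.eventually (ge_mem_nhds hb₁),
    h.b_zero.eventually (ge_mem_nhds hr₀),
    h.b_zero.eventually (ge_mem_nhds (by norm_num : (0 : ℝ) < 1 / 2))] with n hn hGn hθn hnb hnr hn2
  have hb := h.b_pos n
  have hn0 : (0 : ℝ) < n := by exact_mod_cast hn.1
  obtain ⟨s, hs, v, hv, hsv, hwin⟩ := exists_window he hb hn2 hc1.le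
  have hvs : |v - s| = 2 * b n := by rw [hsv, abs_of_pos (by positivity)]
  have hμR : μ (endRegion e (c * b n)) ≠ ∞ :=
    ((measure_mono (endRegion_subset _ _)).trans_lt h.measure_unit_ne_top.lt_top).ne
  have hcb : c * b n ≤ b n := mul_le_of_le_one_left hb.le hc1.le
  have hμ' : a₂ * (c * b n) ≤ μ.real (endRegion e (c * b n)) :=
    (ENNReal.ofReal_le_iff_le_toReal hμR).1 (hμr _ (by positivity) (by linarith))
  have hLsv : θ * (L v - L s) ≤ 1 / 2 := by
    refine le_trans (mul_le_mul_of_nonneg_left ?_ hθ) hθn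
    rw [← hvs]
    exact (le_abs_self _).trans (hA v hv s hs)
  have hGpos : 0 < Real.sqrt (n * b n) := by linarith [hn.2.2]
  have key := (h.gaussian n).sq_le_variance_mul h.kernel hθ hA hL hL' hcL hcL' hb hn2
    (measurableSet_endRegion e (c * b n)) (endRegion_subset _ _) hμR hs hv hwin hLsv
    (h.kernel.continuousOn_scaledBias h.lam_continuousOn n (b n)) hσ (by positivity)
    (hbias (b n) hb hnb n) (fun t ht => hD (h.gaussian n) (b n) hb t ht) hGn hp
  set V := ProbabilityTheory.variance (fun ω => ∫ t in endRegion e (c * b n),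
        |gaussianPath k (b n) (X n) ω t + scaledBias k lam n (b n) t| ^ p ∂μ) (P n)
  set G := Real.sqrt (n * b n) with hGdef
  -- The region contributes `b`, the covariance `√b * G ^ (p - 1)`, and the increment has second
  -- moment at most `2 A b`. By `sq_sqrt_mul_rpow`, the square of `√b * G ^ (p - 1)` is the power of
  -- `b n^{1-1/p}`.
  have hlow : (K * b n) ^ 2 * (b n * (n : ℝ) ^ (1 - 1 / p)) ^ p ≤ V * (A * (2 * b n)) := by
    rw [← hvs]
    refine le_trans ?_ key
    rw [← sq_sqrt_mul_rpow hp0 hn0 hb, ← mul_pow, Real.mul_rpow ha₁.le hGpos.le]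
    refine pow_le_pow_left₀ (by positivity) ?_ 2
    calc _ = a₂ * (c * b n) * (Real.sqrt (b n) * (cL / 4) *
          (p / 4 * (a₁ ^ (p - 1) * G ^ (p - 1)))) := by rw [hK]; ring
      _ ≤ _ := by gcongr
  rw [inv_mul_eq_div, le_div_iff₀ hb]
  have h2 : 0 < A * (2 * b n) := by positivity
  refine le_of_mul_le_mul_right (le_trans (le_of_eq ?_) hlow) h2
  field_simp

end StrongApproximation

/-! ### Return to the original processes and conclusion. -/

theorem TendstoZeroInProb.congr {Ω : ℕ → Type*} [∀ n, MeasurableSpace (Ω n)]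
    {P : ∀ n, Measure (Ω n)} {Z Z' : ∀ n, Ω n → ℝ} (h : TendstoZeroInProb P Z)
    (hZ : ∀ n, Z n =ᵐ[P n] Z' n) : TendstoZeroInProb P Z' := by
  intro ε hε
  refine (h ε hε).congr fun n => measure_congr (eventuallyEq_set.2 ?_)
  filter_upwards [hZ n] with ω hω
  rw [hω]

theorem IsTimeChangedGaussian.gaussianSmooth_eq {Ω : Type*} [MeasurableSpace Ω] {P : Measure Ω}
    {L : ℝ → ℝ} {θ : ℝ} {X : ℝ → Ω → ℝ} (h : IsTimeChangedGaussian L θ X P) {k : ℝ → ℝ}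
    (hk : IsSmoothingKernel k) {B : ℝ≥0 → Ω → ℝ} {ω : Ω}
    (hω : ∀ u ∈ Icc (0 : ℝ) 1, timeChanged B L ω u = X u ω) {b t : ℝ} (hb : 0 < b)
    (ht : t ∈ Icc (0 : ℝ) 1) : gaussianSmooth k b B L ω t = gaussianPath k b X ω t := by
  have hc : ContinuousOn (timeChanged B L ω) (Icc 0 1) := (h.continuous ω).continuousOn.congr hω
  rw [gaussianSmooth, gaussianPath, hc.isCadlagOnUnit.isRegulatedOnUnit.kernelSmooth_eq hk hb ht]
  congr 1
  exact smoothed_congr hω t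

/-- A Brownian motion or bridge, run along the clock `L`, agrees almost surely with a time-changed
Gaussian process. -/
theorem exists_isTimeChangedGaussian_of_brownian {Ω : ℕ → Type*} [∀ n, MeasurableSpace (Ω n)]
    {P : ∀ n, Measure (Ω n)} {B : ∀ n, ℝ≥0 → Ω n → ℝ} {L : ℝ → ℝ} (hL0 : 0 ≤ L 0)
    (hL : MonotoneOn L (Icc 0 1)) (hLc : ContinuousOn L (Icc 0 1))
    (hB : (∀ n, ProbabilityTheory.IsBrownianReal (B n) (P n)) ∨
      ∀ n, IsBrownianBridge (L 1).toNNReal (B n) (P n)) :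
    ∃ θ, 0 ≤ θ ∧ ∃ X : ∀ n, ℝ → Ω n → ℝ, ∀ n, IsTimeChangedGaussian L θ (X n) (P n) ∧
      ∀ᵐ ω ∂(P n), ∀ u ∈ Icc (0 : ℝ) 1, timeChanged (B n) L ω u = X n u ω := by
  rcases hB with hB | hB
  · refine ⟨0, le_rfl, ?_⟩
    have h : ∀ n, ∃ X : ℝ → Ω n → ℝ, IsTimeChangedGaussian L 0 X (P n) ∧
        ∀ᵐ ω ∂(P n), ∀ u ∈ Icc (0 : ℝ) 1, timeChanged (B n) L ω u = X u ω := fun n => by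
      have hG := ProbabilityTheory.IsPreBrownianReal.isGaussianProcess (hB n).toIsPreBrownianReal
      refine exists_isTimeChangedGaussian hL0 hL hLc
        (hG.comp_right fun t : Icc (0 : ℝ≥0) (L 1).toNNReal => (t : ℝ≥0))
        (fun t _ => (hB n).integral_eval t) (fun s t hst _ => ?_) ?_
      · rw [(hB n).covariance_eval, min_eq_left hst]
        simp
      · filter_upwards [(hB n).cont] with ω hω using hω.continuousOn
    choose X hX using h
    exact ⟨X, hX⟩
  -- The bridge of length `T = L 1` has covariance `s - s t / T`, so `θ = 1 / T`.
  · refine ⟨((L 1).toNNReal : ℝ)⁻¹, by positivity, ?_⟩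
    have h : ∀ n, ∃ X : ℝ → Ω n → ℝ, IsTimeChangedGaussian L ((L 1).toNNReal : ℝ)⁻¹ X (P n) ∧
        ∀ᵐ ω ∂(P n), ∀ u ∈ Icc (0 : ℝ) 1, timeChanged (B n) L ω u = X u ω := fun n => by
      refine exists_isTimeChangedGaussian hL0 hL hLc (hB n).gaussian (hB n).mean
        (fun s t hst ht => ?_) (hB n).continuous
      rw [(hB n).covariance s t hst ht]
      ring
    choose X hX using h
    exact ⟨X, hX⟩

theorem mainTheorem8
    -- the kernel
    (k : ℝ → ℝ) (hk : IsSmoothingKernel k)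
    -- the decreasing function `λ` on `[0, 1]`
    (lam : ℝ → ℝ) (hlam_anti : AntitoneOn lam (Icc 0 1)) (hlam_C2 : ContDiffOn ℝ 2 lam (Icc 0 1))
    (hlam_deriv : ∃ c > 0, ∀ t ∈ Icc (0 : ℝ) 1, c ≤ |derivWithin lam (Icc 0 1) t|)
    -- the time change `L` on `[0, 1]`
    (L : ℝ → ℝ) (hL_zero : 0 ≤ L 0) (hL_mono : StrictMonoOn L (Icc 0 1))
    (hL_diff : DifferentiableOn ℝ L (Icc 0 1))
    (hL_diff2 : DifferentiableOn ℝ (derivWithin L (Icc 0 1)) (Icc 0 1))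
    (hL_deriv2 : ∃ C, ∀ t ∈ Icc (0 : ℝ) 1,
      |derivWithin (derivWithin L (Icc 0 1)) (Icc 0 1) t| ≤ C)
    (hL_deriv : ∃ c > 0, ∀ t ∈ Icc (0 : ℝ) 1, c ≤ derivWithin L (Icc 0 1) t)
    -- the measure `dμ(t) = w(t) dt` on `[0, 1]`
    (μ : Measure ℝ) (w : ℝ → ℝ) (hw_nonneg : ∀ t ∈ Icc (0 : ℝ) 1, 0 ≤ w t)
    (hw_cont : ContinuousOn w (Icc 0 1))
    (hμ : μ.restrict (Icc 0 1) =
      (volume.restrict (Icc 0 1)).withDensity fun t => ENNReal.ofReal (w t))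
    -- the estimators `Λ_n` and the approximating processes `B_n`
    {Ω : ℕ → Type*} [∀ n, MeasurableSpace (Ω n)] (P : ∀ n, Measure (Ω n))
    [∀ n, IsProbabilityMeasure (P n)]
    (Lam : ∀ n, ℝ → Ω n → ℝ) (hLam_meas : ∀ n, ∀ t ∈ Icc (0 : ℝ) 1, Measurable (Lam n t))
    (hLam_cadlag : ∀ n ω, IsCadlagOnUnit fun t => Lam n t ω)
    (B : ∀ n, ℝ≥0 → Ω n → ℝ)
    (hB : (∀ n, ProbabilityTheory.IsBrownianReal (B n) (P n)) ∨
      ∀ n, IsBrownianBridge (L 1).toNNReal (B n) (P n))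
    (q Cq : ℝ) (hq : 5 / 2 < q) (hCq : 0 < Cq)
    (hcoupling : ∀ n : ℕ, ∀ x ∈ Ioc (0 : ℝ) n,
      P n {ω | ∃ t ∈ Icc (0 : ℝ) 1, x < (n : ℝ) ^ (1 - 1 / q) *
          |(Lam n t ω - ∫ u in (0 : ℝ)..t, lam u)
            - (Real.sqrt n)⁻¹ * timeChanged (B n) L ω t|}
        ≤ ENNReal.ofReal (Cq * x ^ (-q)))
    -- the exponent and the bandwidth
    (p : ℝ) (hp : 1 ≤ p) (b : ℕ → ℝ) (hb_pos : ∀ n, 0 < b n) (hb_zero : Tendsto b atTop (𝓝 0))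
    (hnb : Tendsto (fun n : ℕ => (n : ℝ) * b n) atTop atTop) :
    -- the claims at each endpoint `e` of `[0, 1]`
    ∀ e ∈ ({0, 1} : Set ℝ),
      -- (i)
      (0 < w e → lam e ≠ 0 →
        Tendsto (fun n : ℕ => (n : ℝ) * b n ^ 3) atTop atTop →
        Tendsto (fun n : ℕ => ENNReal.ofReal (((n : ℝ) * b n) ^ (p / 2)) *
            ∫⁻ ω, ENNReal.ofReal (∫ t in endRegion e (b n),
              |kernelSmooth k (b n) (fun u => Lam n u ω) t - lam t| ^ p ∂μ) ∂(P n))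
          atTop (𝓝 ∞)) ∧
      -- (ii)
      (Tendsto (fun n : ℕ => b n * (n : ℝ) ^ (1 - 1 / p)) atTop (𝓝 0) →
        (2 * p ≤ q ∨ CouplingRates p q b) →
        TendstoZeroInProb P fun n ω => (Real.sqrt (b n))⁻¹ *
          ((∫ t in endRegion e (b n), ((n : ℝ) * b n) ^ (p / 2) *
              |kernelSmooth k (b n) (fun u => Lam n u ω) t - lam t| ^ p ∂μ)
            - ∫ t in endRegion e (b n), |scaledBias k lam n (b n) t| ^ p ∂μ)) ∧
      -- (iii)
      (CouplingRates p q b →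
        (TendstoZeroInProb P fun n ω => (Real.sqrt (b n))⁻¹ *
          |(∫ t in endRegion e (b n), ((n : ℝ) * b n) ^ (p / 2) *
              |kernelSmooth k (b n) (fun u => Lam n u ω) t - lam t| ^ p ∂μ)
            - ∫ t in endRegion e (b n),
                |gaussianSmooth k (b n) (B n) L ω t + scaledBias k lam n (b n) t| ^ p ∂μ|) ∧
        (0 < w e → lam e ≠ 0 →
          Tendsto (fun n : ℕ => b n * (n : ℝ) ^ (1 - 1 / p)) atTop atTop →
          ∀ c ∈ Ioo (0 : ℝ) 1,
            Tendsto (fun n : ℕ => (b n)⁻¹ *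
                ProbabilityTheory.variance (fun ω => ∫ t in endRegion e (c * b n),
                  |gaussianSmooth k (b n) (B n) L ω t + scaledBias k lam n (b n) t| ^ p ∂μ)
                (P n)) atTop atTop)) := by
  have hlamc : ContinuousOn lam (Icc 0 1) := hlam_C2.continuousOn
  have hlam' : ∀ u ∈ Icc (0 : ℝ) 1, HasDerivWithinAt lam (derivWithin lam (Icc 0 1) u) (Icc 0 1) u :=
    fun u hu => ((hlam_C2.differentiableOn (by norm_num)) u hu).hasDerivWithinAt
  have hlam'c : ContinuousOn (derivWithin lam (Icc 0 1)) (Icc 0 1) :=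
    hlam_C2.continuousOn_derivWithin (uniqueDiffOn_Icc zero_lt_one) (by norm_num)
  have hL' : ∀ u ∈ Icc (0 : ℝ) 1, HasDerivWithinAt L (derivWithin L (Icc 0 1) u) (Icc 0 1) u :=
    fun u hu => (hL_diff u hu).hasDerivWithinAt
  have hL'c := hL_diff2.continuousOn
  obtain ⟨cL, hcL, hcL'⟩ := hL_deriv
  obtain ⟨θ, hθ, X, hX⟩ := exists_isTimeChangedGaussian_of_brownian hL_zero hL_mono.monotoneOn
    hL_diff.continuousOn hB
  have h : StrongApproximation k lam L θ q Cq μ P Lam X b :=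
    { kernel := hk
      lam_continuousOn := hlamc
      lam_lipschitz := exists_lipschitz_of_hasDerivWithinAt hlam' hlam'c
      clock_lipschitz := exists_lipschitz_of_hasDerivWithinAt hL' hL'c
      theta_nonneg := hθ
      cadlag := hLam_cadlag
      gaussian := fun n => (hX n).1
      q_gt := hq
      coupling := fun n x hx => by
        -- The path along the clock agrees with `X n` only almost surely, so the failure events are
        -- compared up to a null set.
        refine le_trans (measure_mono_ae ?_) (hcoupling n x hx)
        filter_upwards [(hX n).2] with ω hω hmem
        obtain ⟨t, ht, hlt⟩ := hmem
        exact ⟨t, ht, by rwa [hω t ht]⟩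
      weight := exists_measure_endRegion_le hw_cont hμ
      b_pos := hb_pos
      b_zero := hb_zero
      nb := hnb }
  have hG : ∀ n (e r : ℝ), (fun ω => ∫ t in endRegion e r,
      |gaussianPath k (b n) (X n) ω t + scaledBias k lam n (b n) t| ^ p ∂μ) =ᵐ[P n]
      fun ω => ∫ t in endRegion e r,
        |gaussianSmooth k (b n) (B n) L ω t + scaledBias k lam n (b n) t| ^ p ∂μ := by
    intro n e r
    filter_upwards [(hX n).2] with ω hω
    refine setIntegral_congr_fun (measurableSet_endRegion e r) fun t ht => ?_
    simp only [(hX n).1.gaussianSmooth_eq hk hω (hb_pos n) ht.1]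
  intro e he
  refine ⟨fun hwe hlame hb3 => h.tendsto_lintegral_error hp he hlame
    (exists_le_measure_endRegion hw_cont hμ he hwe) hb3, fun hbn hrate => ?_, fun hrate => ⟨?_, ?_⟩⟩
  · have hγ := tendsto_sqrt_mul_rpow hp hb_pos hbn
    rcases hrate with hpq | hrate
    · exact h.tendstoZeroInProb_error_sub_bias hp e
        (tendsto_mul_of_two_mul_le hp hq hpq hb_pos hbn)
        (tendsto_rpow_of_two_mul_le hp hq hpq hb_pos hnb) hγ
    · exact h.tendstoZeroInProb_error_sub_bias hp e (hrate.tendsto_mul hb_pos)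
        (hrate.tendsto_rpow hp hb_pos) hγ
  · refine (h.tendstoZeroInProb_error_sub_gaussian hp e (hrate.tendsto_mul hb_pos)
      (hrate.tendsto_rpow hp hb_pos)).congr fun n => ?_
    filter_upwards [hG n e (b n)] with ω hω
    rw [hω]
  · intro hwe hlame hbn c hc
    refine (h.tendsto_variance hp he hlame (exists_le_measure_endRegion hw_cont hμ he hwe) hL' hL'c
      hcL hcL' hbn hc).congr fun n => ?_
    rw [ProbabilityTheory.variance_congr (hG n e (c * b n))]
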